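/- **The formal two-matrix model.** Let $V_1,V_2\in\mathbb C[x]$ be polynomials of degrees $d_1+1$ and $d_2+1$, and let $(\xi_i,\eta_i)\in\mathbb C^2$, $1\le i\le d_1d_2$, be pairwise distinct solutions of $V_1'(\xi_i)=\eta_i$, $V_2'(\eta_i)=\xi_i$, with $V_1''(\xi_i)V_2''(\eta_i)\neq 1$. Let $n_i\ge 0$ be integers, $N=\sum_i n_i\ge 1$, and $\epsilon_i=n_i/N$. Put $$q_i(x,y)=\tfrac{V_1''(\xi_i)}2x^2+\tfrac{V_2''(\eta_i)}2y^2-xy,$$ and let $\delta V_{1,i}$ and $\delta V_{2,i}$ be the parts of order at least $3$ of the Taylor expansions of $V_1$ at $\xi_i$ and of $V_2$ at $\eta_i$. For $T>0$ let $\langle\cdot\rangle_T$ be the mean value for the normalized Gaussian measure proportional to $\prod_i e^{-\frac NT\operatorname{Tr}q_i(m_i,\tilde m_i)}\,dm_i\,d\tilde m_i$, where $\operatorname{Tr}q_i(m,\tilde m)=\operatorname{Tr}\bigl(\frac{V_1''(\xi_i)}2m^2+\frac{V_2''(\eta_i)}2\tilde m^2-m\tilde m\bigr)$. Here the pair of $n_i\times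 n_i$ matrices $(m_i,\tilde m_i)$ runs over the image of the pairs of Hermitian matrices (with Lebesgue measure) under a matrix $A_i\in M_2(\mathbb C)$ such that $\operatorname{Re}q_i$ is positive definite on $A_i\mathbb R^2$; one may take $A_i=1$, i.e. Hermitian $m_i,\tilde m_i$, when $\operatorname{Re} q_i$ is positive definite on $\mathbb R^2$. Put $M_i=\xi_i+m_i$, $\tilde M_i=\eta_i+\tilde m_i$, and $$P_l(T)=\frac{(-1)^lN^l}{l!\,T^l}\Bigl\langle\Bigl(\sum_i\operatorname{Tr}\bigl(\delta V_{1,i}(M_i)+\delta V_{2,i}(\tilde M_i)\bigr)\Bigr)^l\prod_{i>j}\det(M_i\otimes 1-1\otimes M_j)\det(\tilde M_i\otimes 1-1\otimes\tilde M_j)\Bigr\rangle_T .$$ Such $A_i$ exist, the Gaussian integrals converge absolutely with a non-zero normalization, $P_l(T)=\sum_kA_{k,l}T^k$ is a polynomial in $T$, and $A_{k,l}=0$ for $2k<l$. One defines, as a formal exponential $e^{a/T}$ times a formal power series in $T$, $$\mathcal Z_{form}=e^{-\frac NT\sum_in_i(V_1(\xi_i)+V_2(\eta_i)-\xi_i\eta_i)}\sum_{k\ge0}T^k\sum_{j=0}^{2k}A_{k,j}.$$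 **Graphs.** Let $\mathcal G$ be the set of isomorphism classes of finite closed fat graphs, possibly empty or disconnected (vertices of valence $k\ge1$ with a cyclic order of their legs, the legs being glued in pairs by orientable ribbons), whose vertices carry a colour $i\in\{1,\dots,d_1d_2\}$ and a spin $\pm$, legs being glued only between vertices of the same colour, and in which moreover some disjoint pairs of vertices of equal spins and different colours are linked by their centres; a vertex in no such pair is called free. Put $$t_{k,i}=\frac{V_1^{(k)}(\xi_i)}{(k-1)!},\qquad h_{k,i}=\sum_{j\ne i}\frac{\epsilon_j}{(\xi_j-\xi_i)^k},\qquad h_{k,i;l,j}=\frac{(k+l-1)!}{(k-1)!\,(l-1)!}\,\frac1{(\xi_j-\xi_i)^k(\xi_i-\xi_j)^l},$$ and let $\tilde t_{k,i},\tilde h_{k,i},\tilde h_{k,i;l,j}$ be the same quantities for $V_2,\eta$. For $G\in\mathcal G$ let $n_{++,i},n_{--,i},n_{a,i}$ be the numbers of edges of colour $i$ between two spins $+$, between two spins $-$, and in all; let $l_i$ be the number of borders of ribbons (faces) of colour $i$; let $c$ be the number of free vertices plus the number of linked pairs; let $\chi=\sum_i(l_i-n_{a,i})+\#\{\text{free vertices}\}$;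 and let $n_T$ be half the sum of the valences of all the vertices minus the number of free vertices whose valence $k$ satisfies $3\le k\le d_1+1$ (spin $+$) or $3\le k\le d_2+1$ (spin $-$). The weight of $G$ is $$\mathcal W(G)=\frac{(-1)^{c}N^{\chi}}{\#\mathrm{Aut}(G)}\,T^{n_T}\prod_{v\ \mathrm{free}}w_v\ \prod_{\text{linked pairs}}h_{k,i;l,j}\ \prod_i\epsilon_i^{\,l_i}\;\tilde t_{2,i}^{\;n_{++,i}}\;t_{2,i}^{\;n_{--,i}}\;(t_{2,i}\tilde t_{2,i}-1)^{-n_{a,i}},$$ where a free vertex of spin $+$, valence $k$ and colour $i$ has $w_v=t_{k,i}+Th_{k,i}$ if $3\le k\le d_1+1$ and $w_v=h_{k,i}$ otherwise, the same with tildes and $d_2$ for spin $-$, and a linked pair of vertices of valences $k,l$ and colours $i<j$ contributes $h_{k,i;l,j}$ (spin $+$) or $\tilde h_{k,i;l,j}$ (spin $-$). **Theorem.** For every $m$ only finitely many $G\in\mathcal G$ have $n_T(G)\le m$, hence only finitely many contribute to the coefficient of $T^m$ in $\sum_{G\in\mathcal G}\mathcal W(G)$, and, for every admissible choice of the $A_i$,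 $$\mathcal Z_{form}=\prod_ie^{-\frac{N^2}T\epsilon_i(V_1(\xi_i)+V_2(\eta_i)-\xi_i\eta_i)}\ \prod_{j>i}\bigl[(\xi_i-\xi_j)(\eta_i-\eta_j)\bigr]^{N^2\epsilon_i\epsilon_j}\ \sum_{G\in\mathcal G}\mathcal W(G).$$ -/

import Mathlib

open Polynomial
open scoped Kronecker

noncomputable section

/-- The two possible spins of a vertex: `true` is `+`, `false` is `-`. -/
abbrev Spin := Bool

/-! ### Coloured fat graphs with spins -/

/-- A closed fat graph whose vertices carry a colour in `ι` and a spin.  Half-edges ("legs") are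
called darts; `next` is the cyclic order of the legs around the vertices, `glue` is the gluing of
the legs in pairs, and `link` is the gluing of the centres: a fixed point of `link` is a vertex
whose centre is free.  All vertices have valence at least one. -/
structure FatGraph (ι : Type) where
  numVert : ℕ
  numDart : ℕ
  vertOf : Fin numDart → Fin numVert
  next : Equiv.Perm (Fin numDart)
  glue : Equiv.Perm (Fin numDart)
  color : Fin numVert → ι
  spin : Fin numVert → Spin
  link : Equiv.Perm (Fin numVert)
  vertOf_surjective : Function.Surjective vertOf
  sameCycle_next_iff : ∀ a b, next.SameCycle a b ↔ vertOf a = vertOf b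
  glue_glue : ∀ a, glue (glue a) = a
  glue_ne : ∀ a, glue a ≠ a
  color_glue : ∀ a, color (vertOf (glue a)) = color (vertOf a)
  link_link : ∀ v, link (link v) = v
  spin_link : ∀ v, spin (link v) = spin v
  color_link : ∀ v, link v ≠ v → color (link v) ≠ color v

namespace FatGraph

variable {ι : Type}

/-- Isomorphisms of fat graphs: bijections of vertices and darts preserving all the structure. -/
structure Iso (G H : FatGraph ι) where
  vert : Fin G.numVert ≃ Fin H.numVert
  dart : Fin G.numDart ≃ Fin H.numDart
  vertOf_dart : ∀ a, H.vertOf (dart a) = vert (G.vertOf a)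
  next_dart : ∀ a, H.next (dart a) = dart (G.next a)
  glue_dart : ∀ a, H.glue (dart a) = dart (G.glue a)
  color_vert : ∀ v, H.color (vert v) = G.color v
  spin_vert : ∀ v, H.spin (vert v) = G.spin v
  link_vert : ∀ v, H.link (vert v) = vert (G.link v)

/-- The identity isomorphism. -/
def Iso.refl (G : FatGraph ι) : Iso G G :=
  ⟨Equiv.refl _, Equiv.refl _, fun _ => rfl, fun _ => rfl, fun _ => rfl, fun _ => rfl,
    fun _ => rfl, fun _ => rfl⟩

/-- The inverse isomorphism. -/
def Iso.symm {G H : FatGraph ι} (f : Iso G H) : Iso H G where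
  vert := f.vert.symm
  dart := f.dart.symm
  vertOf_dart a := by
    rw [Equiv.eq_symm_apply, ← f.vertOf_dart, Equiv.apply_symm_apply]
  next_dart a := by
    rw [Equiv.eq_symm_apply, ← f.next_dart, Equiv.apply_symm_apply]
  glue_dart a := by
    rw [Equiv.eq_symm_apply, ← f.glue_dart, Equiv.apply_symm_apply]
  color_vert v := by rw [← f.color_vert, Equiv.apply_symm_apply]
  spin_vert v := by rw [← f.spin_vert, Equiv.apply_symm_apply]
  link_vert v := by
    rw [Equiv.eq_symm_apply, ← f.link_vert, Equiv.apply_symm_apply]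

/-- Composition of isomorphisms. -/
def Iso.trans {G H K : FatGraph ι} (f : Iso G H) (g : Iso H K) : Iso G K where
  vert := f.vert.trans g.vert
  dart := f.dart.trans g.dart
  vertOf_dart a := by simp [g.vertOf_dart, f.vertOf_dart]
  next_dart a := by simp [g.next_dart, f.next_dart]
  glue_dart a := by simp [g.glue_dart, f.glue_dart]
  color_vert v := by simp [g.color_vert, f.color_vert]
  spin_vert v := by simp [g.spin_vert, f.spin_vert]
  link_vert v := by simp [g.link_vert, f.link_vert]

/-- Being isomorphic is an equivalence relation. -/
def isoSetoid (ι : Type) : Setoid (FatGraph ι) where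
  r G H := Nonempty (Iso G H)
  iseqv := ⟨fun G => ⟨Iso.refl G⟩, fun ⟨f⟩ => ⟨f.symm⟩, fun ⟨f⟩ ⟨g⟩ => ⟨f.trans g⟩⟩

/-- The set of closed fat graphs up to isomorphism. -/
def IsoClass (ι : Type) : Type := Quotient (isoSetoid ι)

/-- A representative of an isomorphism class. -/
def IsoClass.repr (q : IsoClass ι) : FatGraph ι := Quotient.out q

variable (G : FatGraph ι)

/-- The number of automorphisms. -/
def numAut : ℕ := Nat.card (Iso G G)

/-- The valence of a vertex. -/
def valence (v : Fin G.numVert) : ℕ := (Finset.univ.filter fun a => G.vertOf a = v).card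

/-- The vertices whose centre is free. -/
def freeVerts : Finset (Fin G.numVert) := Finset.univ.filter fun v => G.link v = v

/-- One vertex of each pair of vertices linked by their centres, namely the one whose colour is
the smaller of the two (the two colours are different). -/
def linkedPairs [LinearOrder ι] : Finset (Fin G.numVert) :=
  Finset.univ.filter fun v => G.color v < G.color (G.link v)

/-- `l_i`: the number of independent loops of colour `i`, that is of closed paths followed along
the borders of the ribbons. -/
def numLoops (i : ι) : ℕ :=
  ((Quotient.mk (Equiv.Perm.SameCycle.setoid (G.next * G.glue))) ''
    {a | G.color (G.vertOf a) = i}).ncard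

/-- `n_{ss,i}`: the number of edges between two legs of vertices of spin `s` and colour `i`. -/
def numEdgesSame [DecidableEq ι] (s : Spin) (i : ι) : ℕ :=
  ((Finset.univ.filter fun a => G.color (G.vertOf a) = i ∧ G.spin (G.vertOf a) = s ∧
    G.spin (G.vertOf (G.glue a)) = s).image fun a => s(a, G.glue a)).card

/-- `n_{a,i}`: the total number of edges of colour `i`. -/
def numEdges [DecidableEq ι] (i : ι) : ℕ :=
  ((Finset.univ.filter fun a => G.color (G.vertOf a) = i).image fun a => s(a, G.glue a)).card

/-- The number of centres: one for each free vertex, one for each linked pair. -/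
def numCentres [LinearOrder ι] : ℕ := G.freeVerts.card + G.linkedPairs.card

/-- The Euler–Poincaré characteristic. -/
def eulerChar [Fintype ι] [DecidableEq ι] : ℤ :=
  ∑ i, ((G.numLoops i : ℤ) - G.numEdges i) + G.freeVerts.card

end FatGraph

/-! ### The formal two-matrix model -/

/-- The data of the model: two potentials, `d₁ d₂` points `(ξ i, η i)`, and the numbers `n i` of
eigenvalues placed at these points. -/
structure TwoMatrixData where
  d₁ : ℕ
  d₂ : ℕ
  V₁ : ℂ[X]
  V₂ : ℂ[X]
  ξ : Fin (d₁ * d₂) → ℂ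
  η : Fin (d₁ * d₂) → ℂ
  n : Fin (d₁ * d₂) → ℕ

namespace TwoMatrixData

variable (D : TwoMatrixData)

/-- The colours. -/
abbrev Color : Type := Fin (D.d₁ * D.d₂)

/-- The total size of the matrices. -/
def N : ℕ := ∑ i, D.n i

/-- The filling fractions `ε_i = n_i / N`. -/
def ε (i : D.Color) : ℂ := (D.n i : ℂ) / D.N

/-- `d₁` for spin `+`, `d₂` for spin `-`. -/
def d : Spin → ℕ
  | true => D.d₁
  | false => D.d₂

/-- `V₁` for spin `+`, `V₂` for spin `-`. -/
def V : Spin → ℂ[X]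
  | true => D.V₁
  | false => D.V₂

/-- `ξ` for spin `+`, `η` for spin `-`. -/
def pt : Spin → D.Color → ℂ
  | true => D.ξ
  | false => D.η

/-- `t_{k,i}` (spin `+`) and `t̃_{k,i}` (spin `-`). -/
def t (s : Spin) (k : ℕ) (i : D.Color) : ℂ :=
  (derivative^[k] (D.V s)).eval (D.pt s i) / ((k - 1).factorial : ℂ)

/-- `h_{k,i}` (spin `+`) and `h̃_{k,i}` (spin `-`). -/
def h (s : Spin) (k : ℕ) (i : D.Color) : ℂ :=
  ∑ j ∈ Finset.univ.erase i, D.ε j / (D.pt s j - D.pt s i) ^ k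

/-- `h_{k,i;l,j}` (spin `+`) and `h̃_{k,i;l,j}` (spin `-`). -/
def hh (s : Spin) (k : ℕ) (i : D.Color) (l : ℕ) (j : D.Color) : ℂ :=
  ((k + l - 1).factorial : ℂ) / ((k - 1).factorial * (l - 1).factorial) *
    (1 / ((D.pt s j - D.pt s i) ^ k * (D.pt s i - D.pt s j) ^ l))

/-! #### Gaussian integrals -/

/-- The Hermitian matrix `M` with `M a a = u a a`, `Re (M a b) = u a b` and `Im (M a b) = u b a`
for `a < b`.  Lebesgue measure in `u` is `∏ dM_aa ∏_{a<b} dRe(M_ab) dIm(M_ab)`. -/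
def hermitian {m : ℕ} (u : Fin m → Fin m → ℝ) : Matrix (Fin m) (Fin m) ℂ :=
  Matrix.of fun a b =>
    if a = b then (u a a : ℂ)
    else if a < b then (u a b : ℂ) + (u b a : ℂ) * Complex.I
    else (u b a : ℂ) - (u a b : ℂ) * Complex.I

/-- The real coordinates of a pair of Hermitian matrices of size `n i` for each colour `i`. -/
abbrev Config : Type := (i : D.Color) → Spin → Fin (D.n i) → Fin (D.n i) → ℝ

/-- The quadratic part of the action at the point `(ξ i, η i)`, in two numerical variables. -/
def quad (i : D.Color) (z : Spin → ℂ) : ℂ :=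
  (derivative^[2] D.V₁).eval (D.ξ i) / 2 * z true ^ 2 +
    (derivative^[2] D.V₂).eval (D.η i) / 2 * z false ^ 2 - z true * z false

/-- `A` is an admissible contour at colour `i`: the real part of the quadratic part of the action
is positive definite on the real plane `A ℝ²` in `ℂ²`, so that Gaussian integrals converge on it.
The contour `A = 1` is the one of Hermitian perturbations of the saddle point. -/
def IsContour (i : D.Color) (A : Matrix Spin Spin ℂ) : Prop :=
  ∀ x : Spin → ℝ, x ≠ 0 → 0 < (D.quad i (A.mulVec fun s => (x s : ℂ))).re

variable (A : D.Color → Matrix Spin Spin ℂ)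

/-- The perturbations of the saddle point: `m_i` (spin `+`) and `m̃_i` (spin `-`), images of two
Hermitian matrices under the contour matrix `A i`. -/
def pert (u : D.Config) (i : D.Color) (s : Spin) : Matrix (Fin (D.n i)) (Fin (D.n i)) ℂ :=
  ∑ s', A i s s' • hermitian (u i s')

/-- The matrices `M_i = ξ_i 1 + m_i` (spin `+`) and `M̃_i = η_i 1 + m̃_i` (spin `-`). -/
def mat (u : D.Config) (i : D.Color) (s : Spin) : Matrix (Fin (D.n i)) (Fin (D.n i)) ℂ :=
  D.pt s i • (1 : Matrix (Fin (D.n i)) (Fin (D.n i)) ℂ) + D.pert A u i s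

/-- The Gaussian weight at `T`. -/
def gaussWeight (T : ℝ) (u : D.Config) : ℂ :=
  ∏ i, Complex.exp (-((D.N : ℂ) / T) * Matrix.trace (
    ((derivative^[2] D.V₁).eval (D.ξ i) / 2) •
        (D.mat A u i true - D.ξ i • (1 : Matrix (Fin (D.n i)) (Fin (D.n i)) ℂ)) ^ 2 +
    ((derivative^[2] D.V₂).eval (D.η i) / 2) •
        (D.mat A u i false - D.η i • (1 : Matrix (Fin (D.n i)) (Fin (D.n i)) ℂ)) ^ 2 -
    (D.mat A u i true - D.ξ i • (1 : Matrix (Fin (D.n i)) (Fin (D.n i)) ℂ)) *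
      (D.mat A u i false - D.η i • (1 : Matrix (Fin (D.n i)) (Fin (D.n i)) ℂ))))

/-- The mean value of `F` for the normalized Gaussian measure. -/
def gaussMean (T : ℝ) (F : D.Config → ℂ) : ℂ :=
  (∫ u, F u * D.gaussWeight A T u) / ∫ u, D.gaussWeight A T u

/-- `δV_{1,i}` (spin `+`) and `δV_{2,i}` (spin `-`): the terms of order at least three of the
Taylor expansion of the potential at the saddle point. -/
def δV (s : Spin) (i : D.Color) : ℂ[X] :=
  D.V s - C ((D.V s).eval (D.pt s i))
    - C ((derivative (D.V s)).eval (D.pt s i)) * (X - C (D.pt s i))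
    - C ((derivative^[2] (D.V s)).eval (D.pt s i) / 2) * (X - C (D.pt s i)) ^ 2

/-- `∑_i Tr (δV_{1,i}(M_i) + δV_{2,i}(M̃_i))`. -/
def interaction (u : D.Config) : ℂ :=
  ∑ i, ∑ s, Matrix.trace (aeval (D.mat A u i s) (D.δV s i))

/-- `∏_{i>j} det(M_i ⊗ 1 - 1 ⊗ M_j) ∏_{i>j} det(M̃_i ⊗ 1 - 1 ⊗ M̃_j)`. -/
def dets (u : D.Config) : ℂ :=
  ∏ s : Spin, ∏ i, ∏ j ∈ Finset.univ.filter (· < i),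
    Matrix.det (D.mat A u i s ⊗ₖ (1 : Matrix (Fin (D.n j)) (Fin (D.n j)) ℂ)
      - (1 : Matrix (Fin (D.n i)) (Fin (D.n i)) ℂ) ⊗ₖ D.mat A u j s)

/-- The term of order `l` in the expansion of the exponential of the interaction. -/
def gaussTerm (l : ℕ) (T : ℝ) : ℂ :=
  ((-1) ^ l * (D.N : ℂ) ^ l / (l.factorial * (T : ℂ) ^ l)) *
    D.gaussMean A T fun u => D.interaction A u ^ l * D.dets A u

open Classical in
/-- The polynomial `∑_k A_{k,l} T^k` which is equal to `gaussTerm l T` for all `T > 0`. -/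
def termPoly (l : ℕ) : ℂ[X] :=
  if hP : ∃ P : ℂ[X], ∀ T : ℝ, 0 < T → D.gaussTerm A l T = P.eval (T : ℂ) then hP.choose else 0

/-- The coefficients `A_{k,l}`. -/
def coeffA (k l : ℕ) : ℂ := (D.termPoly A l).coeff k

/-! #### The partition function -/

/-- Finite sums of formal expressions `e^{a/T} f(T)`, where `a` is a complex number and `f` is a
formal power series in `T`; they are multiplied by the rule `e^{a/T} e^{b/T} = e^{(a+b)/T}`. -/
abbrev ExpSeries : Type := AddMonoidAlgebra (PowerSeries ℂ) ℂ

/-- The formal exponential `e^{a/T}`. -/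
def expOver (a : ℂ) : ExpSeries := AddMonoidAlgebra.single a 1

/-- A formal power series in `T`. -/
def ofSeries (f : PowerSeries ℂ) : ExpSeries := AddMonoidAlgebra.single 0 f

/-- The value of the action `V₁(x) + V₂(y) - x y` at the point `(ξ i, η i)`. -/
def action (i : D.Color) : ℂ := D.V₁.eval (D.ξ i) + D.V₂.eval (D.η i) - D.ξ i * D.η i

/-- The partition function of the formal two-matrix model: the value of the integrand at the
saddle point times the series `∑_k T^k (∑_{j ≤ 2k} A_{k,j})`. -/
def Zform : ExpSeries :=
  expOver (-(D.N : ℂ) * ∑ i, (D.n i : ℂ) * D.action i) *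
    ofSeries (PowerSeries.mk fun k => ∑ j ∈ Finset.range (2 * k + 1), D.coeffA A k j)

/-! #### The weights of the graphs -/

/-- Whether `t_{k,i}` occurs in the weight of a `k`-valent free vertex of spin `s`. -/
abbrev inPotential (s : Spin) (k : ℕ) : Prop := 3 ≤ k ∧ k ≤ D.d s + 1

/-- The weight of a free vertex, up to the powers of `N` and `T` and the sign collected in
`weight`. -/
def vertexWeight (s : Spin) (k : ℕ) (i : D.Color) : PowerSeries ℂ :=
  if D.inPotential s k then PowerSeries.C (D.t s k i) + PowerSeries.X * PowerSeries.C (D.h s k i)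
  else PowerSeries.C (D.h s k i)

variable (G : FatGraph D.Color)

/-- The exponent `n_T`.  The total valence is even and it is at least three times the number of
vertices which are subtracted, so that neither the division nor the subtraction is truncated. -/
def nT : ℕ :=
  (∑ v ∈ G.freeVerts, G.valence v +
      ∑ v ∈ G.linkedPairs, (G.valence v + G.valence (G.link v))) / 2
    - (G.freeVerts.filter fun v => D.inPotential (G.spin v) (G.valence v)).card

/-- The weight of a graph, a polynomial in `T`. -/
def weight : PowerSeries ℂ :=
  PowerSeries.C ((-1) ^ G.numCentres * (D.N : ℂ) ^ G.eulerChar / G.numAut) *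
    PowerSeries.X ^ D.nT G *
    (∏ v ∈ G.freeVerts, D.vertexWeight (G.spin v) (G.valence v) (G.color v)) *
    PowerSeries.C (∏ v ∈ G.linkedPairs,
      D.hh (G.spin v) (G.valence v) (G.color v) (G.valence (G.link v)) (G.color (G.link v))) *
    PowerSeries.C (∏ i, (D.ε i ^ G.numLoops i *
      D.t false 2 i ^ G.numEdgesSame true i * D.t true 2 i ^ G.numEdgesSame false i *
      ((D.t true 2 i * D.t false 2 i - 1) ^ G.numEdges i)⁻¹))

/-- The sum of the weights of all the graphs up to isomorphism, coefficient by coefficient. -/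
def graphSeries : PowerSeries ℂ :=
  PowerSeries.mk fun m =>
    ∑ᶠ q : FatGraph.IsoClass D.Color, PowerSeries.coeff m (D.weight q.repr)

end TwoMatrixData

end

noncomputable section

set_option linter.unusedSectionVars false

/-! ### Sums over involutions -/

namespace Involution

open Equiv Finset

variable {α β R : Type*} [Fintype α] [DecidableEq α] [CommRing R]

/-- The involutions of `α` which are the identity outside `S`. -/
def involutionsOn (S : Finset α) : Finset (Perm α) :=
  univ.filter fun σ => (∀ v, σ (σ v) = v) ∧ ∀ v, v ∉ S → σ v = v

/-- The two-element orbits of an involution. -/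
def pairs (σ : Perm α) : Finset (Sym2 α) :=
  (univ.filter fun v => σ v ≠ v).image fun v => s(v, σ v)

/-- The loop hafnian: the sum over the involutions of `S` of the product of the weights of the
fixed points and of the pairs. -/
def loopHafnian (x : α → R) (y : Sym2 α → R) (S : Finset α) : R :=
  ∑ σ ∈ involutionsOn S, (∏ v ∈ S.filter (fun v => σ v = v), x v) * ∏ e ∈ pairs σ, y e

theorem mem_involutionsOn {S : Finset α} {σ : Perm α} :
    σ ∈ involutionsOn S ↔ (∀ v, σ (σ v) = v) ∧ ∀ v, v ∉ S → σ v = v := by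
  simp [involutionsOn]

theorem mem_pairs {σ : Perm α} {a b : α} (h : ∀ v, σ (σ v) = v) :
    s(a, b) ∈ pairs σ ↔ σ a = b ∧ a ≠ b := by
  simp only [pairs, mem_image, mem_filter, mem_univ, true_and, Sym2.eq_iff]
  constructor
  · rintro ⟨v, hv, ⟨rfl, rfl⟩ | ⟨rfl, rfl⟩⟩
    · exact ⟨rfl, hv.symm⟩
    · exact ⟨h _, hv⟩
  · rintro ⟨rfl, hb⟩
    exact ⟨a, hb.symm, Or.inl ⟨rfl, rfl⟩⟩

theorem pairs_swap_mul {a b : α} (hab : a ≠ b) {τ : Perm α} (hτ : ∀ v, τ (τ v) = v)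
    (ha : τ a = a) (hb : τ b = b) :
    pairs (swap a b * τ) = insert s(a, b) (pairs τ) ∧ s(a, b) ∉ pairs τ ∧
      (∀ v, (swap a b * τ) ((swap a b * τ) v) = v) := by
  have hne : ∀ v, v ≠ a → v ≠ b → (swap a b) (τ v) = τ v := by
    intro v h1 h2
    apply swap_apply_of_ne_of_ne
    · intro h; apply h1; rw [← hτ v, h, ha]
    · intro h; apply h2; rw [← hτ v, h, hb]
  have hinv : ∀ v, (swap a b * τ) ((swap a b * τ) v) = v := by
    intro v
    simp only [Perm.mul_apply]
    rcases eq_or_ne v a with rfl | h1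
    · simp [ha, hb]
    rcases eq_or_ne v b with rfl | h2
    · simp [ha, hb]
    rw [hne v h1 h2, hτ v, swap_apply_of_ne_of_ne h1 h2]
  refine ⟨?_, ?_, hinv⟩
  · ext e
    induction e with | _ c d
    rw [mem_insert, mem_pairs hinv, mem_pairs hτ, Perm.mul_apply]
    rcases eq_or_ne c a with rfl | h1
    · rw [ha, swap_apply_left]
      simp only [Sym2.eq_iff]
      grind
    rcases eq_or_ne c b with rfl | h2
    · rw [hb, swap_apply_right]
      simp only [Sym2.eq_iff]
      grind
    rw [hne c h1 h2]
    simp only [Sym2.eq_iff]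
    grind
  · rw [mem_pairs hτ, ha]
    tauto

theorem loopHafnian_insert (x : α → R) (y : Sym2 α → R) {S : Finset α} {a : α} (ha : a ∉ S) :
    loopHafnian x y (insert a S) =
      x a * loopHafnian x y S + ∑ b ∈ S, y s(a, b) * loopHafnian x y (S.erase b) := by
  classical
  have hmaps : ∀ σ ∈ involutionsOn (insert a S), σ a ∈ insert a S := by
    intro σ hσ
    rw [mem_involutionsOn] at hσ
    by_contra h
    have h1 := hσ.2 _ h
    rw [hσ.1] at h1
    exact h (h1 ▸ mem_insert_self a S)
  rw [loopHafnian, ← sum_fiberwise_of_maps_to hmaps, sum_insert ha]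
  congr 1
  · rw [loopHafnian, mul_sum]
    have hset : (involutionsOn (insert a S)).filter (fun σ => σ a = a) = involutionsOn S := by
      ext σ
      simp only [mem_filter, mem_involutionsOn, mem_insert, not_or]
      constructor
      · rintro ⟨⟨h1, h2⟩, h3⟩
        refine ⟨h1, fun v hv => ?_⟩
        by_cases hva : v = a
        · rw [hva, h3]
        · exact h2 v ⟨hva, hv⟩
      · rintro ⟨h1, h2⟩
        exact ⟨⟨h1, fun v hv => h2 v hv.2⟩, h2 a ha⟩
    rw [hset]
    refine sum_congr rfl fun σ hσ => ?_
    rw [mem_involutionsOn] at hσ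
    rw [filter_insert, if_pos (hσ.2 a ha), prod_insert (by simp [ha]), mul_assoc]
  · refine sum_congr rfl fun b hb => ?_
    have hab : a ≠ b := fun h => ha (h ▸ hb)
    rw [loopHafnian, mul_sum]
    refine sum_bij' (fun σ _ => swap a b * σ) (fun τ _ => swap a b * τ) ?_ ?_ ?_ ?_ ?_
    · intro σ hσ
      simp only [mem_filter, mem_involutionsOn, mem_insert, not_or] at hσ
      obtain ⟨⟨h1, h2⟩, h3⟩ := hσ
      have h4 : σ b = a := by rw [← h3, h1]
      have h5 : ∀ v, v ≠ a → v ≠ b → swap a b (σ v) = σ v := by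
        intro v hva hvb
        apply swap_apply_of_ne_of_ne
        · intro h; apply hvb; rw [← h1 v, h, h3]
        · intro h; apply hva; rw [← h1 v, h, h4]
      rw [mem_involutionsOn]
      simp only [Perm.mul_apply]
      refine ⟨fun v => ?_, fun v hv => ?_⟩
      · rcases eq_or_ne v a with rfl | hva
        · simp [h3]
        rcases eq_or_ne v b with rfl | hvb
        · simp [h4]
        rw [h5 v hva hvb, h1, swap_apply_of_ne_of_ne hva hvb]
      · rcases eq_or_ne v a with rfl | hva
        · simp [h3]
        rcases eq_or_ne v b with rfl | hvb
        · simp [h4]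
        rw [h5 v hva hvb]
        refine h2 v ⟨hva, fun h => hv ?_⟩
        exact mem_erase.2 ⟨hvb, h⟩
    · intro τ hτ
      rw [mem_involutionsOn] at hτ
      have hτa : τ a = a := hτ.2 a (by simp [ha])
      have hτb : τ b = b := hτ.2 b (by simp)
      obtain ⟨-, -, h⟩ := pairs_swap_mul hab hτ.1 hτa hτb
      simp only [mem_filter, mem_involutionsOn, mem_insert, not_or]
      refine ⟨⟨h, fun v hv => ?_⟩, ?_⟩
      · rw [Perm.mul_apply, hτ.2 v (by simp [hv.2]), swap_apply_of_ne_of_ne hv.1]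
        rintro rfl
        exact hv.2 hb
      · rw [Perm.mul_apply, hτa, swap_apply_left]
    · intro σ _; simp
    · intro τ _; simp
    · intro σ hσ
      simp only [mem_filter, mem_involutionsOn, mem_insert, not_or] at hσ
      obtain ⟨⟨h1, h2⟩, h3⟩ := hσ
      have h4 : σ b = a := by rw [← h3, h1]
      have h5 : ∀ v, v ≠ a → v ≠ b → swap a b (σ v) = σ v := by
        intro v hva hvb
        apply swap_apply_of_ne_of_ne
        · intro h; apply hvb; rw [← h1 v, h, h3]
        · intro h; apply hva; rw [← h1 v, h, h4]
      set τ := swap a b * σ with hτdef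
      have hστ : σ = swap a b * τ := by simp [hτdef]
      have hτa : τ a = a := by simp [hτdef, h3]
      have hτb : τ b = b := by simp [hτdef, h4]
      have hτ : ∀ v, τ (τ v) = v := by
        intro v
        rcases eq_or_ne v a with rfl | hva
        · simp [hτa]
        rcases eq_or_ne v b with rfl | hvb
        · simp [hτb]
        simp only [hτdef, Perm.mul_apply]
        rw [h5 v hva hvb, h1, swap_apply_of_ne_of_ne hva hvb]
      obtain ⟨hp, hn, -⟩ := pairs_swap_mul hab hτ hτa hτb
      have hfilt : (insert a S).filter (fun v => σ v = v) =
          (S.erase b).filter (fun v => τ v = v) := by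
        ext v
        simp only [mem_filter, mem_insert, mem_erase]
        rcases eq_or_ne v a with rfl | hva
        · simp [h3, ha, hab.symm]
        rcases eq_or_ne v b with rfl | hvb
        · simp [h4, hva.symm]
        have : τ v = σ v := by simp only [hτdef, Perm.mul_apply]; exact h5 v hva hvb
        simp [this, hva, hvb]
      rw [hfilt, hστ, hp, prod_insert hn]
      ring

theorem loopHafnian_empty (x : α → R) (y : Sym2 α → R) : loopHafnian x y ∅ = 1 := by
  have h : involutionsOn (∅ : Finset α) = {1} := by
    ext σ
    simp only [mem_involutionsOn, mem_singleton]
    constructor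
    · rintro ⟨-, h⟩
      ext v; simpa using h v (by simp)
    · rintro rfl; simp
  have h2 : pairs (1 : Perm α) = ∅ := by simp [pairs]
  simp [loopHafnian, h, h2]

theorem loopHafnian_congr {x x' : α → R} {y y' : Sym2 α → R} {S : Finset α}
    (hx : ∀ v ∈ S, x v = x' v) (hy : ∀ v ∈ S, ∀ w ∈ S, y s(v, w) = y' s(v, w)) :
    loopHafnian x y S = loopHafnian x' y' S := by
  refine sum_congr rfl fun σ hσ => ?_
  rw [mem_involutionsOn] at hσ
  congr 1
  · exact prod_congr rfl fun v hv => hx v (mem_filter.1 hv).1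
  · refine prod_congr rfl fun e he => ?_
    induction e with | _ c d
    rw [mem_pairs hσ.1] at he
    have hc : c ∈ S := by
      by_contra h
      exact he.2 ((hσ.2 c h).symm.trans he.1)
    have hd : d ∈ S := by
      by_contra h
      have h1 := hσ.2 d h
      rw [← he.1, hσ.1] at h1
      exact he.2 (h1.trans he.1)
    exact hy c hc d hd

/-- Wick's theorem: a functional satisfying the recursion of Gaussian expectations is a sum over
pairings. -/
theorem expectation_prod_eq_loopHafnian {A : Type*} [CommRing A] (E : A → R) (L : α → A)
    (c : Sym2 α → R) (h1 : E 1 = 1)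
    (hrec : ∀ (S : Finset α) (a : α), a ∉ S →
      E (L a * ∏ v ∈ S, L v) = ∑ b ∈ S, c s(a, b) * E (∏ v ∈ S.erase b, L v)) (S : Finset α) :
    E (∏ v ∈ S, L v) = loopHafnian 0 c S := by
  induction hS : S.card using Nat.strong_induction_on generalizing S with
  | _ n ih =>
    rcases S.eq_empty_or_nonempty with rfl | ⟨a, ha⟩
    · simp [loopHafnian_empty, h1]
    · have hlt : (S.erase a).card < n := by
        rw [← hS]; exact card_erase_lt_of_mem ha
      rw [← insert_erase ha, prod_insert (by simp), hrec _ _ (by simp),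
        loopHafnian_insert _ _ (by simp)]
      simp only [Pi.zero_apply, zero_mul, zero_add]
      refine sum_congr rfl fun b hb => ?_
      rw [ih _ (lt_of_le_of_lt (card_le_card (erase_subset _ _)) hlt) _ rfl]

/-- The functions equal to a default value outside `S`. -/
def funsOn {Ty : Type*} [Fintype Ty] (t₀ : Ty) (S : Finset α) : Finset (α → Ty) :=
  Fintype.piFinset fun v => if v ∈ S then univ else {t₀}

theorem sum_funsOn_insert {Ty M : Type*} [Fintype Ty] [AddCommMonoid M] (t₀ : Ty) {S : Finset α}
    {a : α} (ha : a ∉ S) (f : (α → Ty) → M) :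
    ∑ p ∈ funsOn t₀ (insert a S), f p =
      ∑ p ∈ funsOn t₀ S, ∑ t, f (Function.update p a t) := by
  classical
  rw [← sum_product']
  symm
  refine sum_bij' (fun q _ => Function.update q.1 a q.2)
    (fun p _ => (Function.update p a t₀, p a)) ?_ ?_ ?_ ?_ ?_
  · rintro ⟨p, t⟩ h
    simp only [funsOn, mem_product, Fintype.mem_piFinset, mem_univ, and_true] at h ⊢
    intro v
    rcases eq_or_ne v a with rfl | hv
    · simp
    · simpa [hv] using h v
  · intro p h
    simp only [funsOn, mem_product, Fintype.mem_piFinset, mem_univ, and_true] at h ⊢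
    intro v
    rcases eq_or_ne v a with rfl | hv
    · simp [ha]
    · simpa [hv] using h v
  · rintro ⟨p, t⟩ h
    simp only [funsOn, mem_product, Fintype.mem_piFinset, mem_univ, and_true] at h
    have := h a
    simp only [ha, if_false, mem_singleton] at this
    simp [← this]
  · intro p _; simp
  · intro q _; rfl

theorem funsOn_univ {Ty : Type*} [Fintype Ty] (t₀ : Ty) :
    funsOn t₀ (univ : Finset α) = univ := by
  ext p; simp [funsOn]

end Involution

/-! ### Formal exponentials of power series -/

namespace PowerSeries

variable {R : Type*} [CommRing R] [Algebra ℂ R]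

/-- The formal exponential of a power series without constant term. -/
def fexp (F : PowerSeries R) : PowerSeries R :=
  mk fun n => ∑ l ∈ Finset.range (n + 1), ((l.factorial : ℂ)⁻¹) • coeff n (F ^ l)

theorem coeff_pow_mul_eq_zero {F : PowerSeries R} (hF : constantCoeff F = 0) (G : PowerSeries R)
    {n l : ℕ} (h : n < l) : coeff n (F ^ l * G) = 0 := by
  have h1 : (X : PowerSeries R) ^ l ∣ F ^ l * G :=
    (pow_dvd_pow_of_dvd (X_dvd_iff.2 hF) l).mul_right G
  exact (X_pow_dvd_iff.1 h1) n h

theorem coeff_pow_eq_zero {F : PowerSeries R} (hF : constantCoeff F = 0) {n l : ℕ} (h : n < l) :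
    coeff n (F ^ l) = 0 := by
  simpa using coeff_pow_mul_eq_zero hF 1 h

theorem coeff_fexp_eq_sum {F : PowerSeries R} (hF : constantCoeff F = 0) {n B : ℕ} (h : n ≤ B) :
    coeff n (fexp F) =
      ∑ l ∈ Finset.range (B + 1), ((l.factorial : ℂ)⁻¹) • coeff n (F ^ l) := by
  rw [fexp, coeff_mk]
  refine Finset.sum_subset (Finset.range_mono (by omega)) fun l _ hl => ?_
  rw [coeff_pow_eq_zero hF (by simpa using hl), smul_zero]

theorem coeff_fexp_mul {F : PowerSeries R} (hF : constantCoeff F = 0) (G : PowerSeries R)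
    {n B : ℕ} (h : n ≤ B) :
    coeff n (fexp F * G) =
      ∑ l ∈ Finset.range (B + 1), ((l.factorial : ℂ)⁻¹) • coeff n (F ^ l * G) := by
  rw [coeff_mul]
  simp_rw [coeff_mul, Finset.smul_sum]
  rw [Finset.sum_comm]
  refine Finset.sum_congr rfl fun q hq => ?_
  rw [Finset.HasAntidiagonal.mem_antidiagonal] at hq
  rw [coeff_fexp_eq_sum hF (show q.1 ≤ B by omega), Finset.sum_mul]
  simp

theorem constantCoeff_fexp (F : PowerSeries R) : constantCoeff (fexp F) = 1 := by
  rw [← coeff_zero_eq_constantCoeff_apply]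
  simp [fexp]

theorem coeff_fexp_congr {F G : PowerSeries R} {n : ℕ}
    (h : ∀ k ≤ n, coeff k F = coeff k G) : coeff n (fexp F) = coeff n (fexp G) := by
  have hd : (X : PowerSeries R) ^ (n + 1) ∣ F - G := by
    rw [X_pow_dvd_iff]
    intro m hm
    rw [map_sub, h m (by omega), sub_self]
  rw [fexp, fexp, coeff_mk, coeff_mk]
  refine Finset.sum_congr rfl fun l _ => ?_
  have h1 := X_pow_dvd_iff.1 (hd.trans (sub_dvd_pow_sub_pow F G l)) n (by omega)
  rw [map_sub, sub_eq_zero] at h1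
  rw [h1]

theorem derivative_fexp {F : PowerSeries R} (hF : constantCoeff F = 0) :
    derivative R (fexp F) = derivative R F * fexp F := by
  ext n
  rw [coeff_derivative, coeff_fexp_eq_sum hF le_rfl, Finset.sum_mul, Finset.sum_range_succ',
    mul_comm (derivative R F), coeff_fexp_mul hF _ le_rfl]
  have h0 : ((Nat.factorial 0 : ℂ)⁻¹ • coeff (n + 1) (F ^ 0)) * ((n : R) + 1) = 0 := by
    simp [coeff_one]
  rw [h0, add_zero]
  refine Finset.sum_congr rfl fun l _ => ?_
  rw [smul_mul_assoc, ← coeff_derivative, Derivation.leibniz_pow, Nat.add_sub_cancel, smul_eq_mul,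
    map_nsmul, ← Nat.cast_smul_eq_nsmul ℂ, smul_smul]
  congr 1
  rw [Nat.factorial_succ]
  have : (l.factorial : ℂ) ≠ 0 := by exact_mod_cast l.factorial_ne_zero
  push_cast
  have h2 : (l : ℂ) + 1 ≠ 0 := by exact_mod_cast Nat.succ_ne_zero l
  field_simp

theorem eq_of_derivative_eq_mul {f g h : PowerSeries R} (hf : derivative R f = h * f)
    (hg : derivative R g = h * g) (h0 : constantCoeff f = constantCoeff g) : f = g := by
  rw [← sub_eq_zero]
  set k := f - g with hk
  have hk' : derivative R k = h * k := by rw [hk, map_sub, hf, hg, mul_sub]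
  have : ∀ n, ∀ m ≤ n, coeff m k = 0 := by
    intro n
    induction n with
    | zero =>
      intro m hm
      obtain rfl : m = 0 := by omega
      rw [coeff_zero_eq_constantCoeff_apply, hk, map_sub, h0, sub_self]
    | succ n ih =>
      intro m hm
      rcases Nat.lt_or_ge m (n + 1) with h1 | h1
      · exact ih m (by omega)
      obtain rfl : m = n + 1 := by omega
      have h2 := congrArg (coeff n) hk'
      rw [coeff_derivative, coeff_mul, Finset.sum_eq_zero] at h2
      · have h3 : ((n : ℂ) + 1) • coeff (n + 1) k = 0 := by
          rw [Algebra.smul_def, mul_comm]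
          simpa using h2
        have h4 : (n : ℂ) + 1 ≠ 0 := by exact_mod_cast Nat.succ_ne_zero n
        have h5 := congrArg (fun x => ((n : ℂ) + 1)⁻¹ • x) h3
        simpa [smul_smul, h4] using h5
      · intro q hq
        rw [Finset.HasAntidiagonal.mem_antidiagonal] at hq
        rw [ih q.2 (by omega), mul_zero]
  ext n
  simpa using this n n le_rfl

theorem fexp_unique {F G : PowerSeries R} (hF : constantCoeff F = 0)
    (hG : derivative R G = derivative R F * G) (h0 : constantCoeff G = 1) : G = fexp F :=
  eq_of_derivative_eq_mul hG (derivative_fexp hF) (by rw [h0, constantCoeff_fexp])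

theorem fexp_add {F G : PowerSeries R} (hF : constantCoeff F = 0) (hG : constantCoeff G = 0) :
    fexp (F + G) = fexp F * fexp G := by
  symm
  refine fexp_unique (by simp [hF, hG]) ?_ (by simp [constantCoeff_fexp])
  rw [Derivation.leibniz, derivative_fexp hF, derivative_fexp hG, map_add]
  simp only [smul_eq_mul]
  ring

theorem fexp_zero : fexp (0 : PowerSeries R) = 1 := by
  symm
  exact fexp_unique (by simp) (by simp) (by simp)

theorem fexp_sum {ι : Type*} (s : Finset ι) (F : ι → PowerSeries R)
    (hF : ∀ i ∈ s, constantCoeff (F i) = 0) :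
    fexp (∑ i ∈ s, F i) = ∏ i ∈ s, fexp (F i) := by
  classical
  induction s using Finset.induction_on with
  | empty => simp [fexp_zero]
  | insert a s ha ih =>
    rw [Finset.sum_insert ha, Finset.prod_insert ha, fexp_add (hF a (by simp)),
      ih fun i hi => hF i (by simp [hi])]
    rw [map_sum]
    exact Finset.sum_eq_zero fun i hi => hF i (by simp [hi])

section det

variable {m : Type*} [Fintype m] [DecidableEq m]

/-- The resolvent `(1 + X Y)⁻¹`. -/
def resolvent (Y : Matrix m m R) : Matrix m m (PowerSeries R) :=
  Matrix.of fun a b => mk fun p => (-1) ^ p * (Y ^ p) a b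

theorem one_add_X_smul_mul_resolvent (Y : Matrix m m R) :
    (1 + (X : PowerSeries R) • Y.map C) * resolvent Y = 1 := by
  ext a b n
  rw [add_mul, one_mul, Matrix.smul_mul, Matrix.add_apply, Matrix.smul_apply, smul_eq_mul, map_add]
  cases n with
  | zero =>
    by_cases h : a = b <;> simp [resolvent, Matrix.one_apply, h]
  | succ n =>
    rw [coeff_succ_X_mul, Matrix.mul_apply, map_sum]
    simp only [resolvent, Matrix.of_apply, coeff_mk, Matrix.map_apply, coeff_C_mul]
    rw [pow_succ' Y, Matrix.mul_apply, Finset.mul_sum, ← Finset.sum_add_distrib,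
      Finset.sum_eq_zero]
    · rw [Matrix.one_apply]; split_ifs <;> simp [coeff_one]
    · intro j _; ring

theorem trace_mul_resolvent (Y : Matrix m m R) :
    Matrix.trace (Y.map C * resolvent Y) = mk fun p => (-1) ^ p * Matrix.trace (Y ^ (p + 1)) := by
  ext n
  simp only [Matrix.trace, Matrix.diag_apply, Matrix.mul_apply, map_sum, coeff_mk, resolvent,
    Matrix.of_apply, Matrix.map_apply, coeff_C_mul, pow_succ' Y, Finset.mul_sum]
  refine Finset.sum_congr rfl fun i _ => Finset.sum_congr rfl fun j _ => by ring

theorem derivative_det_one_add_X_smul (Y : Matrix m m R) :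
    derivative R (Matrix.det (1 + (X : PowerSeries R) • Y.map C)) =
      (mk fun p => (-1) ^ p * Matrix.trace (Y ^ (p + 1))) *
        Matrix.det (1 + (X : PowerSeries R) • Y.map C) := by
  set f : R[X] := Matrix.det (1 + (Polynomial.X : R[X]) • Y.map Polynomial.C) with hf
  have hcoe : ((f : R[X]) : PowerSeries R) = Matrix.det (1 + (X : PowerSeries R) • Y.map C) := by
    rw [← Polynomial.coeToPowerSeries.ringHom_apply, hf, RingHom.map_det]
    congr 1
    ext a b : 1
    simp [Matrix.one_apply, apply_ite, Matrix.map_apply]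
    ring
  set M : Matrix m m (PowerSeries R) := 1 + (X : PowerSeries R) • Y.map C with hM
  -- the polynomial `f (z + w)` in `w`
  let φ : R[X] →+* (PowerSeries R)[X] :=
    Polynomial.eval₂RingHom (Polynomial.C.comp (C : R →+* PowerSeries R))
      (Polynomial.C (X : PowerSeries R) + Polynomial.X)
  have h1 : φ f = Polynomial.C M.det *
      Matrix.det (1 + (Polynomial.X : (PowerSeries R)[X]) •
        (Y.map C * resolvent Y).map Polynomial.C) := by
    rw [hf, RingHom.map_det, RingHom.map_det, ← Matrix.det_mul]
    congr 1
    have h2 : (Polynomial.C : PowerSeries R →+* _).mapMatrix M *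
        (Polynomial.C : PowerSeries R →+* _).mapMatrix (Y.map C * resolvent Y) =
          (Polynomial.C : PowerSeries R →+* _).mapMatrix (Y.map C) := by
      rw [← map_mul]
      congr 1
      have hcomm : M * Y.map C = Y.map C * M := by
        rw [hM, add_mul, mul_add]; simp
      rw [← mul_assoc, hcomm, mul_assoc, hM, one_add_X_smul_mul_resolvent, mul_one]
    have h3 : (Y.map C * resolvent Y).map Polynomial.C =
      (Polynomial.C : PowerSeries R →+* _).mapMatrix (Y.map C * resolvent Y) := rfl
    rw [h3, mul_add, mul_one, Matrix.mul_smul, h2]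
    ext a b : 1
    simp [hM, φ, Matrix.one_apply, apply_ite, Matrix.map_apply, add_assoc]
    ring
  have h4 : (Polynomial.derivative (φ f)).eval 0 = derivative R ((f : R[X]) : PowerSeries R) := by
    rw [derivative_coe]
    induction f using Polynomial.induction_on' with
    | add p q hp hq => simp [hp, hq]
    | monomial n a =>
      simp only [φ, Polynomial.coe_eval₂RingHom, Polynomial.eval₂_monomial, RingHom.comp_apply,
        Polynomial.derivative_C_mul, Polynomial.derivative_monomial, Polynomial.coe_monomial,
        Polynomial.derivative_pow]
      simp only [Polynomial.derivative_add, Polynomial.derivative_C, zero_add,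
        Polynomial.derivative_X, mul_one, Polynomial.eval_mul, Polynomial.eval_C,
        Polynomial.eval_pow, Polynomial.eval_add, Polynomial.eval_X, add_zero]
      rw [← mul_one (a * (n : R)), ← smul_eq_mul (a * (n : R)), LinearMap.map_smul,
        ← X_pow_eq, smul_eq_C_mul, map_mul, mul_assoc]
      simp
  rw [← hcoe, ← h4, h1, Polynomial.derivative_C_mul, Polynomial.eval_mul, Polynomial.eval_C,
    Matrix.derivative_det_one_add_X_smul, trace_mul_resolvent, hcoe, mul_comm]

theorem det_one_add_X_smul_eq_fexp (Y : Matrix m m R) :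
    Matrix.det (1 + (X : PowerSeries R) • Y.map C) =
      fexp (mk fun p => (-(-1) ^ p / (p : ℂ)) • Matrix.trace (Y ^ p)) := by
  refine fexp_unique ?_ ?_ ?_
  · rw [← coeff_zero_eq_constantCoeff_apply]; simp
  · rw [derivative_det_one_add_X_smul]
    congr 1
    ext n
    rw [coeff_derivative, coeff_mk, coeff_mk]
    have : ((n : R) + 1) = algebraMap ℂ R (n + 1) := by simp
    rw [this, mul_comm _ (algebraMap ℂ R _), ← Algebra.smul_def, smul_smul]
    have h4 : (n : ℂ) + 1 ≠ 0 := by exact_mod_cast Nat.succ_ne_zero n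
    have h5 : ((n : ℂ) + 1) * (-(-1) ^ (n + 1) / ((n + 1 : ℕ) : ℂ)) = (-1) ^ n := by
      push_cast; field_simp; ring
    rw [h5, Algebra.smul_def]
    simp
  · rw [RingHom.map_det]
    have : (constantCoeff : PowerSeries R →+* R).mapMatrix
        (1 + (X : PowerSeries R) • Y.map C) = 1 := by
      ext a b
      by_cases h : a = b <;> simp [Matrix.one_apply, h]
    rw [this, Matrix.det_one]

end det

end PowerSeries

/-! ### The exponential formula for vertices and pairs of vertices -/

theorem PowerSeries.coeff_complex_smul {R : Type*} [CommRing R] [Algebra ℂ R] (n : ℕ) (c : ℂ)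
    (f : PowerSeries R) : coeff n (c • f) = c • coeff n f := by
  rw [Algebra.smul_def, algebraMap_apply, coeff_C_mul, Algebra.smul_def]

namespace Involution

open Finset

variable {α Ty S : Type*} [Fintype α] [DecidableEq α] [Fintype Ty] [CommRing S]

/-- The sum of the loop hafnians of `T` over all the assignments of types to its elements. -/
def typedHafnian (t₀ : Ty) (x : Ty → S) (y : Sym2 Ty → S) (T : Finset α) : S :=
  ∑ p ∈ funsOn t₀ T, loopHafnian (x ∘ p) (y ∘ Sym2.map p) T

theorem typedHafnian_insert (t₀ : Ty) (x : Ty → S) (y : Sym2 Ty → S) {T : Finset α} {a : α}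
    (ha : a ∉ T) :
    typedHafnian t₀ x y (insert a T) = (∑ t, x t) * typedHafnian t₀ x y T +
      ∑ b ∈ T, (∑ t, ∑ t', y s(t, t')) * typedHafnian t₀ x y (T.erase b) := by
  have hne : ∀ v ∈ T, v ≠ a := fun v hv h => ha (h ▸ hv)
  have hup : ∀ (p : α → Ty) (t : Ty) (T' : Finset α), T' ⊆ T →
      loopHafnian (x ∘ Function.update p a t) (y ∘ Sym2.map (Function.update p a t)) T' =
        loopHafnian (x ∘ p) (y ∘ Sym2.map p) T' := by
    intro p t T' hT'
    refine loopHafnian_congr (fun v hv => ?_) (fun v hv w hw => ?_)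
    · simp [hne v (hT' hv)]
    · simp [hne v (hT' hv), hne w (hT' hw)]
  rw [typedHafnian, sum_funsOn_insert t₀ ha]
  have h1 : ∀ p : α → Ty, ∑ t, loopHafnian (x ∘ Function.update p a t)
      (y ∘ Sym2.map (Function.update p a t)) (insert a T) =
      (∑ t, x t) * loopHafnian (x ∘ p) (y ∘ Sym2.map p) T +
        ∑ b ∈ T, (∑ t, y s(t, p b)) * loopHafnian (x ∘ p) (y ∘ Sym2.map p) (T.erase b) := by
    intro p
    simp_rw [loopHafnian_insert _ _ ha, sum_mul]
    rw [sum_comm, ← sum_add_distrib]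
    refine sum_congr rfl fun t _ => ?_
    rw [hup p t T subset_rfl]
    congr 1
    · simp
    · refine sum_congr rfl fun b hb => ?_
      rw [hup p t _ (erase_subset _ _)]
      simp [hne b hb]
  simp_rw [h1, sum_add_distrib]
  congr 1
  · rw [typedHafnian, mul_sum]
  rw [sum_comm]
  refine sum_congr rfl fun b hb => ?_
  conv_lhs => rw [← insert_erase hb]
  rw [sum_funsOn_insert (M := S) t₀ (notMem_erase b T), typedHafnian, mul_sum]
  refine sum_congr rfl fun p _ => ?_
  rw [insert_erase hb, sum_comm, sum_mul]
  refine sum_congr rfl fun t _ => ?_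
  simp only [Function.update_self]
  congr 1
  refine loopHafnian_congr (fun v hv => ?_) (fun v hv w hw => ?_)
  · simp [(mem_erase.1 hv).1]
  · simp [(mem_erase.1 hv).1, (mem_erase.1 hw).1]

theorem typedHafnian_empty (t₀ : Ty) (x : Ty → S) (y : Sym2 Ty → S) :
    typedHafnian (α := α) t₀ x y ∅ = 1 := by
  have h : (funsOn t₀ ∅ : Finset (α → Ty)) = {fun _ => t₀} := by
    ext p; simp [funsOn, funext_iff]
  simp [typedHafnian, h, loopHafnian_empty]

variable [Algebra ℂ S]

/-- The coefficients of `exp (a t + b t²)`. -/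
def gaussCoeff (a b : S) (n : ℕ) : S :=
  PowerSeries.coeff n (PowerSeries.fexp
    (PowerSeries.C a * PowerSeries.X + PowerSeries.C b * PowerSeries.X ^ 2))

theorem gaussCoeff_zero (a b : S) : gaussCoeff a b 0 = 1 := by
  rw [gaussCoeff, PowerSeries.coeff_zero_eq_constantCoeff_apply, PowerSeries.constantCoeff_fexp]

theorem gaussCoeff_one (a b : S) : gaussCoeff a b 1 = a := by
  have h := congrArg (PowerSeries.coeff 0) (PowerSeries.derivative_fexp
    (F := PowerSeries.C a * PowerSeries.X + PowerSeries.C b * PowerSeries.X ^ 2) (by simp))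
  rw [PowerSeries.coeff_derivative] at h
  simp only [zero_add, Nat.cast_zero, mul_one] at h
  rw [gaussCoeff, h, PowerSeries.coeff_zero_eq_constantCoeff_apply, map_mul,
    PowerSeries.constantCoeff_fexp, ← PowerSeries.coeff_zero_eq_constantCoeff_apply,
    PowerSeries.coeff_derivative]
  simp [PowerSeries.coeff_X_pow]

theorem gaussCoeff_succ_succ (a b : S) (n : ℕ) :
    ((n : ℂ) + 2) • gaussCoeff a b (n + 2) =
      a * gaussCoeff a b (n + 1) + 2 * b * gaussCoeff a b n := by
  have h := congrArg (PowerSeries.coeff (n + 1)) (PowerSeries.derivative_fexp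
    (F := PowerSeries.C a * PowerSeries.X + PowerSeries.C b * PowerSeries.X ^ 2) (by simp))
  have hd : PowerSeries.derivative S
      (PowerSeries.C a * PowerSeries.X + PowerSeries.C b * PowerSeries.X ^ 2) =
      PowerSeries.C a + PowerSeries.C (2 * b) * PowerSeries.X := by
    rw [map_add, Derivation.leibniz, Derivation.leibniz, Derivation.leibniz_pow]
    simp [map_ofNat]
    ring
  rw [PowerSeries.coeff_derivative, hd, add_mul, map_add, PowerSeries.coeff_C_mul, mul_assoc,
    PowerSeries.coeff_C_mul, PowerSeries.coeff_succ_X_mul] at h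
  rw [gaussCoeff, gaussCoeff, gaussCoeff, ← h, Algebra.smul_def, mul_comm, map_add,
    map_natCast, map_ofNat]
  push_cast
  ring

theorem typedHafnian_eq (t₀ : Ty) (x : Ty → S) (y : Sym2 Ty → S) (T : Finset α) :
    typedHafnian t₀ x y T = (T.card.factorial : ℂ) •
      gaussCoeff (∑ t, x t) ((2⁻¹ : ℂ) • ∑ t, ∑ t', y s(t, t')) T.card := by
  induction hT : T.card using Nat.strong_induction_on generalizing T with
  | _ n ih =>
    rcases T.eq_empty_or_nonempty with rfl | ⟨a, ha⟩
    · simp at hT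
      subst hT
      simp [typedHafnian_empty, gaussCoeff_zero]
    · have hc : (T.erase a).card + 1 = n := by rw [← hT]; exact card_erase_add_one ha
      rw [← insert_erase ha, typedHafnian_insert _ _ _ (notMem_erase a T)]
      rw [ih _ (by omega) _ rfl]
      have h2 : ∀ b ∈ T.erase a, (∑ t, ∑ t', y s(t, t')) *
          typedHafnian t₀ x y ((T.erase a).erase b) = (∑ t, ∑ t', y s(t, t')) *
          (((n - 2).factorial : ℂ) •
            gaussCoeff (∑ t, x t) ((2⁻¹ : ℂ) • ∑ t, ∑ t', y s(t, t')) (n - 2)) := by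
        intro b hb
        have hcb := card_erase_add_one hb
        have : ((T.erase a).erase b).card = n - 2 := by omega
        rw [ih _ (by omega) _ rfl, this]
      rw [sum_congr rfl h2, sum_const]
      rcases n with _ | _ | n
      · omega
      · have h3 : (T.erase a).card = 0 := by omega
        simp [h3, gaussCoeff_zero, gaussCoeff_one]
      · have h3 : (T.erase a).card = n + 1 := by omega
        rw [h3, Nat.factorial_succ (n + 1)]
        have h5 : n + 1 + 1 - 2 = n := rfl
        rw [h5]
        push_cast
        rw [mul_comm ((n : ℂ) + 1 + 1), mul_smul, add_assoc (n : ℂ), one_add_one_eq_two,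
          gaussCoeff_succ_succ]
        have h4 : (2 : S) * ((2⁻¹ : ℂ) • ∑ t, ∑ t', y s(t, t')) = ∑ t, ∑ t', y s(t, t') := by
          rw [two_mul, ← add_smul]; norm_num
        rw [h4, Nat.factorial_succ n, ← Nat.cast_smul_eq_nsmul ℂ]
        push_cast
        rw [smul_add]
        congr 1
        · simp
        · simp only [mul_smul_comm, smul_smul]

/-- The sum of the coefficients of `exp (a t + b t²)` is `exp (a + b)`. -/
theorem coeff_fexp_add_eq_sum_gaussCoeff {R : Type*} [CommRing R] [Algebra ℂ R]
    {a b : PowerSeries R} (ha : PowerSeries.constantCoeff a = 0)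
    (hb : PowerSeries.constantCoeff b = 0) (n : ℕ) :
    PowerSeries.coeff n (PowerSeries.fexp (a + b)) =
      ∑ V ∈ range (2 * n + 1), PowerSeries.coeff n (gaussCoeff a b V) := by
  set F : (PowerSeries R)[X] := C a * X + C b * X ^ 2 with hF
  have hFc : (F : PowerSeries (PowerSeries R)) =
      PowerSeries.C a * PowerSeries.X + PowerSeries.C b * PowerSeries.X ^ 2 := by
    simp [hF]
  have hz : ∀ l V, n < l → PowerSeries.coeff n ((F ^ l).coeff V) = 0 := by
    intro l V hl
    obtain ⟨a', rfl⟩ := PowerSeries.X_dvd_iff.2 ha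
    obtain ⟨b', rfl⟩ := PowerSeries.X_dvd_iff.2 hb
    have : F = C PowerSeries.X * (C a' * X + C b' * X ^ 2) := by
      rw [hF, C_mul, C_mul]; ring
    rw [this, mul_pow, ← C_pow, coeff_C_mul]
    exact PowerSeries.coeff_pow_mul_eq_zero (by simp) _ hl
  have hdeg : ∀ l, l ≤ n → ∑ V ∈ range (2 * n + 1), (F ^ l).coeff V = (a + b) ^ l := by
    intro l hl
    have h1 : (F ^ l).natDegree < 2 * n + 1 := by
      have h2 : F.natDegree ≤ 2 := by rw [hF]; compute_degree
      have h3 := natDegree_pow_le_of_le l h2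
      omega
    have h4 := eval_eq_sum_range' h1 (1 : PowerSeries R)
    simp only [one_pow, mul_one] at h4
    rw [← h4, hF]
    simp
  have hg : ∀ V ∈ range (2 * n + 1), PowerSeries.coeff n (gaussCoeff a b V) =
      ∑ l ∈ range (2 * n + 1), ((l.factorial : ℂ)⁻¹) • PowerSeries.coeff n ((F ^ l).coeff V) := by
    intro V hV
    rw [gaussCoeff, PowerSeries.coeff_fexp_eq_sum (by simp)
      (show V ≤ 2 * n by simpa [Nat.lt_succ_iff] using hV), map_sum, ← hFc]
    refine sum_congr rfl fun l _ => ?_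
    rw [← Polynomial.coe_pow, Polynomial.coeff_coe, PowerSeries.coeff_complex_smul]
  rw [sum_congr rfl hg, sum_comm, PowerSeries.coeff_fexp_eq_sum (by simp [ha, hb])
    (show n ≤ 2 * n by omega)]
  refine sum_congr rfl fun l _ => ?_
  rw [← smul_sum, ← map_sum]
  rcases Nat.lt_or_ge n l with h | h
  · rw [PowerSeries.coeff_pow_eq_zero (by simp [ha, hb]) h, map_sum,
      sum_eq_zero fun V _ => hz l V h]
  · rw [hdeg l h]

/-- The exponential of a sum over types of vertices and pairs of vertices is a sum over sets of
typed vertices with an involution. -/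
theorem coeff_fexp_eq_sum_loopHafnian {R : Type*} [CommRing R] [Algebra ℂ R] (t₀ : Ty)
    (x : Ty → PowerSeries R) (y : Sym2 Ty → PowerSeries R)
    (hx : ∀ t, PowerSeries.constantCoeff (x t) = 0)
    (hy : ∀ e, PowerSeries.constantCoeff (y e) = 0) (n : ℕ) :
    PowerSeries.coeff n (PowerSeries.fexp (∑ t, x t + (2⁻¹ : ℂ) • ∑ t, ∑ t', y s(t, t'))) =
      ∑ V ∈ range (2 * n + 1), ((V.factorial : ℂ)⁻¹) • ∑ p : Fin V → Ty,
        PowerSeries.coeff n (loopHafnian (x ∘ p) (y ∘ Sym2.map p) univ) := by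
  rw [coeff_fexp_add_eq_sum_gaussCoeff (by simp [hx])
    (by simp [Algebra.smul_def, PowerSeries.algebraMap_apply, hy])]
  refine sum_congr rfl fun V _ => ?_
  have h := typedHafnian_eq t₀ x y (univ : Finset (Fin V))
  rw [card_univ, Fintype.card_fin] at h
  have h2 := congrArg (fun f => ((V.factorial : ℂ)⁻¹) • PowerSeries.coeff n f) h
  have hV : (V.factorial : ℂ) ≠ 0 := by exact_mod_cast V.factorial_ne_zero
  simp only [typedHafnian, funsOn_univ, map_sum] at h2
  rw [h2, PowerSeries.coeff_complex_smul, smul_smul, inv_mul_cancel₀ hV, one_smul]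

end Involution

/-! ### Complex Gaussian integrals on finite-dimensional spaces -/

namespace ComplexGaussian

open MeasureTheory

section general

variable {E : Type*} [NormedAddCommGroup E] [NormedSpace ℝ E] [FiniteDimensional ℝ E]

/-- Continuous functions bounded by a polynomial in the norm. -/
def PolyGrowth (F : E → ℂ) : Prop :=
  Continuous F ∧ ∃ (C : ℝ) (k : ℕ), ∀ x, ‖F x‖ ≤ C * (1 + ‖x‖) ^ k

theorem PolyGrowth.const (c : ℂ) : PolyGrowth fun _ : E => c :=
  ⟨continuous_const, ‖c‖, 0, fun x => by simp⟩

theorem PolyGrowth.add {F G : E → ℂ} (hF : PolyGrowth F) (hG : PolyGrowth G) :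
    PolyGrowth fun x => F x + G x := by
  obtain ⟨hFc, C, k, hC⟩ := hF
  obtain ⟨hGc, C', k', hC'⟩ := hG
  refine ⟨hFc.add hGc, |C| + |C'|, k + k', fun x => ?_⟩
  have h1 : (1 : ℝ) ≤ 1 + ‖x‖ := by linarith [norm_nonneg x]
  have h2 : (1 + ‖x‖) ^ k ≤ (1 + ‖x‖) ^ (k + k') := pow_le_pow_right₀ h1 (by omega)
  have h3 : (1 + ‖x‖) ^ k' ≤ (1 + ‖x‖) ^ (k + k') := pow_le_pow_right₀ h1 (by omega)
  calc ‖F x + G x‖ ≤ ‖F x‖ + ‖G x‖ := norm_add_le _ _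
    _ ≤ C * (1 + ‖x‖) ^ k + C' * (1 + ‖x‖) ^ k' := add_le_add (hC x) (hC' x)
    _ ≤ |C| * (1 + ‖x‖) ^ (k + k') + |C'| * (1 + ‖x‖) ^ (k + k') := by
      gcongr
      · exact le_abs_self C
      · exact le_abs_self C'
    _ = _ := by ring

theorem PolyGrowth.mul {F G : E → ℂ} (hF : PolyGrowth F) (hG : PolyGrowth G) :
    PolyGrowth fun x => F x * G x := by
  obtain ⟨hFc, C, k, hC⟩ := hF
  obtain ⟨hGc, C', k', hC'⟩ := hG
  refine ⟨hFc.mul hGc, C * C', k + k', fun x => ?_⟩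
  rw [norm_mul, pow_add, mul_mul_mul_comm]
  exact mul_le_mul (hC x) (hC' x) (norm_nonneg _) ((norm_nonneg _).trans (hC x))

theorem PolyGrowth.sum {ι : Type*} (s : Finset ι) {F : ι → E → ℂ}
    (hF : ∀ i ∈ s, PolyGrowth (F i)) : PolyGrowth fun x => ∑ i ∈ s, F i x := by
  classical
  induction s using Finset.induction_on with
  | empty => simpa using PolyGrowth.const 0
  | insert a s ha ih =>
    simp_rw [Finset.sum_insert ha]
    exact (hF a (by simp)).add (ih fun i hi => hF i (by simp [hi]))

theorem PolyGrowth.prod {ι : Type*} (s : Finset ι) {F : ι → E → ℂ}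
    (hF : ∀ i ∈ s, PolyGrowth (F i)) : PolyGrowth fun x => ∏ i ∈ s, F i x := by
  classical
  induction s using Finset.induction_on with
  | empty => simpa using PolyGrowth.const 1
  | insert a s ha ih =>
    simp_rw [Finset.prod_insert ha]
    exact (hF a (by simp)).mul (ih fun i hi => hF i (by simp [hi]))

theorem PolyGrowth.linear (L : E →ₗ[ℝ] ℂ) : PolyGrowth fun x => L x := by
  refine ⟨L.continuous_of_finiteDimensional, ‖LinearMap.toContinuousLinearMap L‖, 1, fun x => ?_⟩
  have h := (LinearMap.toContinuousLinearMap L).le_opNorm x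
  simp only [LinearMap.coe_toContinuousLinearMap'] at h
  refine h.trans ?_
  gcongr
  simp

theorem PolyGrowth.mvPolynomial {σ : Type*} (L : σ → E →ₗ[ℝ] ℂ) (p : MvPolynomial σ ℂ) :
    PolyGrowth fun x => MvPolynomial.eval (fun e => L e x) p := by
  induction p using MvPolynomial.induction_on with
  | C a => simpa using PolyGrowth.const a
  | add p q hp hq => simpa using hp.add hq
  | mul_X p e hp => simpa using hp.mul (PolyGrowth.linear (L e))

/-- A complex symmetric bilinear form whose real part is positive definite. -/
structure IsPosRe (B : E →ₗ[ℝ] E →ₗ[ℝ] ℂ) : Prop where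
  symm : ∀ x y, B x y = B y x
  pos : ∀ x, x ≠ 0 → 0 < (B x x).re

theorem continuous_apply_self (B : E →ₗ[ℝ] E →ₗ[ℝ] ℂ) : Continuous fun x => B x x := by
  let B' : E →L[ℝ] (E →L[ℝ] ℂ) := LinearMap.toContinuousLinearMap
    ((LinearMap.toContinuousLinearMap : (E →ₗ[ℝ] ℂ) ≃ₗ[ℝ] (E →L[ℝ] ℂ)).toLinearMap ∘ₗ B)
  have h : (fun x => B x x) = fun x => B' x x := rfl
  rw [h]
  exact (B'.continuous).clm_apply continuous_id

theorem IsPosRe.exists_le {B : E →ₗ[ℝ] E →ₗ[ℝ] ℂ} (hB : IsPosRe B) :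
    ∃ c : ℝ, 0 < c ∧ ∀ x, c * ‖x‖ ^ 2 ≤ (B x x).re := by
  have hcont : Continuous fun x => (B x x).re :=
    Complex.continuous_re.comp (continuous_apply_self B)
  have key : ∃ c : ℝ, 0 < c ∧ ∀ x ∈ Metric.sphere (0 : E) 1, c ≤ (B x x).re := by
    rcases (Metric.sphere (0 : E) 1).eq_empty_or_nonempty with h | h
    · exact ⟨1, one_pos, by simp [h]⟩
    · obtain ⟨x₀, hx₀, hmin⟩ := (isCompact_sphere (0 : E) 1).exists_isMinOn h hcont.continuousOn
      refine ⟨(B x₀ x₀).re, hB.pos x₀ ?_, fun x hx => hmin hx⟩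
      rintro rfl
      simp at hx₀
  obtain ⟨c, hc, h⟩ := key
  refine ⟨c, hc, fun x => ?_⟩
  rcases eq_or_ne x 0 with rfl | hx
  · simp
  have hx' : ‖x‖ ≠ 0 := norm_ne_zero_iff.2 hx
  have h1 := h (‖x‖⁻¹ • x) (by simp [norm_smul, hx'])
  simp only [map_smul, LinearMap.smul_apply, Complex.real_smul, Complex.re_ofReal_mul] at h1
  have h2 : 0 < ‖x‖ := by positivity
  calc c * ‖x‖ ^ 2 ≤ (‖x‖⁻¹ * (‖x‖⁻¹ * (B x x).re)) * ‖x‖ ^ 2 := by gcongr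
    _ = (B x x).re := by field_simp

/-- The Gaussian weight of a bilinear form. -/
def weight (B : E →ₗ[ℝ] E →ₗ[ℝ] ℂ) (x : E) : ℂ := Complex.exp (-(B x x))

theorem continuous_weight (B : E →ₗ[ℝ] E →ₗ[ℝ] ℂ) : Continuous (weight B) :=
  Complex.continuous_exp.comp (continuous_apply_self B).neg

variable [MeasurableSpace E] [BorelSpace E] {μ : Measure E} [μ.IsAddHaarMeasure]

theorem IsPosRe.integrable_mul_weight {B : E →ₗ[ℝ] E →ₗ[ℝ] ℂ} (hB : IsPosRe B) {F : E → ℂ}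
    (hF : PolyGrowth F) : Integrable (fun x => F x * weight B x) μ := by
  obtain ⟨c, hc, hcB⟩ := hB.exists_le
  obtain ⟨hFc, C, k, hC⟩ := hF
  set r : ℕ := Module.finrank ℝ E + 1 with hr
  -- boundedness of `(1 + s)^(k+r) exp(-c s²)`
  obtain ⟨K, hK⟩ : ∃ K : ℝ, ∀ s : ℝ, 0 ≤ s → (1 + s) ^ (k + r) * Real.exp (-(c * s ^ 2)) ≤ K := by
    have hbd : ∀ n : ℕ, ∀ s : ℝ, 0 ≤ s → Real.exp (-(c * s ^ 2)) * (1 + s) ^ n ≤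
        (n.factorial : ℝ) * Real.exp (1 + c⁻¹) := by
      intro n s hs
      have h1 : (1 + s) ^ n ≤ n.factorial * Real.exp (1 + s) := by
        have h := Real.pow_div_factorial_le_exp (1 + s) (by linarith) n
        rw [div_le_iff₀ (by positivity)] at h
        linarith
      have h2 : s ≤ c * s ^ 2 + c⁻¹ := by
        have h3 : 0 ≤ (c * s - 1 / 2) ^ 2 * c⁻¹ := by positivity
        have h4 : (c * s - 1 / 2) ^ 2 * c⁻¹ = c * s ^ 2 - s + c⁻¹ / 4 := by field_simp; ring
        have h5 : 0 < c⁻¹ := by positivity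
        linarith
      calc Real.exp (-(c * s ^ 2)) * (1 + s) ^ n
          ≤ Real.exp (-(c * s ^ 2)) * (n.factorial * Real.exp (1 + s)) := by gcongr
        _ = n.factorial * Real.exp (-(c * s ^ 2) + (1 + s)) := by
          rw [Real.exp_add (-(c * s ^ 2))]; ring
        _ ≤ _ := mul_le_mul_of_nonneg_left (Real.exp_le_exp.2 (by linarith)) (by positivity)
    exact ⟨_, fun s hs => by rw [mul_comm]; exact hbd (k + r) s hs⟩
  have hint : Integrable (fun x : E => (C * K) * (1 + ‖x‖) ^ (-(r : ℝ))) μ :=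
    (integrable_one_add_norm (by rw [hr]; push_cast; linarith)).const_mul _
  refine hint.mono' (hFc.mul (continuous_weight B)).aestronglyMeasurable
    (Filter.Eventually.of_forall fun x => ?_)
  have h1 : (0 : ℝ) < 1 + ‖x‖ := by positivity
  have hC0 : 0 ≤ C := by
    have h2 := (norm_nonneg (F x)).trans (hC x)
    by_contra hneg
    push Not at hneg
    have h3 : C * (1 + ‖x‖) ^ k < 0 := mul_neg_of_neg_of_pos hneg (by positivity)
    linarith
  rw [norm_mul, weight, Complex.norm_exp, Complex.neg_re, Real.rpow_neg h1.le, Real.rpow_natCast]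
  have h4 : Real.exp (-(B x x).re) ≤ Real.exp (-(c * ‖x‖ ^ 2)) :=
    Real.exp_le_exp.2 (neg_le_neg (hcB x))
  calc ‖F x‖ * Real.exp (-(B x x).re)
      ≤ (C * (1 + ‖x‖) ^ k) * Real.exp (-(c * ‖x‖ ^ 2)) := by gcongr; exact hC x
    _ = C * ((1 + ‖x‖) ^ (k + r) * Real.exp (-(c * ‖x‖ ^ 2))) * ((1 + ‖x‖) ^ r)⁻¹ := by
      rw [pow_add]; field_simp
    _ ≤ C * K * ((1 + ‖x‖) ^ r)⁻¹ := by
      gcongr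
      exact hK _ (norm_nonneg x)

theorem IsPosRe.integrable_weight {B : E →ₗ[ℝ] E →ₗ[ℝ] ℂ} (hB : IsPosRe B) :
    Integrable (weight B) μ := by
  simpa using hB.integrable_mul_weight (μ := μ) (PolyGrowth.const 1)

theorem hasLineDerivAt_linear (L : E →ₗ[ℝ] ℂ) (x v : E) :
    HasLineDerivAt ℝ (fun x => L x) (L v) x v := by
  unfold HasLineDerivAt
  simp only [map_add, map_smul]
  have h := ((hasDerivAt_id (0 : ℝ)).smul_const (L v)).const_add (L x)
  simpa using h

theorem hasLineDerivAt_prod {ι : Type*} [DecidableEq ι] (S : Finset ι) (L : ι → E →ₗ[ℝ] ℂ)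
    (x v : E) :
    HasLineDerivAt ℝ (fun x => ∏ j ∈ S, L j x)
      (∑ b ∈ S, L b v * ∏ j ∈ S.erase b, L j x) x v := by
  unfold HasLineDerivAt
  have h := HasDerivAt.fun_finsetProd (u := S) (x := (0 : ℝ))
    (f := fun j (t : ℝ) => L j (x + t • v)) (f' := fun j => L j v)
    (fun j _ => hasLineDerivAt_linear (L j) x v)
  refine h.congr_deriv ?_
  refine Finset.sum_congr rfl fun b _ => ?_
  simp [mul_comm]

theorem hasLineDerivAt_weight {B : E →ₗ[ℝ] E →ₗ[ℝ] ℂ} (hB : IsPosRe B) (x v : E) :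
    HasLineDerivAt ℝ (weight B) (-(2 * B x v) * weight B x) x v := by
  unfold HasLineDerivAt weight
  have h1 : HasDerivAt (fun t : ℝ => -(B (x + t • v) (x + t • v))) (-(2 * B x v)) 0 := by
    have h2 : (fun t : ℝ => -(B (x + t • v) (x + t • v))) =
        fun t : ℝ => -(B x x + t • (2 * B x v) + (t ^ 2) • B v v) := by
      ext t
      simp only [map_add, map_smul, LinearMap.add_apply, LinearMap.smul_apply, hB.symm v x,
        Complex.real_smul]
      push_cast
      ring
    rw [h2]
    have h3 := ((((hasDerivAt_id (0 : ℝ)).smul_const (2 * B x v)).const_add (B x x)).add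
      (((hasDerivAt_id (0 : ℝ)).pow 2).smul_const (B v v))).neg
    refine h3.congr_deriv ?_
    simp
  have h4 := h1.cexp
  simpa [mul_comm] using h4

/-- Integration by parts for a Gaussian weight. -/
theorem IsPosRe.integral_mul_weight_stein {B : E →ₗ[ℝ] E →ₗ[ℝ] ℂ} (hB : IsPosRe B)
    {ι : Type*} [DecidableEq ι] (S : Finset ι) (L : ι → E →ₗ[ℝ] ℂ) (v : E) :
    ∫ x, (2 * B x v * ∏ j ∈ S, L j x) * weight B x ∂μ =
      ∑ b ∈ S, L b v * ∫ x, (∏ j ∈ S.erase b, L j x) * weight B x ∂μ := by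
  have hprod : ∀ S' : Finset ι, PolyGrowth fun x => ∏ j ∈ S', L j x :=
    fun S' => PolyGrowth.prod S' fun j _ => PolyGrowth.linear (L j)
  have hBv : PolyGrowth fun x => B x v := by
    simpa using PolyGrowth.linear (B.flip v)
  have h := integral_bilinear_hasLineDerivAt_right_eq_neg_left_of_integrable (μ := μ)
    (B := ContinuousLinearMap.mul ℝ ℂ) (f := fun x => ∏ j ∈ S, L j x)
    (f' := fun x => ∑ b ∈ S, L b v * ∏ j ∈ S.erase b, L j x) (g := weight B)
    (g' := fun x => -(2 * B x v) * weight B x) (v := v) ?_ ?_ ?_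
    (fun x _ => hasLineDerivAt_prod S L x v) (fun x _ => hasLineDerivAt_weight hB x v)
  · simp only [ContinuousLinearMap.mul_apply'] at h
    have h1 : ∀ x, (∏ j ∈ S, L j x) * (-(2 * B x v) * weight B x) =
        -((2 * B x v * ∏ j ∈ S, L j x) * weight B x) := fun x => by ring
    simp_rw [h1, integral_neg, neg_inj] at h
    rw [h]
    simp_rw [Finset.sum_mul]
    rw [integral_finsetSum]
    · refine Finset.sum_congr rfl fun b _ => ?_
      simp_rw [mul_assoc]
      rw [integral_const_mul]
    · intro b _
      exact hB.integrable_mul_weight ((PolyGrowth.const (L b v)).mul (hprod _))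
  · exact hB.integrable_mul_weight
      (PolyGrowth.sum S fun b _ => (PolyGrowth.const (L b v)).mul (hprod _))
  · simp only [ContinuousLinearMap.mul_apply']
    have h2 := hB.integrable_mul_weight (μ := μ) ((hprod S).mul ((PolyGrowth.const (-2)).mul hBv))
    refine h2.congr (Filter.Eventually.of_forall fun x => ?_)
    simp only
    ring
  · exact hB.integrable_mul_weight (hprod S)

end general

end ComplexGaussian

namespace ComplexGaussian

open MeasureTheory

/-- The bilinear form obtained by integrating out the first coordinate. -/
def schurComplement {n : ℕ} (B : (Fin (n + 1) → ℝ) →ₗ[ℝ] (Fin (n + 1) → ℝ) →ₗ[ℝ] ℂ) :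
    (Fin n → ℝ) →ₗ[ℝ] (Fin n → ℝ) →ₗ[ℝ] ℂ :=
  LinearMap.mk₂ ℝ (fun x y => B (Fin.cons 0 x) (Fin.cons 0 y) -
      B (Fin.cons 1 0) (Fin.cons 0 x) * B (Fin.cons 1 0) (Fin.cons 0 y) /
        B (Fin.cons 1 0) (Fin.cons 1 0))
    (fun x x' y => by
      have h : (Fin.cons 0 (x + x') : Fin (n + 1) → ℝ) = Fin.cons 0 x + Fin.cons 0 x' := by
        ext i; refine Fin.cases ?_ (fun j => ?_) i <;> simp
      rw [h]; simp only [map_add, LinearMap.add_apply]; ring)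
    (fun c x y => by
      have h : (Fin.cons 0 (c • x) : Fin (n + 1) → ℝ) = c • Fin.cons 0 x := by
        ext i; refine Fin.cases ?_ (fun j => ?_) i <;> simp
      rw [h]; simp only [map_smul, LinearMap.smul_apply, Complex.real_smul]; ring)
    (fun x y y' => by
      have h : (Fin.cons 0 (y + y') : Fin (n + 1) → ℝ) = Fin.cons 0 y + Fin.cons 0 y' := by
        ext i; refine Fin.cases ?_ (fun j => ?_) i <;> simp
      rw [h]; simp only [map_add]; ring)
    (fun c x y => by
      have h : (Fin.cons 0 (c • y) : Fin (n + 1) → ℝ) = c • Fin.cons 0 y := by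
        ext i; refine Fin.cases ?_ (fun j => ?_) i <;> simp
      rw [h]; simp only [map_smul, Complex.real_smul]; ring)

theorem apply_cons_cons {n : ℕ} {B : (Fin (n + 1) → ℝ) →ₗ[ℝ] (Fin (n + 1) → ℝ) →ₗ[ℝ] ℂ}
    (hB : IsPosRe B) (s : ℝ) (x : Fin n → ℝ) :
    B (Fin.cons s x) (Fin.cons s x) = B (Fin.cons 1 0) (Fin.cons 1 0) * s ^ 2 +
      2 * B (Fin.cons 1 0) (Fin.cons 0 x) * s + B (Fin.cons 0 x) (Fin.cons 0 x) := by
  have h : (Fin.cons s x : Fin (n + 1) → ℝ) = s • Fin.cons 1 0 + Fin.cons 0 x := by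
    ext i; refine Fin.cases ?_ (fun j => ?_) i <;> simp
  rw [h]
  simp only [map_add, map_smul, LinearMap.add_apply, LinearMap.smul_apply, Complex.real_smul,
    hB.symm (Fin.cons 0 x) (Fin.cons 1 0)]
  ring

theorem cons_one_zero_ne_zero {n : ℕ} : (Fin.cons 1 0 : Fin (n + 1) → ℝ) ≠ 0 := by
  intro h
  have := congrFun h 0
  simp at this

theorem IsPosRe.schurComplement {n : ℕ}
    {B : (Fin (n + 1) → ℝ) →ₗ[ℝ] (Fin (n + 1) → ℝ) →ₗ[ℝ] ℂ} (hB : IsPosRe B) :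
    IsPosRe (schurComplement B) := by
  have hpos : 0 < (B (Fin.cons 1 0) (Fin.cons 1 0)).re := hB.pos _ cons_one_zero_ne_zero
  refine ⟨fun x y => ?_, fun x hx => ?_⟩
  · simp only [ComplexGaussian.schurComplement, LinearMap.mk₂_apply]
    rw [hB.symm (Fin.cons 0 x) (Fin.cons 0 y)]
    ring
  · simp only [ComplexGaussian.schurComplement, LinearMap.mk₂_apply]
    set a := B (Fin.cons 1 0) (Fin.cons 1 0) with ha
    have ha0 : a ≠ 0 := fun h => by rw [h] at hpos; simp at hpos
    set b := B (Fin.cons 1 0) (Fin.cons 0 x) with hb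
    set s : ℝ := -(b / a).re with hs
    have h1 : 0 < (B (Fin.cons s x) (Fin.cons s x)).re := by
      refine hB.pos _ fun h => hx ?_
      ext i
      simpa using congrFun h i.succ
    rw [apply_cons_cons hB, ← ha, ← hb] at h1
    have hba : b / a = ((-s : ℝ) : ℂ) + (b / a).im * Complex.I := by
      rw [hs, neg_neg]; exact (Complex.re_add_im _).symm
    have h2 : b = a * (((-s : ℝ) : ℂ) + (b / a).im * Complex.I) := by
      rw [← hba]; field_simp
    have h3 : a * s ^ 2 + 2 * b * s + B (Fin.cons 0 x) (Fin.cons 0 x) =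
        (B (Fin.cons 0 x) (Fin.cons 0 x) - b * b / a) - ((b / a).im ^ 2 : ℝ) * a := by
      have h4 : b * b / a = a * (b / a) ^ 2 := by field_simp
      rw [h4, show 2 * b * (s : ℂ) = 2 * (a * (b / a)) * s by rw [mul_div_cancel₀ _ ha0]]
      generalize (b / a).im = t at hba
      rw [hba]
      push_cast
      linear_combination (a * t ^ 2) * Complex.I_sq
    rw [h3, Complex.sub_re, Complex.re_ofReal_mul] at h1
    have : 0 ≤ (b / a).im ^ 2 * a.re := by positivity
    linarith

theorem integral_weight_ne_zero_pi {n : ℕ} (B : (Fin n → ℝ) →ₗ[ℝ] (Fin n → ℝ) →ₗ[ℝ] ℂ)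
    (hB : IsPosRe B) : ∫ x, weight B x ≠ 0 := by
  induction n with
  | zero =>
    have h : weight B = fun _ => 1 := by
      ext x
      have : x = 0 := Subsingleton.elim _ _
      rw [weight, this, map_zero, neg_zero, Complex.exp_zero]
    rw [h]
    simp [Measure.real, volume_pi]
  | succ n ih =>
    have hpos : 0 < (B (Fin.cons 1 0) (Fin.cons 1 0)).re := hB.pos _ cons_one_zero_ne_zero
    set a := B (Fin.cons 1 0) (Fin.cons 1 0) with ha
    have ha0 : a ≠ 0 := fun h => by rw [h] at hpos; simp at hpos
    have hmp := (volume_preserving_piFinSuccAbove (fun _ : Fin (n + 1) => ℝ) 0).symm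
    rw [← hmp.integral_comp (MeasurableEquiv.measurableEmbedding _)]
    have hint : Integrable (fun p : ℝ × (Fin n → ℝ) => weight B (Fin.cons p.1 p.2))
        (volume.prod volume) := by
      have := hmp.integrable_comp_emb (MeasurableEquiv.measurableEmbedding _)
        |>.2 (hB.integrable_weight (μ := volume))
      simpa [Function.comp_def, MeasurableEquiv.piFinSuccAbove, Fin.insertNthEquiv] using! this
    have hval : ∀ p : ℝ × (Fin n → ℝ), weight B
        ((MeasurableEquiv.piFinSuccAbove (fun _ : Fin (n + 1) => ℝ) 0).symm p) =
          weight B (Fin.cons p.1 p.2) := by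
      intro p
      simp [MeasurableEquiv.piFinSuccAbove, Fin.insertNthEquiv]
    simp_rw [hval]
    rw [Measure.volume_eq_prod, integral_prod_symm _ hint]
    have hinner : ∀ x : Fin n → ℝ, ∫ s : ℝ, weight B (Fin.cons s x) =
        (Real.pi / a) ^ (1 / 2 : ℂ) * weight (schurComplement B) x := by
      intro x
      have h1 : ∀ s : ℝ, weight B (Fin.cons s x) = Complex.exp ((-a) * s ^ 2 +
          (-(2 * B (Fin.cons 1 0) (Fin.cons 0 x))) * s + (-B (Fin.cons 0 x) (Fin.cons 0 x))) := by
        intro s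
        rw [weight, apply_cons_cons hB, ← ha]
        congr 1
        ring
      simp_rw [h1]
      rw [integral_cexp_quadratic (by simpa using hpos), neg_neg, weight]
      congr 2
      simp only [schurComplement, LinearMap.mk₂_apply, ← ha]
      field_simp
      ring
    simp only [hinner]
    rw [integral_const_mul]
    refine mul_ne_zero ?_ (ih _ hB.schurComplement)
    rw [Complex.cpow_def_of_ne_zero]
    · exact Complex.exp_ne_zero _
    · exact div_ne_zero (by exact_mod_cast Real.pi_ne_zero) ha0

theorem IsPosRe.integral_weight_ne_zero {E : Type*} [NormedAddCommGroup E] [NormedSpace ℝ E]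
    [FiniteDimensional ℝ E] [MeasurableSpace E] [BorelSpace E] {μ : Measure E}
    [μ.IsAddHaarMeasure] {B : E →ₗ[ℝ] E →ₗ[ℝ] ℂ} (hB : IsPosRe B) :
    ∫ x, weight B x ∂μ ≠ 0 := by
  let e : (Fin (Module.finrank ℝ E) → ℝ) ≃L[ℝ] E :=
    (ContinuousLinearEquiv.ofFinrankEq (by simp))
  have hμ := Measure.isAddLeftInvariant_eq_smul μ
    ((volume : Measure (Fin (Module.finrank ℝ E) → ℝ)).map e)
  rw [hμ, integral_smul_nnreal_measure]
  have hB' : IsPosRe (B.compl₁₂ e.toLinearEquiv.toLinearMap e.toLinearEquiv.toLinearMap) :=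
    ⟨fun x y => hB.symm _ _, fun x hx => hB.pos _ (by simpa using hx)⟩
  have h1 := integral_weight_ne_zero_pi _ hB'
  have h2 : ∫ x, weight B x ∂((volume : Measure (Fin (Module.finrank ℝ E) → ℝ)).map e) =
      ∫ x, weight (B.compl₁₂ e.toLinearEquiv.toLinearMap e.toLinearEquiv.toLinearMap) x := by
    exact (e.toHomeomorph.measurableEmbedding).integral_map (μ := volume) (weight B)
  rw [h2]
  refine smul_ne_zero ?_ h1
  exact (Measure.addHaarScalarFactor_pos_of_isAddHaarMeasure _ _).ne'

end ComplexGaussian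

/-! ### The Gaussian measure of the two-matrix model -/

namespace TwoMatrixData

open MeasureTheory ComplexGaussian

/-- `hermitian` as a linear map. -/
def hermitianL (m : ℕ) : (Fin m → Fin m → ℝ) →ₗ[ℝ] Matrix (Fin m) (Fin m) ℂ where
  toFun := hermitian
  map_add' u v := by
    ext a b
    simp only [hermitian, Matrix.of_apply, Matrix.add_apply, Pi.add_apply]
    split_ifs <;> push_cast <;> ring
  map_smul' c u := by
    ext a b
    simp only [hermitian, Matrix.of_apply, Matrix.smul_apply, Pi.smul_apply, smul_eq_mul,
      RingHom.id_apply, Complex.real_smul]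
    split_ifs <;> push_cast <;> ring

theorem hermitian_apply_swap {m : ℕ} (u : Fin m → Fin m → ℝ) (a b : Fin m) :
    hermitian u b a = (starRingEnd ℂ) (hermitian u a b) := by
  simp only [hermitian, Matrix.of_apply]
  rcases lt_trichotomy a b with h | rfl | h
  · simp [h, h.ne, h.ne', h.not_gt, sub_eq_add_neg]
  · simp
  · simp [h, h.ne, h.ne', h.not_gt]

theorem exists_hermitian_eq {m : ℕ} {H : Matrix (Fin m) (Fin m) ℂ}
    (hH : ∀ a b, H b a = (starRingEnd ℂ) (H a b)) : ∃ u, hermitian u = H := by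
  refine ⟨fun a b => if a ≤ b then (H a b).re else (H b a).im, ?_⟩
  ext a b
  simp only [hermitian, Matrix.of_apply]
  rcases lt_trichotomy a b with h | rfl | h
  · simp [h, h.ne, h.le, h.not_ge, Complex.re_add_im]
  · simp only [le_refl, if_true]
    have h1 := congrArg Complex.im (hH a a)
    simp only [Complex.conj_im] at h1
    apply Complex.ext
    · simp
    · simp; linarith
  · simp only [h.ne', if_false, h.not_gt, h.le, if_true, h.not_ge]
    rw [hH b a]
    apply Complex.ext <;> simp

theorem hermitian_injective {m : ℕ} {u : Fin m → Fin m → ℝ} (h : hermitian u = 0) : u = 0 := by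
  have key : ∀ a b, a ≤ b → u a b = 0 ∧ u b a = 0 := by
    intro a b hab
    have h1 := congrFun (congrFun h a) b
    simp only [hermitian, Matrix.of_apply, Matrix.zero_apply] at h1
    rcases hab.eq_or_lt with rfl | hlt
    · simp at h1; exact ⟨h1, h1⟩
    · simp only [hlt.ne, if_false, hlt, if_true] at h1
      have hr := congrArg Complex.re h1
      have hi := congrArg Complex.im h1
      simp at hr hi
      exact ⟨hr, hi⟩
  ext a b
  rcases le_total a b with h1 | h1
  · exact (key a b h1).1
  · exact (key b a h1).2

variable (D : TwoMatrixData)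

/-- The coefficients of the quadratic part of the action. -/
def quadCoeff (i : D.Color) : Spin → Spin → ℂ
  | true, true => (derivative^[2] D.V₁).eval (D.ξ i) / 2
  | false, false => (derivative^[2] D.V₂).eval (D.η i) / 2
  | _, _ => -1 / 2

theorem quadCoeff_symm (i : D.Color) (s s' : Spin) : D.quadCoeff i s s' = D.quadCoeff i s' s := by
  cases s <;> cases s' <;> rfl

theorem quad_eq (i : D.Color) (z : Spin → ℂ) :
    D.quad i z = ∑ s, ∑ s', D.quadCoeff i s s' * z s * z s' := by
  simp only [quad, quadCoeff, Fintype.sum_bool]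
  ring

/-- The propagator between spins, up to the factor `T / N`. -/
def propagator (i : D.Color) : Spin → Spin → ℂ
  | true, true => D.t false 2 i / (D.t true 2 i * D.t false 2 i - 1)
  | false, false => D.t true 2 i / (D.t true 2 i * D.t false 2 i - 1)
  | _, _ => 1 / (D.t true 2 i * D.t false 2 i - 1)

theorem propagator_symm (i : D.Color) (s s' : Spin) :
    D.propagator i s s' = D.propagator i s' s := by
  cases s <;> cases s' <;> rfl

theorem quadCoeff_mul_propagator {i : D.Color} (h : D.t true 2 i * D.t false 2 i ≠ 1)
    (s s₁ : Spin) :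
    ∑ s₂, 2 * D.quadCoeff i s₁ s₂ * D.propagator i s s₂ = if s₁ = s then 1 else 0 := by
  have h1 : (derivative^[2] D.V₁).eval (D.ξ i) = D.t true 2 i := by simp [t, V, pt]
  have h2 : (derivative^[2] D.V₂).eval (D.η i) = D.t false 2 i := by simp [t, V, pt]
  have h3 : D.t true 2 i * D.t false 2 i - 1 ≠ 0 := sub_ne_zero.2 h
  cases s <;> cases s₁ <;> simp only [quadCoeff, propagator, Fintype.sum_bool, h1, h2] <;>
    simp <;> field_simp <;> ring

variable (A : D.Color → Matrix Spin Spin ℂ)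

theorem exists_isContour {i : D.Color} (h : D.t true 2 i * D.t false 2 i ≠ 1) :
    ∃ A, D.IsContour i A := by
  have h1 : (derivative^[2] D.V₁).eval (D.ξ i) = D.t true 2 i := by simp [t, V, pt]
  have h2 : (derivative^[2] D.V₂).eval (D.η i) = D.t false 2 i := by simp [t, V, pt]
  set a := D.t true 2 i
  set b := D.t false 2 i
  suffices hA : ∃ A : Matrix Spin Spin ℂ, ∀ x : Spin → ℝ,
      D.quad i (A.mulVec fun s => (x s : ℂ)) = ((x true ^ 2 + x false ^ 2 : ℝ) : ℂ) by
    obtain ⟨A, hA⟩ := hA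
    refine ⟨A, fun x hx => ?_⟩
    rw [hA, Complex.ofReal_re]
    by_contra hneg
    apply hx
    have h3 : x true ^ 2 = 0 := by nlinarith [sq_nonneg (x true), sq_nonneg (x false)]
    have h4 : x false ^ 2 = 0 := by nlinarith [sq_nonneg (x true), sq_nonneg (x false)]
    ext s
    cases s
    · simpa using h4
    · simpa using h3
  by_cases ha : a = 0
  · refine ⟨Matrix.of fun s s' => if s then (if s' then b / 2 - 1 else (b / 2 + 1) * Complex.I)
      else (if s' then 1 else Complex.I), fun x => ?_⟩
    simp only [quad, h1, h2, Matrix.mulVec, dotProduct, Fintype.sum_bool, Matrix.of_apply, ha]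
    push_cast
    simp
    linear_combination (-(x false : ℂ) ^ 2) * Complex.I_sq
  · have hc : b / 2 - 1 / (2 * a) ≠ 0 := by
      intro h0
      apply h
      field_simp at h0
      linear_combination h0
    obtain ⟨p, hp⟩ := IsAlgClosed.exists_pow_nat_eq (2 / a : ℂ) two_pos
    obtain ⟨q, hq⟩ := IsAlgClosed.exists_pow_nat_eq (1 / (b / 2 - 1 / (2 * a)) : ℂ) two_pos
    refine ⟨Matrix.of fun s s' => if s then (if s' then p else q / a)
      else (if s' then 0 else q), fun x => ?_⟩
    simp only [quad, h1, h2, Matrix.mulVec, dotProduct, Fintype.sum_bool, Matrix.of_apply]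
    have hp' : a / 2 * p ^ 2 = 1 := by rw [hp]; field_simp
    have hq' : (b / 2 - 1 / (2 * a)) * q ^ 2 = 1 := by
      rw [hq]; exact mul_one_div_cancel hc
    push_cast
    simp
    have key : ∀ x y : ℂ, a / 2 * (p * x + q / a * y) ^ 2 + b / 2 * (q * y) ^ 2 -
        (p * x + q / a * y) * (q * y) =
        (a / 2 * p ^ 2) * x ^ 2 + ((b / 2 - 1 / (2 * a)) * q ^ 2) * y ^ 2 := by
      intro x y; field_simp; ring
    rw [key, hp', hq']
    ring

variable {D A}

/-- Contour matrices are invertible. -/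
theorem IsContour.isUnit_det {i : D.Color} {A : Matrix Spin Spin ℂ} (hA : D.IsContour i A) :
    IsUnit A.det := by
  rw [isUnit_iff_ne_zero]
  intro h0
  obtain ⟨z, hz, hAz⟩ := Matrix.exists_mulVec_eq_zero_iff.2 h0
  set x : Spin → ℝ := fun s => (z s).re with hx
  set y : Spin → ℝ := fun s => (z s).im with hy
  have hzxy : z = (fun s => (x s : ℂ)) + Complex.I • (fun s => (y s : ℂ)) := by
    ext s
    simp [hx, hy, mul_comm Complex.I, Complex.re_add_im]
  rw [hzxy, Matrix.mulVec_add, Matrix.mulVec_smul] at hAz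
  have h1 : A.mulVec (fun s => (x s : ℂ)) = -(Complex.I • A.mulVec (fun s => (y s : ℂ))) :=
    eq_neg_of_add_eq_zero_left hAz
  have h2 : D.quad i (A.mulVec fun s => (x s : ℂ)) = -D.quad i (A.mulVec fun s => (y s : ℂ)) := by
    rw [h1, quad_eq, quad_eq, ← Finset.sum_neg_distrib]
    refine Finset.sum_congr rfl fun s _ => ?_
    rw [← Finset.sum_neg_distrib]
    refine Finset.sum_congr rfl fun s' _ => ?_
    simp only [Pi.neg_apply, Pi.smul_apply, smul_eq_mul]
    linear_combination (D.quadCoeff i s s' * (A.mulVec (fun s => (y s : ℂ)) s) *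
      (A.mulVec (fun s => (y s : ℂ)) s')) * Complex.I_sq
  have h3 : ∀ w : Spin → ℝ, 0 ≤ (D.quad i (A.mulVec fun s => (w s : ℂ))).re := by
    intro w
    rcases eq_or_ne w 0 with rfl | hw
    · have : (fun s => (((0 : Spin → ℝ) s : ℝ) : ℂ)) = 0 := by ext; simp
      rw [this, Matrix.mulVec_zero, quad_eq]
      simp
    · exact (hA w hw).le
  have hxy : x ≠ 0 ∨ y ≠ 0 := by
    by_contra hcon
    push Not at hcon
    apply hz
    rw [hzxy, hcon.1, hcon.2]
    ext; simp
  have h4 := congrArg Complex.re h2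
  rw [Complex.neg_re] at h4
  rcases hxy with hne | hne
  · have := hA _ hne; linarith [h3 y]
  · have := hA _ hne; linarith [h3 x]

variable (D A)

/-- `pert` as a linear map. -/
def pertL (i : D.Color) (s : Spin) : D.Config →ₗ[ℝ] Matrix (Fin (D.n i)) (Fin (D.n i)) ℂ where
  toFun u := D.pert A u i s
  map_add' u v := by
    have h : ∀ s', hermitian ((u + v) i s') = hermitian (u i s') + hermitian (v i s') :=
      fun s' => (hermitianL (D.n i)).map_add (u i s') (v i s')
    simp only [pert, h, smul_add, Finset.sum_add_distrib]
  map_smul' c u := by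
    have h : ∀ s', hermitian ((c • u) i s') = c • hermitian (u i s') :=
      fun s' => (hermitianL (D.n i)).map_smul c (u i s')
    simp only [pert, h, smul_comm _ c, Finset.smul_sum, RingHom.id_apply]

theorem pertL_apply (i : D.Color) (s : Spin) (u : D.Config) :
    D.pertL A i s u = D.pert A u i s := rfl

/-- The labels of the matrix elements. -/
abbrev Entry : Type := (i : D.Color) × (Spin × Fin (D.n i) × Fin (D.n i))

/-- The matrix elements as linear forms. -/
def entryForm (e : D.Entry) : D.Config →ₗ[ℝ] ℂ where
  toFun u := D.pert A u e.1 e.2.1 e.2.2.1 e.2.2.2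
  map_add' u v := by
    rw [← pertL_apply, map_add, Matrix.add_apply, pertL_apply, pertL_apply]
  map_smul' c u := by
    rw [← pertL_apply, map_smul, Matrix.smul_apply, pertL_apply, RingHom.id_apply]

/-- The quadratic part of the action as a bilinear form. -/
def actionForm (T : ℝ) : D.Config →ₗ[ℝ] D.Config →ₗ[ℝ] ℂ :=
  LinearMap.mk₂ ℝ (fun u v => ((D.N : ℂ) / T) * ∑ i, ∑ s, ∑ s', D.quadCoeff i s s' *
      Matrix.trace (D.pert A u i s * D.pert A v i s'))
    (fun u u' v => by
      simp only [← pertL_apply, map_add, add_mul, Matrix.trace_add, mul_add,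
        Finset.sum_add_distrib])
    (fun c u v => by
      simp only [← pertL_apply, map_smul, Matrix.smul_mul, Matrix.trace_smul, mul_smul_comm,
        ← Finset.smul_sum])
    (fun u v v' => by
      simp only [← pertL_apply, map_add, Matrix.trace_add, mul_add, Finset.sum_add_distrib])
    (fun c u v => by
      simp only [← pertL_apply, map_smul, Matrix.trace_smul, mul_smul_comm, ← Finset.smul_sum])

theorem actionForm_apply (T : ℝ) (u v : D.Config) :
    D.actionForm A T u v = ((D.N : ℂ) / T) * ∑ i, ∑ s, ∑ s', D.quadCoeff i s s' *
      Matrix.trace (D.pert A u i s * D.pert A v i s') := rfl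

theorem gaussWeight_eq (T : ℝ) : D.gaussWeight A T = ComplexGaussian.weight (D.actionForm A T) := by
  ext u
  have hm : ∀ i s, D.mat A u i s - D.pt s i • (1 : Matrix (Fin (D.n i)) (Fin (D.n i)) ℂ) =
      D.pert A u i s := fun i s => by simp [mat]
  rw [gaussWeight, ← Complex.exp_sum, ComplexGaussian.weight, actionForm_apply, Finset.mul_sum,
    ← Finset.sum_neg_distrib]
  congr 1
  refine Finset.sum_congr rfl fun i _ => ?_
  have h1 := hm i true
  have h2 := hm i false
  simp only [pt] at h1 h2
  rw [h1, h2]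
  simp only [Fintype.sum_bool, quadCoeff, Matrix.trace_sub, Matrix.trace_add, Matrix.trace_smul,
    smul_eq_mul, pow_two]
  rw [Matrix.trace_mul_comm (D.pert A u i false) (D.pert A u i true)]
  ring

/-- A sum of products over a Hermitian pair splits in real and imaginary parts. -/
theorem sum_quadCoeff_trace (i : D.Color) (u : D.Config) :
    ∑ s, ∑ s', D.quadCoeff i s s' * Matrix.trace (D.pert A u i s * D.pert A u i s') =
      ∑ a, ∑ b, (D.quad i ((A i).mulVec fun s => ((hermitian (u i s) a b).re : ℂ)) +
        D.quad i ((A i).mulVec fun s => ((hermitian (u i s) a b).im : ℂ))) := by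
  simp only [Matrix.trace, Matrix.diag_apply, Matrix.mul_apply, Finset.mul_sum]
  have hswap : ∀ f : Spin → Spin → Fin (D.n i) → Fin (D.n i) → ℂ,
      ∑ s, ∑ s', ∑ a, ∑ b, f s s' a b = ∑ a, ∑ b, ∑ s, ∑ s', f s s' a b := by
    intro f
    simp only [Fintype.sum_bool, Finset.sum_add_distrib]
  rw [hswap]
  refine Finset.sum_congr rfl fun a _ => Finset.sum_congr rfl fun b _ => ?_
  set x : Spin → ℂ := fun s => ((hermitian (u i s) a b).re : ℂ) with hx
  set y : Spin → ℂ := fun s => ((hermitian (u i s) a b).im : ℂ) with hy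
  have h1 : ∀ s, D.pert A u i s a b = (A i).mulVec x s + Complex.I * (A i).mulVec y s := by
    intro s
    simp only [pert, Matrix.sum_apply, Matrix.smul_apply, smul_eq_mul, Matrix.mulVec, dotProduct,
      Finset.mul_sum, ← Finset.sum_add_distrib]
    refine Finset.sum_congr rfl fun s' _ => ?_
    have h := Complex.re_add_im (hermitian (u i s') a b)
    simp only [hx, hy]
    linear_combination (-A i s s') * h
  have h2 : ∀ s, D.pert A u i s b a = (A i).mulVec x s - Complex.I * (A i).mulVec y s := by
    intro s
    simp only [pert, Matrix.sum_apply, Matrix.smul_apply, smul_eq_mul, Matrix.mulVec, dotProduct,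
      Finset.mul_sum, ← Finset.sum_sub_distrib]
    refine Finset.sum_congr rfl fun s' _ => ?_
    have h := congrArg (starRingEnd ℂ) (Complex.re_add_im (hermitian (u i s') a b))
    simp only [map_add, map_mul, Complex.conj_ofReal, Complex.conj_I] at h
    rw [hermitian_apply_swap]
    simp only [hx, hy]
    linear_combination (-A i s s') * h
  simp only [h1, h2, quad_eq, Fintype.sum_bool]
  rw [D.quadCoeff_symm i false true]
  generalize (A i).mulVec x true = x1
  generalize (A i).mulVec x false = x2
  generalize (A i).mulVec y true = y1
  generalize (A i).mulVec y false = y2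
  linear_combination (-(D.quadCoeff i true true * y1 * y1 + 2 * D.quadCoeff i true false * y1 * y2 +
    D.quadCoeff i false false * y2 * y2)) * Complex.I_sq

variable {D A}

theorem isPosRe_actionForm (hA : ∀ i, D.IsContour i (A i)) (hN : 0 < D.N) {T : ℝ} (hT : 0 < T) :
    IsPosRe (D.actionForm A T) := by
  refine ⟨fun u v => ?_, fun u hu => ?_⟩
  · rw [actionForm_apply, actionForm_apply]
    refine congrArg (fun z => ((D.N : ℂ) / T) * z) ?_
    refine Finset.sum_congr rfl fun i _ => ?_
    rw [Finset.sum_comm]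
    refine Finset.sum_congr rfl fun s _ => Finset.sum_congr rfl fun s' _ => ?_
    rw [quadCoeff_symm, Matrix.trace_mul_comm]
  · rw [actionForm_apply]
    have hc : (D.N : ℂ) / (T : ℂ) = ((D.N / T : ℝ) : ℂ) := by push_cast; rfl
    rw [hc, Complex.re_ofReal_mul]
    have hN' : (0 : ℝ) < D.N := by exact_mod_cast hN
    refine mul_pos (by positivity) ?_
    simp_rw [sum_quadCoeff_trace, Complex.re_sum, Complex.add_re]
    have h0 : ∀ i (w : Spin → ℝ), 0 ≤ (D.quad i ((A i).mulVec fun s => (w s : ℂ))).re := by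
      intro i w
      rcases eq_or_ne w 0 with rfl | hw
      · have : (fun s => (((0 : Spin → ℝ) s : ℝ) : ℂ)) = 0 := by ext; simp
        rw [this, Matrix.mulVec_zero, quad_eq]
        simp
      · exact (hA i w hw).le
    obtain ⟨i, hi⟩ := Function.ne_iff.1 hu
    obtain ⟨s, hs⟩ := Function.ne_iff.1 hi
    have hH : hermitian (u i s) ≠ 0 := fun h => hs (hermitian_injective h)
    obtain ⟨a, b, hab⟩ : ∃ a b, hermitian (u i s) a b ≠ 0 := by
      by_contra hcon
      push Not at hcon
      exact hH (by ext a b; simp [hcon a b])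
    refine Finset.sum_pos' (fun i _ => Finset.sum_nonneg fun a _ => Finset.sum_nonneg fun b _ =>
      add_nonneg (h0 i _) (h0 i _)) ⟨i, Finset.mem_univ i, ?_⟩
    refine Finset.sum_pos' (fun a _ => Finset.sum_nonneg fun b _ =>
      add_nonneg (h0 i _) (h0 i _)) ⟨a, Finset.mem_univ a, ?_⟩
    refine Finset.sum_pos' (fun b _ => add_nonneg (h0 i _) (h0 i _)) ⟨b, Finset.mem_univ b, ?_⟩
    have hri : (hermitian (u i s) a b).re ≠ 0 ∨ (hermitian (u i s) a b).im ≠ 0 := by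
      by_contra hcon
      push Not at hcon
      exact hab (Complex.ext hcon.1 hcon.2)
    rcases hri with h | h
    · refine add_pos_of_pos_of_nonneg (hA i _ ?_) (h0 i _)
      exact Function.ne_iff.2 ⟨s, h⟩
    · refine add_pos_of_nonneg_of_pos (h0 i _) (hA i _ ?_)
      exact Function.ne_iff.2 ⟨s, h⟩

end TwoMatrixData

namespace Involution

open Equiv Finset

variable {α R : Type*} [Fintype α] [DecidableEq α] [CommRing R]

variable (α) in
/-- The involutions without fixed points. -/
def pairings : Finset (Perm α) := univ.filter fun σ => (∀ v, σ (σ v) = v) ∧ ∀ v, σ v ≠ v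

theorem mem_pairings {σ : Perm α} : σ ∈ pairings α ↔ (∀ v, σ (σ v) = v) ∧ ∀ v, σ v ≠ v := by
  simp [pairings]

theorem two_mul_card_pairs {σ : Perm α} (hσ : σ ∈ pairings α) :
    2 * (pairs σ).card = Fintype.card α := by
  rw [mem_pairings] at hσ
  have h1 : ∀ e ∈ pairs σ, (univ.filter fun v => s(v, σ v) = e).card = 2 := by
    intro e he
    induction e with | _ a b
    rw [mem_pairs hσ.1] at he
    obtain ⟨rfl, hne⟩ := he
    have : (univ.filter fun v => s(v, σ v) = s(a, σ a)) = {a, σ a} := by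
      ext v
      simp only [mem_filter, mem_univ, true_and, Sym2.eq_iff, mem_insert, mem_singleton]
      constructor
      · rintro (⟨h, -⟩ | ⟨h, -⟩)
        · exact Or.inl h
        · exact Or.inr h
      · rintro (rfl | rfl)
        · exact Or.inl ⟨rfl, rfl⟩
        · exact Or.inr ⟨rfl, hσ.1 a⟩
    rw [this, card_pair hne]
  have h2 := card_eq_sum_card_fiberwise (f := fun v => s(v, σ v)) (s := (univ : Finset α))
    (t := pairs σ) (fun v _ => by
      simp only [pairs, coe_image, Set.mem_image]
      exact ⟨v, by simp [hσ.2 v], rfl⟩)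
  rw [← card_univ, h2, sum_congr rfl h1, sum_const, smul_eq_mul, mul_comm]

theorem loopHafnian_zero (c : Sym2 α → R) :
    loopHafnian 0 c univ = ∑ σ ∈ pairings α, ∏ e ∈ pairs σ, c e := by
  have hsub : pairings α ⊆ involutionsOn univ := by
    intro σ hσ
    rw [mem_pairings] at hσ
    rw [mem_involutionsOn]
    exact ⟨hσ.1, by simp⟩
  rw [loopHafnian, ← sum_subset hsub]
  · refine sum_congr rfl fun σ hσ => ?_
    rw [mem_pairings] at hσ
    rw [filter_false_of_mem fun v _ => hσ.2 v, prod_empty, one_mul]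
  · intro σ h1 h2
    rw [mem_involutionsOn] at h1
    rw [mem_pairings] at h2
    push Not at h2
    obtain ⟨v, hv⟩ := h2 h1.1
    rw [prod_eq_zero (i := v) (by simp [hv]) (by simp), zero_mul]

theorem loopHafnian_zero_mul (T : R) (c : Sym2 α → R) :
    loopHafnian 0 (fun e => T * c e) univ =
      T ^ (Fintype.card α / 2) * ∑ σ ∈ pairings α, ∏ e ∈ pairs σ, c e := by
  rw [loopHafnian_zero, mul_sum]
  refine sum_congr rfl fun σ hσ => ?_
  have h := two_mul_card_pairs hσ
  rw [prod_mul_distrib, prod_const, show Fintype.card α / 2 = (pairs σ).card by omega]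

theorem pairings_eq_empty (h : Odd (Fintype.card α)) : pairings α = ∅ := by
  by_contra hne
  obtain ⟨σ, hσ⟩ := nonempty_iff_ne_empty.2 hne
  have h1 := two_mul_card_pairs hσ
  rw [← h1] at h
  exact (Nat.not_odd_iff_even.2 (even_two_mul _)) h

end Involution

namespace TwoMatrixData

open MeasureTheory ComplexGaussian

variable {D : TwoMatrixData} {A : D.Color → Matrix Spin Spin ℂ}

instance isAddHaarMeasure_volume_config : (volume : Measure D.Config).IsAddHaarMeasure := by
  have h₁ (k : ℕ) : (volume : Measure (Fin k → Fin k → ℝ)).IsAddHaarMeasure :=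
    Measure.pi.isAddHaarMeasure fun _ : Fin k => (volume : Measure (Fin k → ℝ))
  have h₂ (k : ℕ) : (volume : Measure (Spin → Fin k → Fin k → ℝ)).IsAddHaarMeasure :=
    Measure.pi.isAddHaarMeasure fun _ : Spin => (volume : Measure (Fin k → Fin k → ℝ))
  exact Measure.pi.isAddHaarMeasure fun i =>
    (volume : Measure (Spin → Fin (D.n i) → Fin (D.n i) → ℝ))

theorem integrable_eval_mul_gaussWeight (hA : ∀ i, D.IsContour i (A i)) (hN : 0 < D.N) {T : ℝ}
    (hT : 0 < T) (p : MvPolynomial D.Entry ℂ) :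
    Integrable fun u => MvPolynomial.eval (fun e => D.entryForm A e u) p * D.gaussWeight A T u := by
  rw [gaussWeight_eq]
  exact (isPosRe_actionForm hA hN hT).integrable_mul_weight
    (PolyGrowth.mvPolynomial (D.entryForm A) p)

theorem integral_gaussWeight_ne_zero (hA : ∀ i, D.IsContour i (A i)) (hN : 0 < D.N) {T : ℝ}
    (hT : 0 < T) : ∫ u, D.gaussWeight A T u ≠ 0 := by
  rw [gaussWeight_eq]
  exact (isPosRe_actionForm hA hN hT).integral_weight_ne_zero

/-- The Gaussian mean value of polynomials in the matrix elements. -/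
def mean (hA : ∀ i, D.IsContour i (A i)) (hN : 0 < D.N) {T : ℝ} (hT : 0 < T) :
    MvPolynomial D.Entry ℂ →ₗ[ℂ] ℂ where
  toFun p := D.gaussMean A T fun u => MvPolynomial.eval (fun e => D.entryForm A e u) p
  map_add' p q := by
    simp only [gaussMean, map_add, add_mul]
    rw [integral_add (integrable_eval_mul_gaussWeight hA hN hT p)
      (integrable_eval_mul_gaussWeight hA hN hT q), add_div]
  map_smul' c p := by
    simp only [gaussMean, MvPolynomial.smul_eval, mul_assoc, RingHom.id_apply, smul_eq_mul]
    rw [integral_const_mul, mul_div_assoc]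

theorem mean_apply (hA : ∀ i, D.IsContour i (A i)) (hN : 0 < D.N) {T : ℝ} (hT : 0 < T)
    (p : MvPolynomial D.Entry ℂ) : mean hA hN hT p =
      D.gaussMean A T fun u => MvPolynomial.eval (fun e => D.entryForm A e u) p := rfl

theorem mean_one (hA : ∀ i, D.IsContour i (A i)) (hN : 0 < D.N) {T : ℝ} (hT : 0 < T) :
    mean hA hN hT 1 = 1 := by
  simp only [mean_apply, gaussMean, map_one, one_mul]
  exact div_self (integral_gaussWeight_ne_zero hA hN hT)

variable (D) in
/-- The covariance of two matrix elements at `T = 1`. -/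
def cov (e e' : D.Entry) : ℂ :=
  if e' = ⟨e.1, e'.2.1, e.2.2.2, e.2.2.1⟩ then D.propagator e.1 e.2.1 e'.2.1 / D.N else 0

theorem cov_mk_same (i : D.Color) (s s' : Spin) (a b a' b' : Fin (D.n i)) :
    D.cov ⟨i, s, a, b⟩ ⟨i, s', a', b'⟩ =
      if a' = b ∧ b' = a then D.propagator i s s' / D.N else 0 := by
  simp [cov]

theorem cov_of_ne {e e' : D.Entry} (h : e.1 ≠ e'.1) : D.cov e e' = 0 := by
  rw [cov, if_neg]
  intro he
  exact h (congrArg Sigma.fst he).symm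

theorem cov_symm (e e' : D.Entry) : D.cov e e' = D.cov e' e := by
  obtain ⟨i, s, a, b⟩ := e
  obtain ⟨i', s', a', b'⟩ := e'
  by_cases h : i = i'
  · subst h
    rw [cov_mk_same, cov_mk_same, D.propagator_symm]
    refine if_congr ?_ rfl rfl
    constructor <;> rintro ⟨rfl, rfl⟩ <;> exact ⟨rfl, rfl⟩
  · rw [cov_of_ne h, cov_of_ne (Ne.symm h)]

theorem pert_single_same (i : D.Color) (σ : Spin) (w : Fin (D.n i) → Fin (D.n i) → ℝ) (s : Spin) :
    D.pert A (Pi.single i (Pi.single σ w)) i s = A i s σ • hermitian w := by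
  have h0 : hermitian (0 : Fin (D.n i) → Fin (D.n i) → ℝ) = 0 := (hermitianL (D.n i)).map_zero
  rw [pert, Finset.sum_eq_single σ]
  · simp
  · intro s' _ hs'
    simp [hs', h0]
  · simp

theorem pert_single_of_ne {i i' : D.Color} (h : i' ≠ i) (w : Spin → Fin (D.n i) → Fin (D.n i) → ℝ)
    (s : Spin) : D.pert A (Pi.single i w) i' s = 0 := by
  have h0 : hermitian (0 : Fin (D.n i') → Fin (D.n i') → ℝ) = 0 := (hermitianL (D.n i')).map_zero
  simp [pert, h, h0]

/-- Every complex direction carried by a single matrix element is a complex combination of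
directions in the contour. -/
theorem exists_direction {i : D.Color} (hA : D.IsContour i (A i)) (κ : Spin → ℂ)
    (a b : Fin (D.n i)) :
    ∃ (c : Spin × Bool → ℂ) (v : Spin × Bool → D.Config),
      (∀ s, ∑ k, c k • D.pert A (v k) i s = κ s • Matrix.single b a 1) ∧
      ∀ i' ≠ i, ∀ k s, D.pert A (v k) i' s = 0 := by
  obtain ⟨u₁, hu₁⟩ := exists_hermitian_eq
    (H := (Matrix.single a b 1 + Matrix.single b a 1 : Matrix (Fin (D.n i)) (Fin (D.n i)) ℂ))
    (fun x y => by
      simp only [Matrix.add_apply, Matrix.single_apply, map_add, apply_ite (starRingEnd ℂ),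
        map_one, map_zero]
      rw [add_comm]
      congr 1 <;> simp [and_comm])
  obtain ⟨u₂, hu₂⟩ := exists_hermitian_eq
    (H := (Complex.I • (Matrix.single a b 1 - Matrix.single b a 1) :
      Matrix (Fin (D.n i)) (Fin (D.n i)) ℂ))
    (fun x y => by
      simp only [Matrix.smul_apply, Matrix.sub_apply, Matrix.single_apply, map_sub, smul_eq_mul,
        map_mul, Complex.conj_I, apply_ite (starRingEnd ℂ), map_one, map_zero]
      rw [neg_mul, ← mul_neg, neg_sub]
      congr 2 <;> simp [and_comm])
  set γ : Spin → ℂ := (A i)⁻¹.mulVec κ with hγ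
  have hAγ : (A i).mulVec γ = κ := by
    rw [hγ, Matrix.mulVec_mulVec, Matrix.mul_nonsing_inv _ hA.isUnit_det, Matrix.one_mulVec]
  refine ⟨fun k => γ k.1 * (if k.2 then 1 / 2 else Complex.I / 2),
    fun k => Pi.single i (Pi.single k.1 (if k.2 then u₁ else u₂)), fun s => ?_, ?_⟩
  · rw [Fintype.sum_prod_type]
    simp only [pert_single_same]
    have h1 : ∀ σ, ∑ t : Bool, (γ σ * (if t = true then 1 / 2 else Complex.I / 2)) •
        A i s σ • hermitian (if t = true then u₁ else u₂) =
          (A i s σ * γ σ) • Matrix.single b a (1 : ℂ) := by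
      intro σ
      simp only [Fintype.sum_bool, if_true, Bool.false_eq_true, if_false, hu₁, hu₂]
      ext x y
      simp only [Matrix.add_apply, Matrix.smul_apply, Matrix.sub_apply, smul_eq_mul]
      linear_combination (γ σ * A i s σ / 2 *
        (Matrix.single a b (1 : ℂ) x y - Matrix.single b a (1 : ℂ) x y)) * Complex.I_sq
    simp only [h1, ← Finset.sum_smul]
    rw [← hAγ]
    rfl
  · intro i' hi' k s
    exact pert_single_of_ne hi' _ s

/-- The recursion satisfied by the Gaussian mean values of products of matrix elements. -/
theorem mean_X_mul_prod (hA : ∀ i, D.IsContour i (A i))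
    (hnondeg : ∀ i, D.t true 2 i * D.t false 2 i ≠ 1) (hN : 0 < D.N) {T : ℝ}
    (hT : 0 < T) {α : Type*} [DecidableEq α] (S : Finset α) (f : α → D.Entry) (e : D.Entry) :
    mean hA hN hT (MvPolynomial.X e * ∏ v ∈ S, MvPolynomial.X (f v)) =
      ∑ b ∈ S, (T * D.cov e (f b)) *
        mean hA hN hT (∏ v ∈ S.erase b, MvPolynomial.X (f v)) := by
  obtain ⟨i, s, a, b⟩ := e
  have hN0 : (D.N : ℂ) ≠ 0 := by exact_mod_cast hN.ne'
  have hT0 : (T : ℂ) ≠ 0 := by exact_mod_cast hT.ne'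
  obtain ⟨c, v, hv, hv'⟩ := exists_direction (hA i)
    (fun s' => (T / D.N : ℂ) * D.propagator i s s') a b
  have hB := isPosRe_actionForm hA hN hT
  have hform : ∀ u : D.Config, ∑ k, c k * (2 * D.actionForm A T u (v k)) =
      D.entryForm A ⟨i, s, a, b⟩ u := by
    intro u
    have h1 : ∀ k, D.actionForm A T u (v k) = ((D.N : ℂ) / T) * ∑ s₁, ∑ s₂,
        D.quadCoeff i s₁ s₂ * Matrix.trace (D.pert A u i s₁ * D.pert A (v k) i s₂) := by
      intro k
      rw [actionForm_apply, Finset.sum_eq_single i]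
      · intro i' _ hi'
        simp [hv' i' hi']
      · simp
    have h2 : ∀ s₁ s₂, ∑ k, c k * Matrix.trace (D.pert A u i s₁ * D.pert A (v k) i s₂) =
        ((T / D.N : ℂ) * D.propagator i s s₂) * D.pert A u i s₁ a b := by
      intro s₁ s₂
      have h3 : ∑ k, c k * Matrix.trace (D.pert A u i s₁ * D.pert A (v k) i s₂) =
          Matrix.trace (D.pert A u i s₁ * ∑ k, c k • D.pert A (v k) i s₂) := by
        rw [Finset.mul_sum, Matrix.trace_sum]
        refine Finset.sum_congr rfl fun k _ => ?_
        rw [Matrix.mul_smul, Matrix.trace_smul, smul_eq_mul]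
      rw [h3, hv, Matrix.mul_smul, Matrix.trace_smul, smul_eq_mul, Matrix.trace_mul_single]
      simp
    have h4 : ∑ k, c k * (2 * D.actionForm A T u (v k)) =
        2 * ((D.N : ℂ) / T) * ∑ s₁, ∑ s₂, D.quadCoeff i s₁ s₂ *
          ∑ k, c k * Matrix.trace (D.pert A u i s₁ * D.pert A (v k) i s₂) := by
      simp only [h1, Finset.mul_sum]
      rw [Finset.sum_comm]
      refine Finset.sum_congr rfl fun s₁ _ => ?_
      rw [Finset.sum_comm]
      refine Finset.sum_congr rfl fun s₂ _ => Finset.sum_congr rfl fun k _ => ?_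
      ring
    rw [h4]
    simp only [h2]
    have h5 : ∀ s₁, ∑ s₂, D.quadCoeff i s₁ s₂ * (((T / D.N : ℂ) * D.propagator i s s₂) *
        D.pert A u i s₁ a b) = (T / D.N / 2 : ℂ) * ((if s₁ = s then 1 else 0) *
          D.pert A u i s₁ a b) := by
      intro s₁
      rw [← D.quadCoeff_mul_propagator (hnondeg i), Finset.sum_mul, Finset.mul_sum]
      refine Finset.sum_congr rfl fun s₂ _ => ?_
      ring
    simp only [h5, ← Finset.mul_sum, ite_mul, one_mul, zero_mul, Finset.sum_ite_eq',
      Finset.mem_univ, if_true]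
    change _ = D.pert A u i s a b
    field_simp
  have hcov : ∀ e' : D.Entry, ∑ k, c k * D.entryForm A e' (v k) =
      T * D.cov ⟨i, s, a, b⟩ e' := by
    rintro ⟨i', s', a', b'⟩
    change ∑ k, c k * D.pert A (v k) i' s' a' b' = _
    by_cases h : i' = i
    · subst h
      have h1 := congrFun (congrFun (hv s') a') b'
      simp only [Matrix.sum_apply, Matrix.smul_apply, smul_eq_mul] at h1
      rw [h1, cov_mk_same, Matrix.single_apply]
      by_cases h2 : b = a' ∧ a = b'
      · rw [if_pos h2, if_pos ⟨h2.1.symm, h2.2.symm⟩]; ring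
      · rw [if_neg h2, if_neg fun h3 => h2 ⟨h3.1.symm, h3.2.symm⟩]; ring
    · rw [cov_of_ne (Ne.symm h), mul_zero]
      simp [hv' i' h]
  have hmean : ∀ p : MvPolynomial D.Entry ℂ, mean hA hN hT p =
      (∫ u, MvPolynomial.eval (fun e => D.entryForm A e u) p *
        ComplexGaussian.weight (D.actionForm A T) u) /
        ∫ u, ComplexGaussian.weight (D.actionForm A T) u := by
    intro p
    rw [mean_apply, gaussMean, gaussWeight_eq]
  rw [hmean]
  simp only [hmean, ← mul_div_assoc]
  rw [← Finset.sum_div]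
  congr 1
  simp only [map_mul, map_prod, MvPolynomial.eval_X, ← hform, Finset.sum_mul]
  rw [integral_finsetSum]
  · have h1 : ∀ k, ∫ u, c k * (2 * D.actionForm A T u (v k)) *
        (∏ x ∈ S, D.entryForm A (f x) u) * ComplexGaussian.weight (D.actionForm A T) u =
        ∑ b ∈ S, (c k * D.entryForm A (f b) (v k)) *
          ∫ u, (∏ x ∈ S.erase b, D.entryForm A (f x) u) *
            ComplexGaussian.weight (D.actionForm A T) u := by
      intro k
      have h2 := hB.integral_mul_weight_stein (μ := volume) S (fun x => D.entryForm A (f x)) (v k)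
      have h3 : ∀ u, c k * (2 * D.actionForm A T u (v k)) *
        (∏ x ∈ S, D.entryForm A (f x) u) * ComplexGaussian.weight (D.actionForm A T) u =
        c k * ((2 * D.actionForm A T u (v k) * ∏ x ∈ S, D.entryForm A (f x) u) *
          ComplexGaussian.weight (D.actionForm A T) u) := fun u => by ring
      simp_rw [h3]
      rw [integral_const_mul, h2, Finset.mul_sum]
      simp only [mul_assoc]
    simp only [h1]
    rw [Finset.sum_comm]
    refine Finset.sum_congr rfl fun b _ => ?_
    rw [← Finset.sum_mul, hcov]
  · intro k _
    refine hB.integrable_mul_weight ?_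
    refine PolyGrowth.mul ?_ (PolyGrowth.prod S fun x _ => PolyGrowth.linear (D.entryForm A (f x)))
    refine (PolyGrowth.const (c k)).mul ((PolyGrowth.const 2).mul ?_)
    exact PolyGrowth.linear ((D.actionForm A T).flip (v k))

variable (D) in
/-- The covariance as a function of unordered pairs. -/
def covSym : Sym2 D.Entry → ℂ := Sym2.lift ⟨D.cov, cov_symm⟩

/-- Wick's theorem for the matrix elements. -/
theorem mean_prod_X (hA : ∀ i, D.IsContour i (A i))
    (hnondeg : ∀ i, D.t true 2 i * D.t false 2 i ≠ 1) (hN : 0 < D.N) {T : ℝ}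
    (hT : 0 < T) {α : Type*} [Fintype α] [DecidableEq α] (f : α → D.Entry) :
    mean hA hN hT (∏ v, MvPolynomial.X (f v)) =
      (T : ℂ) ^ (Fintype.card α / 2) *
        ∑ σ ∈ Involution.pairings α, ∏ e ∈ Involution.pairs σ, D.covSym (e.map f) := by
  rw [← Involution.loopHafnian_zero_mul]
  refine Involution.expectation_prod_eq_loopHafnian (mean hA hN hT)
    (fun v => MvPolynomial.X (f v)) _ (mean_one hA hN hT) ?_ _
  intro S a _
  rw [mean_X_mul_prod hA hnondeg hN hT]
  simp [covSym]

end TwoMatrixData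

namespace MvPolynomial

variable {σ : Type*}

/-- The substitution `X_e ↦ z X_e`. -/
def scale : MvPolynomial σ ℂ →ₐ[ℂ] PowerSeries (MvPolynomial σ ℂ) :=
  aeval fun e => PowerSeries.C (X e) * PowerSeries.X

theorem scale_monomial (m : σ →₀ ℕ) (c : ℂ) :
    scale (monomial m c) = PowerSeries.C (monomial m c) * PowerSeries.X ^ m.degree := by
  have h : (m.prod fun e k => (X e : MvPolynomial σ ℂ) ^ k) = ∏ e ∈ m.support, X e ^ m e := rfl
  have h' : (m.prod fun e k => (PowerSeries.C (X e) * PowerSeries.X :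
      PowerSeries (MvPolynomial σ ℂ)) ^ k) =
      ∏ e ∈ m.support, (PowerSeries.C (X e) * PowerSeries.X) ^ m e := rfl
  have hC : algebraMap ℂ (PowerSeries (MvPolynomial σ ℂ)) c = PowerSeries.C (C c) := by
    rw [PowerSeries.algebraMap_apply, algebraMap_eq]
  rw [scale, aeval_monomial, monomial_eq, h, h', hC, map_mul, mul_assoc, map_prod,
    Finsupp.degree_apply, ← Finset.prod_pow_eq_pow_sum, ← Finset.prod_mul_distrib]
  simp only [mul_pow, map_pow]

theorem coeff_scale (d : ℕ) (p : MvPolynomial σ ℂ) :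
    PowerSeries.coeff d (scale p) = homogeneousComponent d p := by
  induction p using MvPolynomial.induction_on' with
  | monomial m c =>
    have h : monomial m c ∈ homogeneousSubmodule σ ℂ m.degree := isHomogeneous_monomial c rfl
    rw [scale_monomial, PowerSeries.coeff_C_mul, PowerSeries.coeff_X_pow,
      homogeneousComponent_of_mem h]
    split_ifs <;> simp
  | add p q hp hq => rw [map_add, map_add, map_add, hp, hq]

end MvPolynomial

namespace TwoMatrixData

variable {D : TwoMatrixData} {A : D.Color → Matrix Spin Spin ℂ}

section scaling

variable (hA : ∀ i, D.IsContour i (A i)) (hnondeg : ∀ i, D.t true 2 i * D.t false 2 i ≠ 1)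
  (hN : 0 < D.N)

include hnondeg in
theorem mean_monomial {T : ℝ} (hT : 0 < T) (m : D.Entry →₀ ℕ) (c : ℂ) :
    mean hA hN hT (MvPolynomial.monomial m c) = (T : ℂ) ^ (m.degree / 2) *
      mean hA hN one_pos (MvPolynomial.monomial m c) ∧
    (Odd m.degree → mean hA hN hT (MvPolynomial.monomial m c) = 0) := by
  classical
  have h1 : MvPolynomial.monomial m c =
      c • ∏ v : (e : D.Entry) × Fin (m e), (MvPolynomial.X v.1 : MvPolynomial D.Entry ℂ) := by
    rw [MvPolynomial.monomial_eq, MvPolynomial.smul_eq_C_mul, Fintype.prod_sigma,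
      Finsupp.prod_fintype _ _ (by simp)]
    simp
  have h2 : Fintype.card ((e : D.Entry) × Fin (m e)) = m.degree := by
    simp [Finsupp.degree_eq_sum]
  rw [h1, map_smul, map_smul, mean_prod_X hA hnondeg hN hT, mean_prod_X hA hnondeg hN one_pos, h2]
  refine ⟨by simp; ring, fun h => ?_⟩
  rw [Involution.pairings_eq_empty (by rwa [h2])]
  simp

include hnondeg in
theorem mean_of_isHomogeneous {T : ℝ} (hT : 0 < T) {p : MvPolynomial D.Entry ℂ} {d : ℕ}
    (hp : p.IsHomogeneous d) :
    mean hA hN hT p = (T : ℂ) ^ (d / 2) * mean hA hN one_pos p ∧ (Odd d → mean hA hN hT p = 0) := by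
  have hdeg : ∀ m ∈ p.support, m.degree = d := by
    intro m hm
    have := hp (MvPolynomial.mem_support_iff.1 hm)
    rwa [Finsupp.degree_eq_weight_one]
  rw [← MvPolynomial.support_sum_monomial_coeff p, map_sum, map_sum, Finset.mul_sum]
  refine ⟨Finset.sum_congr rfl fun m hm => ?_, fun h => Finset.sum_eq_zero fun m hm => ?_⟩
  · rw [(mean_monomial hA hnondeg hN hT m _).1, hdeg m hm]
  · exact (mean_monomial hA hnondeg hN hT m _).2 (by rwa [hdeg m hm])

include hnondeg in
theorem mean_coeff_scale_odd {d : ℕ} (hd : Odd d) (p : MvPolynomial D.Entry ℂ) :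
    mean hA hN one_pos (PowerSeries.coeff d (MvPolynomial.scale p)) = 0 := by
  rw [MvPolynomial.coeff_scale]
  exact (mean_of_isHomogeneous hA hnondeg hN one_pos
    (MvPolynomial.homogeneousComponent_isHomogeneous d p)).2 hd

include hnondeg in
theorem mean_eq_sum {T : ℝ} (hT : 0 < T) (p : MvPolynomial D.Entry ℂ) {B : ℕ}
    (hB : p.totalDegree < B) :
    mean hA hN hT p = ∑ d ∈ Finset.range B, (T : ℂ) ^ (d / 2) *
      mean hA hN one_pos (PowerSeries.coeff d (MvPolynomial.scale p)) := by
  conv_lhs => rw [← MvPolynomial.sum_homogeneousComponent p]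
  rw [map_sum]
  have hsub : Finset.range (p.totalDegree + 1) ⊆ Finset.range B :=
    Finset.range_mono (by omega)
  rw [Finset.sum_subset hsub]
  · refine Finset.sum_congr rfl fun d _ => ?_
    rw [MvPolynomial.coeff_scale]
    exact (mean_of_isHomogeneous hA hnondeg hN hT
      (MvPolynomial.homogeneousComponent_isHomogeneous d p)).1
  · intro d _ hd
    rw [Finset.mem_range, not_lt] at hd
    rw [MvPolynomial.homogeneousComponent_eq_zero _ _ (by omega), map_zero]

theorem sum_range_two_mul {M : Type*} [AddCommMonoid M] (f : ℕ → M) (B : ℕ) :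
    ∑ d ∈ Finset.range (2 * B), f d = ∑ k ∈ Finset.range B, (f (2 * k) + f (2 * k + 1)) := by
  induction B with
  | zero => simp
  | succ B ih =>
    rw [Nat.mul_succ, Finset.sum_range_succ, Finset.sum_range_succ, Finset.sum_range_succ, ih,
      add_assoc]

include hnondeg in
/-- The mean value of a polynomial divisible by `z^{2l}` after scaling, as a polynomial in `T`. -/
theorem mean_eq_of_scale_eq {T : ℝ} (hT : 0 < T) (p : MvPolynomial D.Entry ℂ) {l : ℕ}
    {G : PowerSeries (MvPolynomial D.Entry ℂ)}
    (hG : MvPolynomial.scale p = PowerSeries.X ^ (2 * l) * G) :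
    mean hA hN hT p = (T : ℂ) ^ l * ∑ k ∈ Finset.range (p.totalDegree + 1), (T : ℂ) ^ k *
      mean hA hN one_pos (PowerSeries.coeff (2 * k) G) := by
  rw [mean_eq_sum hA hnondeg hN hT p (B := 2 * (l + (p.totalDegree + 1))) (by omega),
    sum_range_two_mul, Finset.sum_range_add, Finset.sum_eq_zero (s := Finset.range l), zero_add,
    Finset.mul_sum]
  · refine Finset.sum_congr rfl fun k _ => ?_
    rw [mean_coeff_scale_odd hA hnondeg hN (d := 2 * (l + k) + 1) ⟨l + k, rfl⟩, mul_zero, add_zero,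
      hG, show 2 * (l + k) = 2 * k + 2 * l by ring, PowerSeries.coeff_X_pow_mul,
      show (2 * k + 2 * l) / 2 = l + k by omega, pow_add, mul_assoc]
  · intro k hk
    rw [Finset.mem_range] at hk
    rw [mean_coeff_scale_odd hA hnondeg hN (d := 2 * k + 1) ⟨k, rfl⟩, mul_zero, add_zero, hG,
      PowerSeries.coeff_X_pow_mul', if_neg (by omega), map_zero, mul_zero]

end scaling

section observables

variable (D)
variable {S S' : Type*} [CommRing S] [Algebra ℂ S] [CommRing S'] [Algebra ℂ S']

/-- The interaction, for matrices over any commutative algebra. -/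
def interactionOf (m : (i : D.Color) → Spin → Matrix (Fin (D.n i)) (Fin (D.n i)) S) : S :=
  ∑ i, ∑ s, Matrix.trace (aeval
    (D.pt s i • (1 : Matrix (Fin (D.n i)) (Fin (D.n i)) S) + m i s) (D.δV s i))

/-- The product of determinants, for matrices over any commutative algebra. -/
def detsOf (m : (i : D.Color) → Spin → Matrix (Fin (D.n i)) (Fin (D.n i)) S) : S :=
  ∏ s : Spin, ∏ i, ∏ j ∈ Finset.univ.filter (· < i),
    Matrix.det ((D.pt s i • (1 : Matrix (Fin (D.n i)) (Fin (D.n i)) S) + m i s) ⊗ₖ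
        (1 : Matrix (Fin (D.n j)) (Fin (D.n j)) S)
      - (1 : Matrix (Fin (D.n i)) (Fin (D.n i)) S) ⊗ₖ
        (D.pt s j • (1 : Matrix (Fin (D.n j)) (Fin (D.n j)) S) + m j s))

theorem map_interactionOf (φ : S →ₐ[ℂ] S')
    (m : (i : D.Color) → Spin → Matrix (Fin (D.n i)) (Fin (D.n i)) S) :
    φ (D.interactionOf m) = D.interactionOf fun i s => (m i s).map φ := by
  simp only [interactionOf, map_sum]
  refine Finset.sum_congr rfl fun i _ => Finset.sum_congr rfl fun s _ => ?_
  have h1 : (D.pt s i • (1 : Matrix (Fin (D.n i)) (Fin (D.n i)) S') + (m i s).map φ) =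
      φ.mapMatrix (D.pt s i • (1 : Matrix (Fin (D.n i)) (Fin (D.n i)) S) + m i s) := by
    rw [map_add, map_smul, map_one]; rfl
  rw [h1, aeval_algHom_apply]
  simp [Matrix.trace]

theorem map_detsOf (φ : S →ₐ[ℂ] S')
    (m : (i : D.Color) → Spin → Matrix (Fin (D.n i)) (Fin (D.n i)) S) :
    φ (D.detsOf m) = D.detsOf fun i s => (m i s).map φ := by
  simp only [detsOf, map_prod]
  refine Finset.prod_congr rfl fun s _ => Finset.prod_congr rfl fun i _ =>
    Finset.prod_congr rfl fun j _ => ?_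
  rw [AlgHom.map_det]
  congr 1
  ext a b
  simp [Matrix.kroneckerMap_apply, Matrix.one_apply, apply_ite φ]

/-- The matrices whose elements are the variables. -/
def genMat (i : D.Color) (s : Spin) :
    Matrix (Fin (D.n i)) (Fin (D.n i)) (MvPolynomial D.Entry ℂ) :=
  Matrix.of fun a b => MvPolynomial.X ⟨i, s, a, b⟩

theorem eval_interactionOf_genMat (A : D.Color → Matrix Spin Spin ℂ) (u : D.Config) :
    MvPolynomial.eval (fun e => D.entryForm A e u) (D.interactionOf D.genMat) =
      D.interaction A u := by
  have h := D.map_interactionOf (MvPolynomial.aeval fun e => D.entryForm A e u) D.genMat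
  have h2 : (fun i s => (D.genMat i s).map (MvPolynomial.aeval fun e => D.entryForm A e u)) =
      fun i s => D.pert A u i s := by
    funext i s
    ext a b
    simp [genMat, entryForm]
  rw [h2] at h
  rw [← MvPolynomial.coe_aeval_eq_eval]
  exact h

theorem eval_detsOf_genMat (A : D.Color → Matrix Spin Spin ℂ) (u : D.Config) :
    MvPolynomial.eval (fun e => D.entryForm A e u) (D.detsOf D.genMat) = D.dets A u := by
  have h := D.map_detsOf (MvPolynomial.aeval fun e => D.entryForm A e u) D.genMat
  have h2 : (fun i s => (D.genMat i s).map (MvPolynomial.aeval fun e => D.entryForm A e u)) =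
      fun i s => D.pert A u i s := by
    funext i s
    ext a b
    simp [genMat, entryForm]
  rw [h2] at h
  rw [← MvPolynomial.coe_aeval_eq_eval]
  exact h

theorem scale_genMat :
    (fun i s => (D.genMat i s).map MvPolynomial.scale) = fun i s =>
      (PowerSeries.X : PowerSeries (MvPolynomial D.Entry ℂ)) •
        (D.genMat i s).map PowerSeries.C := by
  funext i s
  ext1 a b
  simp [genMat, MvPolynomial.scale, mul_comm]

theorem natDegree_V (hV₁ : D.V₁.natDegree = D.d₁ + 1) (hV₂ : D.V₂.natDegree = D.d₂ + 1) (s : Spin) :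
    (D.V s).natDegree = D.d s + 1 := by
  cases s
  · exact hV₂
  · exact hV₁

theorem taylor_coeff_V (s : Spin) (i : D.Color) (k : ℕ) :
    (taylor (D.pt s i) (D.V s)).coeff k =
      (derivative^[k] (D.V s)).eval (D.pt s i) / (k.factorial : ℂ) := by
  rw [taylor_coeff, eq_div_iff (by exact_mod_cast k.factorial_ne_zero), mul_comm,
    ← nsmul_eq_mul, ← eval_smul, ← factorial_smul_hasseDeriv,
    LinearMap.smul_apply]

theorem taylor_δV (hV : ∀ s, (D.V s).natDegree = D.d s + 1) (s : Spin) (i : D.Color) :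
    taylor (D.pt s i) (D.δV s i) =
      ∑ k ∈ Finset.Icc 3 (D.d s + 1), C (D.t s k i / k) * X ^ k := by
  have h1 : taylor (D.pt s i) (D.δV s i) = taylor (D.pt s i) (D.V s)
      - C ((taylor (D.pt s i) (D.V s)).coeff 0) - C ((taylor (D.pt s i) (D.V s)).coeff 1) * X
      - C ((taylor (D.pt s i) (D.V s)).coeff 2) * X ^ 2 := by
    simp only [taylor_coeff_V]
    simp [δV, taylor_apply]
  rw [h1]
  ext k
  have h2 : (∑ k ∈ Finset.Icc 3 (D.d s + 1), C (D.t s k i / k) * X ^ k).coeff k =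
      if k ∈ Finset.Icc 3 (D.d s + 1) then D.t s k i / k else 0 := by
    simp [coeff_X_pow]
  rw [h2]
  rcases k with _ | _ | _ | k
  · simp
  · simp [coeff_C, coeff_X_pow]
  · simp
  · have h3 : (taylor (D.pt s i) (D.V s)
      - C ((taylor (D.pt s i) (D.V s)).coeff 0) - C ((taylor (D.pt s i) (D.V s)).coeff 1) * X
      - C ((taylor (D.pt s i) (D.V s)).coeff 2) * X ^ 2).coeff (k + 1 + 1 + 1) =
        (taylor (D.pt s i) (D.V s)).coeff (k + 1 + 1 + 1) := by
      simp
    rw [h3]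
    split_ifs with h
    · rw [taylor_coeff_V, t, Nat.add_sub_cancel, Nat.factorial_succ (k + 1 + 1), div_div]
      push_cast
      ring
    · rw [Finset.mem_Icc] at h
      apply coeff_eq_zero_of_natDegree_lt
      rw [natDegree_taylor, hV]
      omega

theorem trace_aeval_δV (hV : ∀ s, (D.V s).natDegree = D.d s + 1) (s : Spin) (i : D.Color)
    {m : Type*} [Fintype m] [DecidableEq m] (Y : Matrix m m S) :
    Matrix.trace (aeval (D.pt s i • (1 : Matrix m m S) + Y) (D.δV s i)) =
      ∑ k ∈ Finset.Icc 3 (D.d s + 1), (D.t s k i / k) • Matrix.trace (Y ^ k) := by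
  have h1 : aeval (D.pt s i • (1 : Matrix m m S) + Y) (D.δV s i) =
      aeval Y (taylor (D.pt s i) (D.δV s i)) := by
    rw [taylor_apply, aeval_comp]
    simp [Algebra.algebraMap_eq_smul_one, add_comm]
  rw [h1, D.taylor_δV hV, map_sum, Matrix.trace_sum]
  refine Finset.sum_congr rfl fun k _ => ?_
  rw [map_mul, aeval_C, map_pow, aeval_X, Algebra.algebraMap_eq_smul_one, smul_mul_assoc, one_mul,
    Matrix.trace_smul]

/-- The scaled interaction divided by `z²`. -/
def potentialSeries : PowerSeries (MvPolynomial D.Entry ℂ) :=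
  ∑ i, ∑ s, ∑ k ∈ Finset.Icc 3 (D.d s + 1), (D.t s k i / k) •
    (PowerSeries.X ^ (k - 2) * PowerSeries.C (Matrix.trace (D.genMat i s ^ k)))

theorem trace_X_smul_pow {m : Type*} [Fintype m] [DecidableEq m] (Y : Matrix m m S) (k : ℕ) :
    Matrix.trace (((PowerSeries.X : PowerSeries S) • Y.map PowerSeries.C) ^ k) =
      PowerSeries.X ^ k * PowerSeries.C (Matrix.trace (Y ^ k)) := by
  have h : Y.map PowerSeries.C = (PowerSeries.C : S →+* PowerSeries S).mapMatrix Y := rfl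
  rw [_root_.smul_pow, Matrix.trace_smul, smul_eq_mul, h, ← map_pow]
  congr 1
  simp [Matrix.trace]

theorem scale_interactionOf_genMat (hV : ∀ s, (D.V s).natDegree = D.d s + 1) :
    MvPolynomial.scale (D.interactionOf D.genMat) = PowerSeries.X ^ 2 * D.potentialSeries := by
  rw [map_interactionOf, scale_genMat, interactionOf, potentialSeries, Finset.mul_sum]
  refine Finset.sum_congr rfl fun i _ => ?_
  rw [Finset.mul_sum]
  refine Finset.sum_congr rfl fun s _ => ?_
  rw [D.trace_aeval_δV hV, Finset.mul_sum]
  refine Finset.sum_congr rfl fun k hk => ?_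
  rw [Finset.mem_Icc] at hk
  rw [trace_X_smul_pow, mul_smul_comm, ← mul_assoc, ← pow_add,
    show 2 + (k - 2) = k by omega]

theorem constantCoeff_potentialSeries : PowerSeries.constantCoeff D.potentialSeries = 0 := by
  rw [potentialSeries, map_sum]
  refine Finset.sum_eq_zero fun i _ => ?_
  rw [map_sum]
  refine Finset.sum_eq_zero fun s _ => ?_
  rw [map_sum]
  refine Finset.sum_eq_zero fun k hk => ?_
  rw [Finset.mem_Icc] at hk
  rw [← PowerSeries.coeff_zero_eq_constantCoeff_apply, PowerSeries.coeff_complex_smul,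
    PowerSeries.coeff_zero_eq_constantCoeff_apply, map_mul, map_pow, PowerSeries.constantCoeff_X,
    zero_pow (by omega), zero_mul, smul_zero]

end observables

section terms

variable (hA : ∀ i, D.IsContour i (A i)) (hnondeg : ∀ i, D.t true 2 i * D.t false 2 i ≠ 1)
  (hN : 0 < D.N) (hV : ∀ s, (D.V s).natDegree = D.d s + 1)

include hA hN in
theorem integrable_interaction_mul_dets {T : ℝ} (hT : 0 < T) (l : ℕ) :
    MeasureTheory.Integrable fun u =>
      (D.interaction A u ^ l * D.dets A u) * D.gaussWeight A T u := by
  have h := integrable_eval_mul_gaussWeight hA hN hT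
    (D.interactionOf D.genMat ^ l * D.detsOf D.genMat)
  simpa only [map_mul, map_pow, eval_interactionOf_genMat, eval_detsOf_genMat] using h

include hnondeg hV in
theorem gaussTerm_eq {T : ℝ} (hT : 0 < T) (l : ℕ) :
    D.gaussTerm A l T = ∑ k ∈ Finset.range
        ((D.interactionOf D.genMat ^ l * D.detsOf D.genMat).totalDegree + 1),
      ((-1) ^ l * (D.N : ℂ) ^ l / l.factorial * mean hA hN one_pos (PowerSeries.coeff (2 * k)
        (D.potentialSeries ^ l * MvPolynomial.scale (D.detsOf D.genMat)))) * (T : ℂ) ^ k := by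
  have h1 : (D.gaussMean A T fun u => D.interaction A u ^ l * D.dets A u) =
      mean hA hN hT (D.interactionOf D.genMat ^ l * D.detsOf D.genMat) := by
    rw [mean_apply]
    simp only [map_mul, map_pow, eval_interactionOf_genMat, eval_detsOf_genMat]
  have hT0 : (T : ℂ) ≠ 0 := by exact_mod_cast hT.ne'
  have hl : (l.factorial : ℂ) ≠ 0 := by exact_mod_cast l.factorial_ne_zero
  rw [gaussTerm, h1, mean_eq_of_scale_eq hA hnondeg hN hT _ (l := l)
    (G := D.potentialSeries ^ l * MvPolynomial.scale (D.detsOf D.genMat)), Finset.mul_sum,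
    Finset.mul_sum]
  · refine Finset.sum_congr rfl fun k _ => ?_
    field_simp
  · rw [map_mul, map_pow, D.scale_interactionOf_genMat hV, mul_pow, ← pow_mul, mul_assoc]

include hnondeg hV in
theorem exists_termPoly (l : ℕ) :
    ∃ P : ℂ[X], (∀ T : ℝ, 0 < T → D.gaussTerm A l T = P.eval (T : ℂ)) ∧
      ∀ k, P.coeff k = (-1) ^ l * (D.N : ℂ) ^ l / l.factorial * mean hA hN one_pos
        (PowerSeries.coeff (2 * k)
          (D.potentialSeries ^ l * MvPolynomial.scale (D.detsOf D.genMat))) := by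
  refine ⟨∑ k ∈ Finset.range
        ((D.interactionOf D.genMat ^ l * D.detsOf D.genMat).totalDegree + 1),
      C ((-1) ^ l * (D.N : ℂ) ^ l / l.factorial * mean hA hN one_pos (PowerSeries.coeff (2 * k)
        (D.potentialSeries ^ l * MvPolynomial.scale (D.detsOf D.genMat)))) * X ^ k, ?_, ?_⟩
  · intro T hT
    rw [gaussTerm_eq hA hnondeg hN hV hT, eval_finsetSum]
    simp
  · intro k
    simp only [finsetSum_coeff, coeff_C_mul, coeff_X_pow, mul_ite, mul_one, mul_zero,
      Finset.sum_ite_eq, Finset.mem_range]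
    split_ifs with h
    · rfl
    · have h2 : PowerSeries.coeff (2 * k)
          (D.potentialSeries ^ l * MvPolynomial.scale (D.detsOf D.genMat)) =
          PowerSeries.coeff (2 * k + 2 * l) (MvPolynomial.scale
            (D.interactionOf D.genMat ^ l * D.detsOf D.genMat)) := by
        rw [map_mul MvPolynomial.scale, map_pow, D.scale_interactionOf_genMat hV, mul_pow,
          ← pow_mul, mul_assoc, PowerSeries.coeff_X_pow_mul]
      rw [h2, MvPolynomial.coeff_scale, MvPolynomial.homogeneousComponent_eq_zero _ _ (by omega),
        map_zero, mul_zero]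

include hA hnondeg hN hV in
theorem gaussTerm_eq_eval_termPoly (l : ℕ) {T : ℝ} (hT : 0 < T) :
    D.gaussTerm A l T = (D.termPoly A l).eval (T : ℂ) := by
  obtain ⟨P, hP, -⟩ := exists_termPoly hA hnondeg hN hV l
  have h : ∃ P : ℂ[X], ∀ T : ℝ, 0 < T → D.gaussTerm A l T = P.eval (T : ℂ) := ⟨P, hP⟩
  rw [termPoly, dif_pos h]
  exact h.choose_spec T hT

include hnondeg hV in
theorem coeffA_eq (k l : ℕ) :
    D.coeffA A k l = (-1) ^ l * (D.N : ℂ) ^ l / l.factorial * mean hA hN one_pos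
        (PowerSeries.coeff (2 * k)
          (D.potentialSeries ^ l * MvPolynomial.scale (D.detsOf D.genMat))) := by
  obtain ⟨P, hP, hc⟩ := exists_termPoly hA hnondeg hN hV l
  have heq : D.termPoly A l = P := by
    apply Polynomial.eq_of_infinite_eval_eq
    refine Set.Infinite.mono (s := (fun T : ℝ => (T : ℂ)) '' Set.Ioi 0) ?_ ?_
    · rintro _ ⟨T, hT, rfl⟩
      rw [Set.mem_ofPred_eq, ← hP T hT, gaussTerm_eq_eval_termPoly hA hnondeg hN hV l hT]
    · exact (Set.Ioi_infinite 0).image Complex.ofReal_injective.injOn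
  rw [coeffA, heq, hc]

include hA hnondeg hN hV in
theorem coeffA_eq_zero {k l : ℕ} (h : 2 * k < l) : D.coeffA A k l = 0 := by
  rw [coeffA_eq hA hnondeg hN hV, PowerSeries.coeff_pow_mul_eq_zero
    D.constantCoeff_potentialSeries _ h, map_zero, mul_zero]

include hnondeg hV in
theorem sum_coeffA_eq (k : ℕ) :
    ∑ j ∈ Finset.range (2 * k + 1), D.coeffA A k j = mean hA hN one_pos (PowerSeries.coeff (2 * k)
      (PowerSeries.fexp ((-(D.N : ℂ)) • D.potentialSeries) *
        MvPolynomial.scale (D.detsOf D.genMat))) := by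
  have h0 : PowerSeries.constantCoeff ((-(D.N : ℂ)) • D.potentialSeries) = 0 := by
    rw [← PowerSeries.coeff_zero_eq_constantCoeff_apply, PowerSeries.coeff_complex_smul,
      PowerSeries.coeff_zero_eq_constantCoeff_apply, constantCoeff_potentialSeries, smul_zero]
  rw [PowerSeries.coeff_fexp_mul h0 _ le_rfl, map_sum]
  refine Finset.sum_congr rfl fun l _ => ?_
  rw [coeffA_eq hA hnondeg hN hV, _root_.smul_pow, smul_mul_assoc, PowerSeries.coeff_complex_smul,
    map_smul, map_smul, smul_eq_mul, smul_eq_mul, neg_pow]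
  ring

end terms

end TwoMatrixData

/-! ### The logarithm of the determinants -/

namespace TwoMatrixData

theorem trace_kronecker_sub_pow {S m m' : Type*} [CommRing S] [Fintype m] [DecidableEq m]
    [Fintype m'] [DecidableEq m'] (Y : Matrix m m S) (Y' : Matrix m' m' S) (p : ℕ) :
    Matrix.trace ((Y ⊗ₖ (1 : Matrix m' m' S) - (1 : Matrix m m S) ⊗ₖ Y') ^ p) =
      ∑ q ∈ Finset.HasAntidiagonal.antidiagonal p, ((p.choose q.1 : S) * (-1) ^ q.2) *
        (Matrix.trace (Y ^ q.1) * Matrix.trace (Y' ^ q.2)) := by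
  have hpow1 : ∀ k : ℕ, (Y ⊗ₖ (1 : Matrix m' m' S)) ^ k = (Y ^ k) ⊗ₖ (1 : Matrix m' m' S) := by
    intro k
    induction k with
    | zero => simp
    | succ k ih => rw [pow_succ, pow_succ, ih, ← Matrix.mul_kronecker_mul, mul_one]
  have hpow2 : ∀ k : ℕ, ((1 : Matrix m m S) ⊗ₖ Y') ^ k = (1 : Matrix m m S) ⊗ₖ (Y' ^ k) := by
    intro k
    induction k with
    | zero => simp
    | succ k ih => rw [pow_succ, pow_succ, ih, ← Matrix.mul_kronecker_mul, mul_one]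
  have hcomm : Commute (Y ⊗ₖ (1 : Matrix m' m' S)) (-((1 : Matrix m m S) ⊗ₖ Y')) := by
    refine Commute.neg_right ?_
    change _ * _ = _ * _
    rw [← Matrix.mul_kronecker_mul, ← Matrix.mul_kronecker_mul, mul_one, one_mul, one_mul, mul_one]
  rw [sub_eq_add_neg, hcomm.add_pow', Matrix.trace_sum]
  refine Finset.sum_congr rfl fun q _ => ?_
  rw [Matrix.trace_smul, hpow1, neg_pow, hpow2, ← mul_assoc, nsmul_eq_mul]
  have h1 : (Y ^ q.1) ⊗ₖ (1 : Matrix m' m' S) * (-1) ^ q.2 * ((1 : Matrix m m S) ⊗ₖ (Y' ^ q.2)) =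
      ((-1 : S) ^ q.2) • ((Y ^ q.1) ⊗ₖ (Y' ^ q.2)) := by
    rcases neg_one_pow_eq_or (Matrix (m × m') (m × m') S) q.2 with h | h <;>
    rcases Nat.even_or_odd q.2 with h2 | h2
    · rw [h2.neg_one_pow, h2.neg_one_pow, mul_one, ← Matrix.mul_kronecker_mul, mul_one, one_mul,
        one_smul]
    · rw [h2.neg_one_pow, h2.neg_one_pow, mul_neg, mul_one, neg_mul, ← Matrix.mul_kronecker_mul,
        mul_one, one_mul, neg_smul, one_smul]
    · rw [h2.neg_one_pow, h2.neg_one_pow, mul_one, ← Matrix.mul_kronecker_mul, mul_one, one_mul,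
        one_smul]
    · rw [h2.neg_one_pow, h2.neg_one_pow, mul_neg, mul_one, neg_mul, ← Matrix.mul_kronecker_mul,
        mul_one, one_mul, neg_smul, one_smul]
  rw [h1, Matrix.trace_smul, Matrix.trace_kronecker, smul_eq_mul, mul_assoc]

variable (D : TwoMatrixData)

/-- The coefficients of the expansion of the logarithm of a determinant. -/
def logCoeff (s : Spin) (i j : D.Color) (k l : ℕ) : ℂ :=
  if k + l = 0 then 0 else ((k + l - 1).factorial : ℂ) / (k.factorial * l.factorial) *
    (1 / ((D.pt s j - D.pt s i) ^ k * (D.pt s i - D.pt s j) ^ l))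

theorem logCoeff_symm (s : Spin) (i j : D.Color) (k l : ℕ) :
    D.logCoeff s i j k l = D.logCoeff s j i l k := by
  simp only [logCoeff, add_comm l k, mul_comm ((D.pt s j - D.pt s i) ^ k),
    mul_comm (k.factorial : ℂ)]

/-- Products of two traces of powers of the matrices of variables. -/
def tracePair (s : Spin) (i j : D.Color) (k l : ℕ) : MvPolynomial D.Entry ℂ :=
  Matrix.trace (D.genMat i s ^ k) * Matrix.trace (D.genMat j s ^ l)

theorem tracePair_symm (s : Spin) (i j : D.Color) (k l : ℕ) :
    D.tracePair s i j k l = D.tracePair s j i l k := mul_comm _ _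

/-- The logarithm of a normalized determinant. -/
def pairLog (s : Spin) (i j : D.Color) : PowerSeries (MvPolynomial D.Entry ℂ) :=
  PowerSeries.mk fun p => -∑ q ∈ Finset.HasAntidiagonal.antidiagonal p,
    D.logCoeff s i j q.1 q.2 • D.tracePair s i j q.1 q.2

theorem pairLog_symm (s : Spin) (i j : D.Color) : D.pairLog s i j = D.pairLog s j i := by
  ext1 p
  rw [pairLog, pairLog, PowerSeries.coeff_mk, PowerSeries.coeff_mk,
    ← Finset.Nat.sum_antidiagonal_swap]
  simp only [Prod.fst_swap, Prod.snd_swap]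
  congr 1
  refine Finset.sum_congr rfl fun q _ => ?_
  rw [logCoeff_symm, tracePair_symm]

theorem constantCoeff_pairLog (s : Spin) (i j : D.Color) :
    PowerSeries.constantCoeff (D.pairLog s i j) = 0 := by
  rw [← PowerSeries.coeff_zero_eq_constantCoeff_apply, pairLog, PowerSeries.coeff_mk]
  simp [logCoeff]

theorem det_kronecker_eq {s : Spin} {i j : D.Color} (h : D.pt s i ≠ D.pt s j) :
    Matrix.det ((D.pt s i • (1 : Matrix (Fin (D.n i)) (Fin (D.n i))
          (PowerSeries (MvPolynomial D.Entry ℂ))) +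
          (PowerSeries.X : PowerSeries (MvPolynomial D.Entry ℂ)) •
            (D.genMat i s).map PowerSeries.C) ⊗ₖ
        (1 : Matrix (Fin (D.n j)) (Fin (D.n j)) (PowerSeries (MvPolynomial D.Entry ℂ)))
      - (1 : Matrix (Fin (D.n i)) (Fin (D.n i)) (PowerSeries (MvPolynomial D.Entry ℂ))) ⊗ₖ
        (D.pt s j • (1 : Matrix (Fin (D.n j)) (Fin (D.n j))
          (PowerSeries (MvPolynomial D.Entry ℂ))) +
          (PowerSeries.X : PowerSeries (MvPolynomial D.Entry ℂ)) •
            (D.genMat j s).map PowerSeries.C)) =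
      ((D.pt s i - D.pt s j) ^ (D.n i * D.n j)) • PowerSeries.fexp (D.pairLog s i j) := by
  set c : ℂ := D.pt s i - D.pt s j with hc
  have hc0 : c ≠ 0 := sub_ne_zero.2 h
  set Y : Matrix (Fin (D.n i) × Fin (D.n j)) (Fin (D.n i) × Fin (D.n j)) (MvPolynomial D.Entry ℂ) :=
    D.genMat i s ⊗ₖ 1 - 1 ⊗ₖ D.genMat j s with hY
  have h1 : ((D.pt s i • (1 : Matrix (Fin (D.n i)) (Fin (D.n i))
          (PowerSeries (MvPolynomial D.Entry ℂ))) +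
          (PowerSeries.X : PowerSeries (MvPolynomial D.Entry ℂ)) •
            (D.genMat i s).map PowerSeries.C) ⊗ₖ
        (1 : Matrix (Fin (D.n j)) (Fin (D.n j)) (PowerSeries (MvPolynomial D.Entry ℂ)))
      - (1 : Matrix (Fin (D.n i)) (Fin (D.n i)) (PowerSeries (MvPolynomial D.Entry ℂ))) ⊗ₖ
        (D.pt s j • (1 : Matrix (Fin (D.n j)) (Fin (D.n j))
          (PowerSeries (MvPolynomial D.Entry ℂ))) +
          (PowerSeries.X : PowerSeries (MvPolynomial D.Entry ℂ)) •
            (D.genMat j s).map PowerSeries.C)) =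
      (algebraMap ℂ (PowerSeries (MvPolynomial D.Entry ℂ)) c) •
        (1 + (PowerSeries.X : PowerSeries (MvPolynomial D.Entry ℂ)) •
          ((c⁻¹ • Y).map PowerSeries.C)) := by
    have h2 : (c⁻¹ • Y).map (PowerSeries.C : MvPolynomial D.Entry ℂ →+* _) =
        (algebraMap ℂ (PowerSeries (MvPolynomial D.Entry ℂ)) c⁻¹) • Y.map PowerSeries.C := by
      ext1 a b
      rw [Matrix.map_apply, Matrix.smul_apply, Matrix.smul_apply, Algebra.smul_def, map_mul,
        PowerSeries.algebraMap_apply, smul_eq_mul, Matrix.map_apply]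
    have h3 : Y.map (PowerSeries.C : MvPolynomial D.Entry ℂ →+* _) =
        (D.genMat i s).map PowerSeries.C ⊗ₖ 1 - 1 ⊗ₖ (D.genMat j s).map PowerSeries.C := by
      ext1 a b
      simp only [hY, Matrix.map_apply, Matrix.sub_apply, Matrix.kroneckerMap_apply, map_sub,
        map_mul, Matrix.one_apply, apply_ite (PowerSeries.C : MvPolynomial D.Entry ℂ →+* _),
        map_one, map_zero]
    rw [h2, h3, smul_add, smul_smul, smul_smul, mul_right_comm, ← map_mul, mul_inv_cancel₀ hc0,
      map_one, one_mul, hc, map_sub, sub_smul, Matrix.add_kronecker, Matrix.kronecker_add,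
      Matrix.smul_kronecker, Matrix.kronecker_smul, Matrix.smul_kronecker, Matrix.kronecker_smul,
      Matrix.one_kronecker_one, smul_sub]
    simp only [algebraMap_smul]
    abel
  rw [h1, Matrix.det_smul, PowerSeries.det_one_add_X_smul_eq_fexp, Fintype.card_prod,
    Fintype.card_fin, Fintype.card_fin, ← map_pow, ← Algebra.smul_def]
  congr 2
  ext1 p
  rw [PowerSeries.coeff_mk, pairLog, PowerSeries.coeff_mk, _root_.smul_pow, Matrix.trace_smul, hY,
    trace_kronecker_sub_pow, Finset.smul_sum, Finset.smul_sum, ← Finset.sum_neg_distrib]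
  refine Finset.sum_congr rfl fun q hq => ?_
  rw [Finset.HasAntidiagonal.mem_antidiagonal] at hq
  have h4 : ((p.choose q.1 : MvPolynomial D.Entry ℂ) * (-1) ^ q.2) =
      algebraMap ℂ (MvPolynomial D.Entry ℂ) ((p.choose q.1 : ℂ) * (-1) ^ q.2) := by simp
  rw [h4, ← Algebra.smul_def, smul_smul, smul_smul, ← neg_smul, tracePair]
  congr 1
  rw [logCoeff, hq]
  split_ifs with hp
  · simp [hp]
  · have h5 : D.pt s j - D.pt s i = -c := by rw [hc]; ring
    have hchoose : (p.choose q.1 : ℂ) = p.factorial / (q.1.factorial * q.2.factorial) := by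
      rw [← hq, Nat.cast_add_choose]
    obtain ⟨p', rfl⟩ : ∃ p', p = p' + 1 := ⟨p - 1, by omega⟩
    rw [h5, ← hc, hchoose, Nat.add_sub_cancel, Nat.factorial_succ, neg_pow c, ← hq, pow_add, pow_add,
      inv_pow, inv_pow]
    have h6 : ((p' : ℂ) + 1) ≠ 0 := by exact_mod_cast Nat.succ_ne_zero p'
    have h7 : (q.1.factorial : ℂ) ≠ 0 := by exact_mod_cast q.1.factorial_ne_zero
    have h8 : (q.2.factorial : ℂ) ≠ 0 := by exact_mod_cast q.2.factorial_ne_zero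
    rw [hq]
    push_cast
    have h9 : ((-1 : ℂ) ^ q.1) * (-1) ^ q.1 = 1 := by rw [← mul_pow]; simp
    have h10 : ((-1 : ℂ) ^ q.2) * (-1) ^ q.2 = 1 := by rw [← mul_pow]; simp
    have h11 : ((-1 : ℂ) ^ q.1) ≠ 0 := by intro h; rw [h] at h9; simp at h9
    field_simp
    linear_combination (-p'.factorial : ℂ) * (((-1 : ℂ) ^ q.1) ^ 2 * h10 + h9)

theorem scale_detsOf_genMat (h : ∀ s, Function.Injective (D.pt s)) :
    MvPolynomial.scale (D.detsOf D.genMat) =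
      (∏ s : Spin, ∏ i, ∏ j ∈ Finset.univ.filter (· < i),
        (D.pt s i - D.pt s j) ^ (D.n i * D.n j)) •
      PowerSeries.fexp (∑ s : Spin, ∑ i, ∑ j ∈ Finset.univ.filter (· < i), D.pairLog s i j) := by
  have h0 : ∀ s i, PowerSeries.constantCoeff
      (∑ j ∈ Finset.univ.filter (· < i), D.pairLog s i j) = 0 := by
    intro s i
    rw [map_sum]
    exact Finset.sum_eq_zero fun j _ => D.constantCoeff_pairLog s i j
  rw [PowerSeries.fexp_sum, map_detsOf, scale_genMat, detsOf, Algebra.smul_def, map_prod,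
    ← Finset.prod_mul_distrib]
  · refine Finset.prod_congr rfl fun s _ => ?_
    rw [PowerSeries.fexp_sum _ _ fun i _ => h0 s i, map_prod, ← Finset.prod_mul_distrib]
    refine Finset.prod_congr rfl fun i _ => ?_
    rw [PowerSeries.fexp_sum _ _ fun j _ => D.constantCoeff_pairLog s i j, map_prod,
      ← Finset.prod_mul_distrib]
    refine Finset.prod_congr rfl fun j hj => ?_
    rw [Finset.mem_filter] at hj
    rw [← Algebra.smul_def]
    exact D.det_kronecker_eq fun h1 => hj.2.ne' (h s h1)
  · intro s _
    rw [map_sum]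
    exact Finset.sum_eq_zero fun i _ => h0 s i

theorem sum_lt_symm {M ι : Type*} [AddCommMonoid M] [Module ℂ M] [Fintype ι] [LinearOrder ι]
    (f : ι → ι → M) (hf : ∀ i j, f i j = f j i) :
    ∑ i, ∑ j ∈ Finset.univ.filter (· < i), f i j =
      (2⁻¹ : ℂ) • ∑ i, ∑ j ∈ Finset.univ.erase i, f i j := by
  have h1 : ∑ i, ∑ j ∈ Finset.univ.filter (i < ·), f i j =
      ∑ i, ∑ j ∈ Finset.univ.filter (· < i), f i j := by
    simp only [Finset.sum_filter]
    rw [Finset.sum_comm]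
    refine Finset.sum_congr rfl fun i _ => Finset.sum_congr rfl fun j _ => ?_
    rw [hf]
  have h2 : ∀ i, ∑ j ∈ Finset.univ.erase i, f i j =
      ∑ j ∈ Finset.univ.filter (· < i), f i j + ∑ j ∈ Finset.univ.filter (i < ·), f i j := by
    intro i
    rw [← Finset.sum_union]
    · refine Finset.sum_congr ?_ fun _ _ => rfl
      ext j
      simp [lt_or_lt_iff_ne]
    · rw [Finset.disjoint_filter]
      intro j _ h3 h4
      exact lt_asymm h3 h4
  simp only [h2, Finset.sum_add_distrib]
  rw [h1, ← two_smul ℂ, smul_smul]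
  norm_num

end TwoMatrixData

/-! ### The exponent as a sum over types of vertices -/

namespace TwoMatrixData

variable (D : TwoMatrixData)

/-- The spins, valences and colours of vertices of valence at most `K`; the valence of a type `τ`
is `τ.2.1 + 1`. -/
abbrev VertexType (K : ℕ) : Type := Spin × Fin K × D.Color

/-- The weight of a free vertex as a series in `z = √T`, with the symmetry factor of a trace. -/
def vertexSeries (s : Spin) (k : ℕ) (i : D.Color) : PowerSeries ℂ :=
  (-(D.N : ℂ) / k) • (PowerSeries.X ^ (k - if D.inPotential s k then 2 else 0) *
    PowerSeries.expand 2 two_ne_zero (D.vertexWeight s k i))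

/-- The weight of a linked pair as a series in `z = √T`, with the symmetry factors of traces. -/
def pairSeries (τ τ' : Spin × ℕ × D.Color) : PowerSeries ℂ :=
  if τ.1 = τ'.1 ∧ τ.2.2 ≠ τ'.2.2 then
    PowerSeries.C (-(D.hh τ.1 τ.2.1 τ.2.2 τ'.2.1 τ'.2.2) / (τ.2.1 * τ'.2.1)) *
      PowerSeries.X ^ (τ.2.1 + τ'.2.1)
  else 0

theorem hh_symm (s : Spin) (k : ℕ) (i : D.Color) (l : ℕ) (j : D.Color) :
    D.hh s k i l j = D.hh s l j k i := by
  simp only [hh, add_comm l k, mul_comm ((D.pt s j - D.pt s i) ^ k),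
    mul_comm ((k - 1).factorial : ℂ)]

theorem pairSeries_symm (τ τ' : Spin × ℕ × D.Color) : D.pairSeries τ τ' = D.pairSeries τ' τ := by
  obtain ⟨s, k, i⟩ := τ
  obtain ⟨s', l, j⟩ := τ'
  simp only [pairSeries]
  by_cases h : s = s' ∧ i ≠ j
  · obtain ⟨rfl, h⟩ := h
    rw [if_pos ⟨rfl, h⟩, if_pos ⟨rfl, h.symm⟩, D.hh_symm, add_comm k l, mul_comm (k : ℂ)]
  · rw [if_neg h, if_neg fun h' => h ⟨h'.1.symm, h'.2.symm⟩]

variable {D} in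
/-- The spin, valence and colour of a type. -/
abbrev VertexType.data {K : ℕ} (τ : D.VertexType K) : Spin × ℕ × D.Color := (τ.1, τ.2.1 + 1, τ.2.2)

/-- The trace of the power of a matrix of variables attached to a vertex. -/
def vertexTrace (τ : Spin × ℕ × D.Color) : MvPolynomial D.Entry ℂ :=
  Matrix.trace (D.genMat τ.2.2 τ.1 ^ τ.2.1)

/-- Constants as power series with polynomial coefficients. -/
abbrev constSeries : PowerSeries ℂ →+* PowerSeries (MvPolynomial D.Entry ℂ) :=
  PowerSeries.map MvPolynomial.C

/-- The contribution of a free vertex to the exponent. -/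
def freeTerm {K : ℕ} (τ : D.VertexType K) : PowerSeries (MvPolynomial D.Entry ℂ) :=
  D.constSeries (D.vertexSeries τ.data.1 τ.data.2.1 τ.data.2.2) *
    PowerSeries.C (D.vertexTrace τ.data)

/-- The contribution of a linked pair to the exponent. -/
def linkTerm {K : ℕ} : Sym2 (D.VertexType K) → PowerSeries (MvPolynomial D.Entry ℂ) :=
  Sym2.lift ⟨fun τ τ' => D.constSeries (D.pairSeries τ.data τ'.data) *
    PowerSeries.C (D.vertexTrace τ.data * D.vertexTrace τ'.data),
    fun τ τ' => by
      dsimp only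
      rw [pairSeries_symm, mul_comm (D.vertexTrace _)]⟩

theorem linkTerm_mk {K : ℕ} (τ τ' : D.VertexType K) :
    D.linkTerm s(τ, τ') = D.constSeries (D.pairSeries τ.data τ'.data) *
      PowerSeries.C (D.vertexTrace τ.data * D.vertexTrace τ'.data) := rfl

theorem vertexSeries_eq (s : Spin) (k : ℕ) (i : D.Color) :
    D.vertexSeries s k i = (if D.inPotential s k then
      (-(D.N : ℂ)) • (D.t s k i / k) • (PowerSeries.X ^ (k - 2) : PowerSeries ℂ) else 0) +
      (-(D.N : ℂ) * D.h s k i / k) • (PowerSeries.X ^ k : PowerSeries ℂ) := by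
  rw [vertexSeries, vertexWeight]
  split_ifs with h
  · rw [map_add, map_mul, PowerSeries.expand_C, PowerSeries.expand_C, PowerSeries.expand_X, mul_add,
      ← mul_assoc, ← pow_add, show k - 2 + 2 = k by omega, smul_add]
    congr 1
    · rw [mul_comm, ← PowerSeries.smul_eq_C_mul, smul_smul, smul_smul]
      congr 1
      ring
    · rw [mul_comm, ← PowerSeries.smul_eq_C_mul, smul_smul]
      congr 1
      ring
  · rw [PowerSeries.expand_C, zero_add, Nat.sub_zero, mul_comm, ← PowerSeries.smul_eq_C_mul,
      smul_smul]
    congr 1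
    ring

theorem constSeries_smul (c : ℂ) (f : PowerSeries ℂ) :
    D.constSeries (c • f) = c • D.constSeries f := by
  rw [PowerSeries.smul_eq_C_mul, map_mul, PowerSeries.map_C, Algebra.smul_def,
    PowerSeries.algebraMap_apply, MvPolynomial.algebraMap_eq]

theorem constSeries_X_pow (k : ℕ) : D.constSeries (PowerSeries.X ^ k) = PowerSeries.X ^ k := by
  rw [map_pow, PowerSeries.map_X]

theorem constantCoeff_freeTerm {K : ℕ} (τ : D.VertexType K) :
    PowerSeries.constantCoeff (D.freeTerm τ) = 0 := by
  have h : PowerSeries.constantCoeff (D.vertexSeries τ.data.1 τ.data.2.1 τ.data.2.2) = 0 := by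
    rw [vertexSeries, PowerSeries.smul_eq_C_mul, map_mul, map_mul, map_pow,
      PowerSeries.constantCoeff_X, zero_pow, zero_mul, mul_zero]
    split_ifs with h
    · have := h.1; omega
    · simp
  rw [freeTerm, map_mul, constSeries,
    ← PowerSeries.coeff_zero_eq_constantCoeff_apply (PowerSeries.map _ _), PowerSeries.coeff_map,
    PowerSeries.coeff_zero_eq_constantCoeff_apply, h, map_zero, zero_mul]

theorem constantCoeff_linkTerm {K : ℕ} (e : Sym2 (D.VertexType K)) :
    PowerSeries.constantCoeff (D.linkTerm e) = 0 := by
  induction e with | _ τ τ'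
  have h : PowerSeries.constantCoeff (D.pairSeries τ.data τ'.data) = 0 := by
    rw [pairSeries]
    split_ifs
    · simp
    · simp
  rw [linkTerm_mk, map_mul, constSeries,
    ← PowerSeries.coeff_zero_eq_constantCoeff_apply (PowerSeries.map _ _), PowerSeries.coeff_map,
    PowerSeries.coeff_zero_eq_constantCoeff_apply, h, map_zero, zero_mul]

theorem sum_potential_freeTerm {K : ℕ} (hK : ∀ s, D.d s + 1 ≤ K) :
    ∑ τ : D.VertexType K, (D.constSeries (if D.inPotential τ.data.1 τ.data.2.1 then
      (-(D.N : ℂ)) • (D.t τ.data.1 τ.data.2.1 τ.data.2.2 / τ.data.2.1) •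
        (PowerSeries.X ^ (τ.data.2.1 - 2) : PowerSeries ℂ) else 0) *
      PowerSeries.C (D.vertexTrace τ.data)) = (-(D.N : ℂ)) • D.potentialSeries := by
  rw [potentialSeries, Finset.smul_sum, Fintype.sum_prod_type]
  simp only [Fintype.sum_prod_type, VertexType.data]
  have h1 : ∀ s : Spin, ∀ i : D.Color, ∑ κ : Fin K, (D.constSeries (if D.inPotential s (κ + 1) then
      (-(D.N : ℂ)) • (D.t s (κ + 1) i / ((κ + 1 : ℕ) : ℂ)) •
        (PowerSeries.X ^ ((κ : ℕ) + 1 - 2) : PowerSeries ℂ) else 0) *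
      PowerSeries.C (D.vertexTrace (s, κ + 1, i))) = (-(D.N : ℂ)) •
        ∑ k ∈ Finset.Icc 3 (D.d s + 1), (D.t s k i / k) •
    (PowerSeries.X ^ (k - 2) * PowerSeries.C (Matrix.trace (D.genMat i s ^ k))) := by
    intro s i
    have h2 : Finset.Icc 3 (D.d s + 1) =
        ((Finset.range K).map (addRightEmbedding 1)).filter fun k => D.inPotential s k := by
      ext k
      simp only [Finset.mem_Icc, Finset.mem_filter, Finset.mem_map, Finset.mem_range,
        addRightEmbedding_apply, inPotential]
      constructor
      · intro h
        exact ⟨⟨k - 1, by have := hK s; omega, by omega⟩, h⟩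
      · exact fun h => h.2
    rw [h2, Finset.sum_filter, Finset.sum_map, Finset.smul_sum,
      ← Fin.sum_univ_eq_sum_range (fun κ => (-(D.N : ℂ)) • if D.inPotential s
        ((addRightEmbedding 1) κ) then (D.t s ((addRightEmbedding 1) κ) i /
          (((addRightEmbedding 1) κ : ℕ) : ℂ)) • ((PowerSeries.X :
            PowerSeries (MvPolynomial D.Entry ℂ)) ^ ((addRightEmbedding 1) κ - 2) *
          PowerSeries.C (Matrix.trace (D.genMat i s ^ ((addRightEmbedding 1) κ)))) else 0)]
    refine Finset.sum_congr rfl fun κ _ => ?_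
    simp only [addRightEmbedding_apply]
    split_ifs with h
    · rw [constSeries_smul, constSeries_smul, constSeries_X_pow, smul_mul_assoc, smul_mul_assoc]
      rfl
    · simp
  rw [Finset.sum_congr rfl fun s _ => Finset.sum_comm]
  simp only [h1]
  rw [Finset.sum_comm]
  simp only [Finset.smul_sum]

theorem N_mul_ε (hN : 0 < D.N) (j : D.Color) : (D.N : ℂ) * D.ε j = D.n j := by
  have : (D.N : ℂ) ≠ 0 := by exact_mod_cast hN.ne'
  rw [ε]; field_simp

theorem logCoeff_zero_right (s : Spin) (i j : D.Color) {k : ℕ} (hk : 0 < k) :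
    D.logCoeff s i j k 0 = 1 / (k * (D.pt s j - D.pt s i) ^ k) := by
  obtain ⟨k, rfl⟩ : ∃ k', k = k' + 1 := ⟨k - 1, by omega⟩
  rw [logCoeff, if_neg (by omega), Nat.add_zero, Nat.add_sub_cancel, Nat.factorial_succ]
  have h1 : (k.factorial : ℂ) ≠ 0 := by exact_mod_cast k.factorial_ne_zero
  have h2 : (k : ℂ) + 1 ≠ 0 := by exact_mod_cast Nat.succ_ne_zero k
  push_cast
  simp only [Nat.factorial_zero, Nat.cast_one, pow_zero, mul_one]
  rw [div_mul_div_comm, mul_one, mul_comm ((k : ℂ) + 1), mul_assoc, div_mul_eq_div_div,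
    div_self h1]

theorem logCoeff_succ_succ (s : Spin) (i j : D.Color) (k l : ℕ) :
    D.logCoeff s i j (k + 1) (l + 1) =
      D.hh s (k + 1) i (l + 1) j / (((k + 1 : ℕ) : ℂ) * ((l + 1 : ℕ) : ℂ)) := by
  rw [logCoeff, if_neg (by omega), hh, Nat.factorial_succ k, Nat.factorial_succ l,
    Nat.add_sub_cancel, Nat.add_sub_cancel]
  have h1 : (k.factorial : ℂ) ≠ 0 := by exact_mod_cast k.factorial_ne_zero
  have h2 : (l.factorial : ℂ) ≠ 0 := by exact_mod_cast l.factorial_ne_zero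
  have h3 : (k : ℂ) + 1 ≠ 0 := by exact_mod_cast Nat.succ_ne_zero k
  have h4 : (l : ℂ) + 1 ≠ 0 := by exact_mod_cast Nat.succ_ne_zero l
  push_cast
  generalize (1 / ((D.pt s j - D.pt s i) ^ (k + 1) * (D.pt s i - D.pt s j) ^ (l + 1))) = w
  field_simp

/-- The contributions of the determinants to the exponent. -/
def logTerm (s : Spin) (i j : D.Color) (k l : ℕ) : MvPolynomial D.Entry ℂ :=
  D.logCoeff s i j k l • D.tracePair s i j k l

theorem coeff_sum_h_freeTerm (hN : 0 < D.N) {K p : ℕ} (hp : p ≤ K) :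
    PowerSeries.coeff p (∑ τ : D.VertexType K, (D.constSeries
      ((-(D.N : ℂ) * D.h τ.data.1 τ.data.2.1 τ.data.2.2 / τ.data.2.1) •
        (PowerSeries.X ^ τ.data.2.1 : PowerSeries ℂ)) * PowerSeries.C (D.vertexTrace τ.data))) =
      -∑ s, ∑ i, ∑ j ∈ Finset.univ.erase i, D.logTerm s i j p 0 := by
  rw [map_sum, Fintype.sum_prod_type, ← Finset.sum_neg_distrib]
  refine Finset.sum_congr rfl fun s _ => ?_
  rw [Fintype.sum_prod_type, Finset.sum_comm, ← Finset.sum_neg_distrib]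
  refine Finset.sum_congr rfl fun i _ => ?_
  simp only [VertexType.data, constSeries_smul, constSeries_X_pow, smul_mul_assoc,
    PowerSeries.coeff_complex_smul, mul_comm (PowerSeries.X ^ _), PowerSeries.coeff_C_mul,
    PowerSeries.coeff_X_pow]
  rcases Nat.eq_zero_or_pos p with rfl | hp0
  · rw [Finset.sum_eq_zero, Finset.sum_eq_zero, neg_zero]
    · intro j _; simp [logTerm, logCoeff]
    · intro κ _; simp
  · rw [Finset.sum_eq_single (⟨p - 1, by omega⟩ : Fin K)]
    · have h1 : p - 1 + 1 = p := by omega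
      simp only [h1, if_true, mul_one]
      rw [← Finset.sum_neg_distrib]
      simp only [logTerm, D.logCoeff_zero_right s i _ hp0, tracePair, pow_zero, Matrix.trace_one,
        Fintype.card_fin]
      have h2 : (-(D.N : ℂ) * D.h s p i / p) = ∑ j ∈ Finset.univ.erase i,
          -((D.n j : ℂ) * (1 / (p * (D.pt s j - D.pt s i) ^ p))) := by
        rw [h, Finset.mul_sum, Finset.sum_div]
        refine Finset.sum_congr rfl fun j _ => ?_
        rw [← D.N_mul_ε hN]
        simp only [div_eq_mul_inv, mul_inv]
        ring
      rw [h2, Finset.sum_smul]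
      refine Finset.sum_congr rfl fun j _ => ?_
      rw [neg_smul, mul_comm (D.n j : ℂ), mul_smul, vertexTrace]
      congr 2
      rw [mul_comm, Algebra.smul_def, map_natCast]
    · intro κ _ hκ
      rw [if_neg, mul_zero, smul_zero]
      intro h1
      apply hκ
      ext
      simp only
      omega
    · simp

theorem coeff_sum_linkTerm {K p : ℕ} (hp : p ≤ K) :
    PowerSeries.coeff p (∑ τ : D.VertexType K, ∑ τ' : D.VertexType K, D.linkTerm s(τ, τ')) =
      -∑ s, ∑ i, ∑ j ∈ Finset.univ.erase i,
        ∑ q ∈ (Finset.HasAntidiagonal.antidiagonal p).filter (fun q => q.1 ≠ 0 ∧ q.2 ≠ 0),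
          D.logTerm s i j q.1 q.2 := by
  have h0 : ∀ τ τ' : D.VertexType K, PowerSeries.coeff p (D.linkTerm s(τ, τ')) =
      if τ.1 = τ'.1 then (if τ.2.2 ≠ τ'.2.2 then
        (if (τ.2.1 : ℕ) + 1 + (τ'.2.1 + 1) = p then
          -D.logTerm τ.1 τ.2.2 τ'.2.2 (τ.2.1 + 1) (τ'.2.1 + 1) else 0) else 0) else 0 := by
    rintro ⟨s, κ, i⟩ ⟨s', l, j⟩
    rw [linkTerm_mk]
    simp only [VertexType.data, pairSeries]
    by_cases h1 : s = s'
    · subst h1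
      by_cases h2 : i = j
      · simp [h2]
      · rw [if_pos (show s = s ∧ i ≠ j from ⟨rfl, h2⟩), if_pos rfl, if_pos h2,
          map_mul D.constSeries, PowerSeries.map_C, constSeries_X_pow,
          mul_assoc, PowerSeries.coeff_C_mul, mul_comm (PowerSeries.X ^ _), PowerSeries.coeff_C_mul,
          PowerSeries.coeff_X_pow]
        split_ifs with h3 h4 h4
        · rw [logTerm, logCoeff_succ_succ, mul_one, ← neg_smul, ← neg_div,
            MvPolynomial.smul_eq_C_mul]
          rfl
        · omega
        · omega
        · simp
    · rw [if_neg (show ¬(s = s' ∧ i ≠ j) from fun h => h1 h.1), if_neg h1]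
      simp
  simp only [map_sum, h0]
  rw [Fintype.sum_prod_type, ← Finset.sum_neg_distrib]
  refine Finset.sum_congr rfl fun s _ => ?_
  rw [Fintype.sum_prod_type, Finset.sum_comm, ← Finset.sum_neg_distrib]
  refine Finset.sum_congr rfl fun i _ => ?_
  have h1 : ∀ κ : Fin K, (∑ τ' : D.VertexType K, if s = τ'.1 then (if i ≠ τ'.2.2 then
        (if (κ : ℕ) + 1 + (τ'.2.1 + 1) = p then
          -D.logTerm s i τ'.2.2 (κ + 1) (τ'.2.1 + 1) else 0) else 0) else 0) =
      ∑ j ∈ Finset.univ.erase i, ∑ l : Fin K, if (κ : ℕ) + 1 + (l + 1) = p then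
          -D.logTerm s i j (κ + 1) (l + 1) else 0 := by
    intro κ
    rw [Fintype.sum_prod_type, Finset.sum_eq_single s]
    · rw [Fintype.sum_prod_type, Finset.sum_comm]
      have h2 : Finset.univ.erase i = Finset.univ.filter fun j => i ≠ j := by
        ext j; simp [eq_comm]
      rw [h2, Finset.sum_filter]
      refine Finset.sum_congr rfl fun j _ => ?_
      by_cases h3 : i = j <;> simp [h3]
    · intro s' _ hs'
      simp [hs'.symm]
    · simp
  simp only [h1]
  rw [Finset.sum_comm, ← Finset.sum_neg_distrib]
  refine Finset.sum_congr rfl fun j _ => ?_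
  rw [← Finset.sum_neg_distrib, ← Fintype.sum_prod_type', ← Finset.sum_filter]
  refine Finset.sum_bij' (fun q _ => ((q.1 : ℕ) + 1, (q.2 : ℕ) + 1))
    (fun q hq => (⟨q.1 - 1, ?_⟩, ⟨q.2 - 1, ?_⟩)) ?_ ?_ ?_ ?_ ?_
  · simp only [Finset.mem_filter, Finset.HasAntidiagonal.mem_antidiagonal] at hq; omega
  · simp only [Finset.mem_filter, Finset.HasAntidiagonal.mem_antidiagonal] at hq; omega
  · intro q hq
    simp only [Finset.mem_filter, Finset.HasAntidiagonal.mem_antidiagonal, Finset.mem_univ,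
      true_and] at hq ⊢
    omega
  · intro q hq
    simp only [Finset.mem_filter, Finset.HasAntidiagonal.mem_antidiagonal, Finset.mem_univ,
      true_and] at hq ⊢
    omega
  · intro q hq
    simp
  · intro q hq
    simp only [Finset.mem_filter, Finset.HasAntidiagonal.mem_antidiagonal] at hq
    ext <;> simp only <;> omega
  · intro q hq
    rfl

theorem sum_antidiagonal_logTerm (s : Spin) (p : ℕ) :
    ∑ i, ∑ j ∈ Finset.univ.erase i, ∑ q ∈ Finset.HasAntidiagonal.antidiagonal p,
      D.logTerm s i j q.1 q.2 =
    (2 : ℂ) • ∑ i, ∑ j ∈ Finset.univ.erase i, D.logTerm s i j p 0 +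
      ∑ i, ∑ j ∈ Finset.univ.erase i,
        ∑ q ∈ (Finset.HasAntidiagonal.antidiagonal p).filter (fun q => q.1 ≠ 0 ∧ q.2 ≠ 0),
          D.logTerm s i j q.1 q.2 := by
  have hswap : ∑ i, ∑ j ∈ Finset.univ.erase i, D.logTerm s i j 0 p =
      ∑ i, ∑ j ∈ Finset.univ.erase i, D.logTerm s i j p 0 := by
    have h2 : ∀ i : D.Color, Finset.univ.erase i = Finset.univ.filter fun j => i ≠ j := by
      intro i; ext j; simp [eq_comm]
    simp only [h2, Finset.sum_filter]
    rw [Finset.sum_comm]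
    refine Finset.sum_congr rfl fun i _ => Finset.sum_congr rfl fun j _ => ?_
    rw [logTerm, logCoeff_symm, tracePair_symm, ← logTerm]
    simp only [ne_comm]
  rw [two_smul]
  nth_rewrite 1 [← hswap]
  rw [← Finset.sum_add_distrib, ← Finset.sum_add_distrib]
  refine Finset.sum_congr rfl fun i _ => ?_
  rw [← Finset.sum_add_distrib, ← Finset.sum_add_distrib]
  refine Finset.sum_congr rfl fun j _ => ?_
  rcases Nat.eq_zero_or_pos p with rfl | hp
  · simp [Finset.sum_filter, logTerm, logCoeff]
  · have h3 : Finset.HasAntidiagonal.antidiagonal p = insert (0, p) (insert (p, 0)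
        ((Finset.HasAntidiagonal.antidiagonal p).filter (fun q => q.1 ≠ 0 ∧ q.2 ≠ 0))) := by
      ext ⟨a, b⟩
      simp only [Finset.mem_insert, Finset.mem_filter, Finset.HasAntidiagonal.mem_antidiagonal,
        Prod.mk.injEq]
      omega
    conv_lhs => rw [h3]
    rw [Finset.sum_insert, Finset.sum_insert, ← add_assoc]
    · simp
    · simp only [Finset.mem_insert, Finset.mem_filter, Prod.mk.injEq]
      omega

/-- The truncated sum over types of vertices agrees with the exponent in low degrees. -/
theorem coeff_exponent (hN : 0 < D.N) {K p : ℕ} (hK : ∀ s, D.d s + 1 ≤ K) (hp : p ≤ K) :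
    PowerSeries.coeff p (∑ τ : D.VertexType K, D.freeTerm τ +
        (2⁻¹ : ℂ) • ∑ τ : D.VertexType K, ∑ τ', D.linkTerm s(τ, τ')) =
      PowerSeries.coeff p ((-(D.N : ℂ)) • D.potentialSeries +
        ∑ s : Spin, ∑ i, ∑ j ∈ Finset.univ.filter (· < i), D.pairLog s i j) := by
  have h1 : ∑ τ : D.VertexType K, D.freeTerm τ = (-(D.N : ℂ)) • D.potentialSeries +
      ∑ τ : D.VertexType K, (D.constSeries
      ((-(D.N : ℂ) * D.h τ.data.1 τ.data.2.1 τ.data.2.2 / τ.data.2.1) •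
        (PowerSeries.X ^ τ.data.2.1 : PowerSeries ℂ)) * PowerSeries.C (D.vertexTrace τ.data)) := by
    rw [← D.sum_potential_freeTerm hK, ← Finset.sum_add_distrib]
    refine Finset.sum_congr rfl fun τ _ => ?_
    rw [freeTerm, vertexSeries_eq, map_add, add_mul]
  rw [h1, add_assoc, map_add, map_add (PowerSeries.coeff p) ((-(D.N : ℂ)) • D.potentialSeries)]
  congr 1
  rw [map_add, D.coeff_sum_h_freeTerm hN hp, PowerSeries.coeff_complex_smul,
    D.coeff_sum_linkTerm hp, map_sum]
  have h2 : ∀ s : Spin, PowerSeries.coeff p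
      (∑ i, ∑ j ∈ Finset.univ.filter (· < i), D.pairLog s i j) =
      -((2⁻¹ : ℂ) • ∑ i, ∑ j ∈ Finset.univ.erase i, ∑ q ∈ Finset.HasAntidiagonal.antidiagonal p,
        D.logTerm s i j q.1 q.2) := by
    intro s
    rw [sum_lt_symm _ (D.pairLog_symm s), PowerSeries.coeff_complex_smul, ← smul_neg]
    congr 1
    simp only [map_sum, pairLog, PowerSeries.coeff_mk, Finset.sum_neg_distrib, logTerm]
  simp only [h2, sum_antidiagonal_logTerm, smul_add, smul_smul, Finset.sum_neg_distrib,
    Finset.sum_add_distrib]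
  rw [inv_mul_cancel₀ two_ne_zero]
  simp only [one_smul, neg_add, smul_neg, Finset.smul_sum]

end TwoMatrixData

/-! ### Rotation systems -/

/-- `next` is the cyclic order of the legs around the vertices, `vertOf` being the vertex of a
leg. -/
def IsRotation {α β : Type*} (vertOf : α → β) (next : Equiv.Perm α) : Prop :=
  Function.Surjective vertOf ∧ ∀ a b, next.SameCycle a b ↔ vertOf a = vertOf b

namespace Rotation

open Equiv Finset

variable {α β : Type*} [Fintype α] [DecidableEq α] [Fintype β] [DecidableEq β]
  {vertOf : α → β} {next : Perm α}

/-- The number of legs at a vertex. -/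
def valence (vertOf : α → β) (v : β) : ℕ := (univ.filter fun a => vertOf a = v).card

theorem _root_.IsRotation.valence_pos (h : IsRotation vertOf next) (v : β) :
    0 < valence vertOf v := by
  obtain ⟨a, ha⟩ := h.1 v
  exact card_pos.2 ⟨a, by simp [ha]⟩

theorem sum_valence (vertOf : α → β) : ∑ v, valence vertOf v = Fintype.card α := by
  rw [← card_univ, card_eq_sum_card_fiberwise (f := vertOf) (t := univ) (by simp)]
  rfl

theorem _root_.IsRotation.vertOf_next (h : IsRotation vertOf next) (a : α) :
    vertOf (next a) = vertOf a := by
  rw [← h.2]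
  exact (Perm.sameCycle_apply_left).2 (Perm.SameCycle.refl _ _)

theorem _root_.IsRotation.vertOf_pow (h : IsRotation vertOf next) (n : ℕ) (a : α) :
    vertOf ((next ^ n) a) = vertOf a := by
  rw [← h.2]
  exact (Perm.sameCycle_pow_left).2 (Perm.SameCycle.refl _ _)

theorem _root_.IsRotation.isCycleOn (h : IsRotation vertOf next) (v : β) :
    next.IsCycleOn ((univ.filter fun a => vertOf a = v : Finset α) : Set α) := by
  refine ⟨⟨?_, next.injective.injOn, ?_⟩, ?_⟩
  · intro a ha
    simpa [h.vertOf_next] using ha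
  · intro a ha
    refine ⟨next.symm a, ?_, by simp⟩
    have := h.vertOf_next (next.symm a)
    rw [apply_symm_apply] at this
    simpa [← this] using ha
  · intro a ha b hb
    rw [h.2]
    simp only [coe_filter, mem_univ, true_and, Set.mem_ofPred_eq] at ha hb
    rw [ha, hb]

variable {κ : β → ℕ}

/-- The cyclic order of the legs of the standard vertices with `κ v + 1` legs. -/
def shift (κ : β → ℕ) : Perm (Σ v, Fin (κ v + 1)) := sigmaCongrRight fun v => finRotate (κ v + 1)

theorem shift_apply (v : β) (r : Fin (κ v + 1)) : shift κ ⟨v, r⟩ = ⟨v, r + 1⟩ := by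
  simp [shift]

/-- The numberings of the legs around the vertices compatible with the cyclic order. -/
def IsLabelling (vertOf : α → β) (next : Perm α) (e : (Σ v, Fin (κ v + 1)) ≃ α) : Prop :=
  ∀ x, vertOf (e x) = x.1 ∧ next (e x) = e (shift κ x)

theorem IsLabelling.apply_eq {e : (Σ v, Fin (κ v + 1)) ≃ α} (he : IsLabelling vertOf next e)
    (v : β) (r : Fin (κ v + 1)) : e ⟨v, r⟩ = (next ^ (r : ℕ)) (e ⟨v, 0⟩) := by
  have h : ∀ n (hn : n < κ v + 1), e ⟨v, ⟨n, hn⟩⟩ = (next ^ n) (e ⟨v, 0⟩) := by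
    intro n
    induction n with
    | zero => intro _; rfl
    | succ n ih =>
      intro hn
      rw [pow_succ', Perm.mul_apply, ← ih (by omega), (he _).2, shift_apply]
      congr 2
      ext
      rw [Fin.val_add_one_of_lt (by simp [Fin.lt_def]; omega)]
  exact h r r.2

theorem IsLabelling.isRotation {e : (Σ v, Fin (κ v + 1)) ≃ α} (he : IsLabelling vertOf next e) :
    IsRotation vertOf next := by
  refine ⟨fun v => ⟨e ⟨v, 0⟩, (he _).1⟩, fun a b => ⟨fun h => ?_, fun h => ?_⟩⟩
  · obtain ⟨n, rfl⟩ := h.exists_nat_pow_eq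
    have h1 : ∀ a, vertOf (next a) = vertOf a := by
      intro a
      obtain ⟨x, rfl⟩ := e.surjective a
      rw [(he x).2, (he _).1, (he _).1]
      rfl
    induction n with
    | zero => rfl
    | succ n ih => rw [pow_succ', Perm.mul_apply, h1]; exact ih ⟨n, by simp⟩
  · obtain ⟨⟨v, r⟩, rfl⟩ := e.surjective a
    obtain ⟨⟨w, r'⟩, rfl⟩ := e.surjective b
    rw [(he _).1, (he _).1] at h
    obtain rfl : v = w := h
    rw [he.apply_eq, he.apply_eq v r', Perm.sameCycle_pow_left, Perm.sameCycle_pow_right]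

theorem IsLabelling.valence_eq {e : (Σ v, Fin (κ v + 1)) ≃ α} (he : IsLabelling vertOf next e)
    (v : β) : valence vertOf v = κ v + 1 := by
  have : (univ.filter fun a => vertOf a = v) =
      (univ : Finset (Fin (κ v + 1))).image fun r => e ⟨v, r⟩ := by
    ext a
    obtain ⟨⟨w, r⟩, rfl⟩ := e.surjective a
    simp only [mem_filter, mem_univ, true_and, (he _).1, mem_image, EmbeddingLike.apply_eq_iff_eq]
    constructor
    · rintro rfl; exact ⟨r, rfl⟩
    · rintro ⟨r', h⟩; exact (congrArg Sigma.fst h).symm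
  rw [valence, this, card_image_of_injective _ fun r r' h => by simpa using h]
  simp

/-- Labellings correspond to the choices of a first leg at each vertex. -/
theorem _root_.IsRotation.card_labellings (h : IsRotation vertOf next)
    (hκ : ∀ v, valence vertOf v = κ v + 1) :
    Nat.card {e : (Σ v, Fin (κ v + 1)) ≃ α // IsLabelling vertOf next e} = ∏ v, (κ v + 1) := by
  let F : {e : (Σ v, Fin (κ v + 1)) ≃ α // IsLabelling vertOf next e} →
      ∀ v, {a // vertOf a = v} := fun e v => ⟨e.1 ⟨v, 0⟩, (e.2 _).1⟩
  have hF : Function.Bijective F := by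
    constructor
    · intro e e' he
      ext ⟨v, r⟩
      rw [e.2.apply_eq, e'.2.apply_eq]
      congr 1
      exact congrArg Subtype.val (congrFun he v)
    · intro ρ
      let f : (Σ v, Fin (κ v + 1)) → α := fun x => (next ^ (x.2 : ℕ)) (ρ x.1)
      have hf1 : ∀ x, vertOf (f x) = x.1 := fun x => by
        rw [h.vertOf_pow, (ρ x.1).2]
      have hf : Function.Bijective f := by
        rw [Fintype.bijective_iff_injective_and_card]
        constructor
        · rintro ⟨v, r⟩ ⟨w, r'⟩ hrr
          obtain rfl : v = w := by simpa [hf1] using congrArg vertOf hrr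
          have h2 := ((h.isCycleOn v).pow_apply_eq_pow_apply (a := (ρ v : α))
            (by simp [(ρ v).2])).1 hrr
          rw [show ((univ.filter fun a => vertOf a = v : Finset α)).card = κ v + 1 from hκ v] at h2
          have h3 : (r : ℕ) = r' := Nat.ModEq.eq_of_lt_of_lt h2 r.2 r'.2
          rw [Fin.ext h3]
        · rw [Fintype.card_sigma, ← sum_valence vertOf]
          simp [hκ]
      refine ⟨⟨Equiv.ofBijective f hf, ?_⟩, ?_⟩
      · rintro ⟨v, r⟩
        refine ⟨hf1 _, ?_⟩
        rw [shift_apply, ofBijective_apply, ofBijective_apply]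
        simp only [f]
        rw [← Perm.mul_apply, ← pow_succ']
        rw [(h.isCycleOn v).pow_apply_eq_pow_apply (by simp [(ρ v).2]),
          show ((univ.filter fun a => vertOf a = v : Finset α)).card = κ v + 1 from hκ v,
          Fin.val_add]
        have h1 : ((1 : Fin (κ v + 1)) : ℕ) ≡ 1 [MOD κ v + 1] := by
          rw [Fin.val_one']
          exact Nat.mod_modEq _ _
        exact ((Nat.mod_modEq _ _).trans (Nat.ModEq.add_left _ h1)).symm
      · funext v
        ext
        simp [F, f]
  rw [Nat.card_congr (Equiv.ofBijective F hF), Nat.card_pi]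
  refine prod_congr rfl fun v _ => ?_
  rw [← hκ, Nat.card_eq_fintype_card, Fintype.card_subtype]
  rfl

open Classical in
/-- The number of rotation systems with given valences. -/
theorem card_rotations_mul (κ : β → ℕ) (hα : Fintype.card α = ∑ v, (κ v + 1)) :
    ((univ : Finset ((α → β) × Perm α)).filter fun p => IsRotation p.1 p.2 ∧
      ∀ v, valence p.1 v = κ v + 1).card * ∏ v, (κ v + 1) = (Fintype.card α).factorial := by
  have h := sum_card_bipartiteAbove_eq_sum_card_bipartiteBelow
    (s := (univ : Finset ((α → β) × Perm α)))
    (t := (univ : Finset ((Σ v, Fin (κ v + 1)) ≃ α))) (fun p e => IsLabelling p.1 p.2 e)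
  have h1 : ∀ p : (α → β) × Perm α, (bipartiteAbove (fun p e => IsLabelling p.1 p.2 e)
      (univ : Finset ((Σ v, Fin (κ v + 1)) ≃ α)) p).card =
      if IsRotation p.1 p.2 ∧ ∀ v, valence p.1 v = κ v + 1 then ∏ v, (κ v + 1) else 0 := by
    intro p
    split_ifs with hp
    · rw [← hp.1.card_labellings hp.2, Nat.card_eq_fintype_card, Fintype.card_subtype]
      rfl
    · rw [card_eq_zero, bipartiteAbove, filter_eq_empty_iff]
      exact fun e _ he => hp ⟨he.isRotation, he.valence_eq⟩
  have h2 : ∀ e : (Σ v, Fin (κ v + 1)) ≃ α, (bipartiteBelow (fun p e => IsLabelling p.1 p.2 e)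
      (univ : Finset ((α → β) × Perm α)) e).card = 1 := by
    intro e
    rw [card_eq_one]
    refine ⟨(fun a => (e.symm a).1, (e.symm.trans (shift κ)).trans e), ?_⟩
    ext ⟨vo, nx⟩
    simp only [bipartiteBelow, mem_filter, mem_univ, true_and, mem_singleton, Prod.mk.injEq]
    constructor
    · intro he
      constructor
      · funext a
        rw [← (he (e.symm a)).1, apply_symm_apply]
      · ext a
        have := (he (e.symm a)).2
        rw [apply_symm_apply] at this
        simp [this]
    · rintro ⟨rfl, rfl⟩ x
      simp
  simp only [h1, h2] at h
  rw [← sum_filter, sum_const, sum_const, smul_eq_mul, smul_eq_mul, mul_one, card_univ] at h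
  rw [h]
  obtain ⟨e⟩ : Nonempty ((Σ v, Fin (κ v + 1)) ≃ α) := by
    rw [← Fintype.card_eq, hα]
    simp
  rw [Fintype.card_equiv e, Fintype.card_congr e]

end Rotation

/-! ### Traces of powers as sums over closed paths -/

namespace Matrix

open Finset

variable {I R : Type*} [Fintype I] [DecidableEq I] [CommRing R]

theorem pow_succ_apply_eq_sum (A : Matrix I I R) (n : ℕ) (x y : I) :
    (A ^ (n + 1)) x y = ∑ b : Fin n → I, ∏ r : Fin (n + 1),
      A (Fin.cons (α := fun _ => I) x b r) (Fin.snoc (α := fun _ => I) b y r) := by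
  induction n generalizing x with
  | zero => simp [Fin.snoc]
  | succ n ih =>
    rw [pow_succ', Matrix.mul_apply]
    simp only [ih, mul_sum]
    rw [← (Fin.consEquiv fun _ => I).sum_comp, Fintype.sum_prod_type]
    refine sum_congr rfl fun z _ => sum_congr rfl fun b _ => ?_
    rw [Fin.prod_univ_succ (n := n + 1)]
    congr 1
    refine prod_congr rfl fun r _ => ?_
    simp only [Fin.consEquiv, Equiv.coe_fn_mk, Fin.cons_succ]
    rw [← Fin.cons_snoc_eq_snoc_cons, Fin.cons_succ]

theorem trace_pow_succ_eq_sum (A : Matrix I I R) (n : ℕ) :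
    trace (A ^ (n + 1)) = ∑ a : Fin (n + 1) → I, ∏ r, A (a r) (a (r + 1)) := by
  rw [← (Fin.consEquiv fun _ => I).sum_comp, Fintype.sum_prod_type, trace]
  refine sum_congr rfl fun x _ => ?_
  rw [diag_apply, pow_succ_apply_eq_sum]
  refine sum_congr rfl fun b _ => prod_congr rfl fun r _ => ?_
  congr 1
  refine Fin.lastCases ?_ (fun r => ?_) r
  · simp [Fin.consEquiv]
  · simp [Fin.consEquiv]

/-- A product of traces of powers of matrices as a sum over assignments of indices to the borders
of the legs of a rotation system. -/
theorem prod_trace_pow_eq_sum {α β : Type*} [Fintype α] [DecidableEq α] [Fintype β]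
    [DecidableEq β] {vertOf : α → β} {next : Equiv.Perm α} (h : IsRotation vertOf next)
    (A : β → Matrix I I R) :
    ∏ v, trace (A v ^ Rotation.valence vertOf v) =
      ∑ a : α → I, ∏ d, A (vertOf d) (a d) (a (next d)) := by
  classical
  let κ : β → ℕ := fun v => Rotation.valence vertOf v - 1
  have hκ : ∀ v, Rotation.valence vertOf v = κ v + 1 := fun v => by
    have := h.valence_pos v
    simp only [κ]; omega
  have hne : Nat.card {e : (Σ v, Fin (κ v + 1)) ≃ α // Rotation.IsLabelling vertOf next e} ≠ 0 := by
    rw [h.card_labellings hκ]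
    exact prod_ne_zero_iff.2 fun v _ => Nat.succ_ne_zero _
  obtain ⟨⟨e, he⟩⟩ := (Nat.card_ne_zero.1 hne).1
  simp only [hκ, trace_pow_succ_eq_sum]
  rw [prod_univ_sum, Fintype.piFinset_univ,
    ← (Equiv.piCurry (fun (v : β) (_ : Fin (κ v + 1)) => I)).sum_comp,
    ← (e.arrowCongr (Equiv.refl I)).sum_comp]
  refine sum_congr rfl fun a _ => ?_
  rw [← e.prod_comp, Fintype.prod_sigma]
  refine prod_congr rfl fun v _ => prod_congr rfl fun r _ => ?_
  rw [(he _).1, (he _).2, Rotation.shift_apply]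
  simp [Equiv.arrowCongr, Sigma.curry]

end Matrix

/-! ### Mean values of products of traces -/

namespace Rotation

open Equiv Finset

variable {α ι : Type*} [Fintype α] [DecidableEq α] [Fintype ι] [DecidableEq ι]

/-- The number of cycles of colour `i` of a permutation. -/
def numCycles (π : Perm α) (col : α → ι) (i : ι) : ℕ :=
  ((Quotient.mk (Perm.SameCycle.setoid π)) '' {a | col a = i}).ncard

/-- The number of functions which are constant on the cycles of a permutation, with `n i` possible
values on the cycles of colour `i`. -/
theorem card_cycle_functions (n : ι → ℕ) (π : Perm α) (col : α → ι) (h : ∀ d, col (π d) = col d) :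
    Nat.card {a : α → Σ i, Fin (n i) // ∀ d, (a d).1 = col d ∧ a d = a (π d)} =
      ∏ i, n i ^ numCycles π col i := by
  classical
  have hcol : ∀ d d', π.SameCycle d d' → col d = col d' := by
    intro d d' hd
    obtain ⟨m, rfl⟩ := hd.exists_nat_pow_eq
    clear hd
    induction m with
    | zero => rfl
    | succ m ih => rw [pow_succ', Perm.mul_apply, h, ih]
  let Q := Quotient (Perm.SameCycle.setoid π)
  let colQ : Q → ι := Quotient.lift col hcol
  let F : {b : Q → Σ i, Fin (n i) // ∀ q, (b q).1 = colQ q} →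
      {a : α → Σ i, Fin (n i) // ∀ d, (a d).1 = col d ∧ a d = a (π d)} := fun b =>
    ⟨fun d => b.1 (Quotient.mk _ d), fun d => ⟨b.2 _, congrArg b.1
      (Quotient.sound (s := Perm.SameCycle.setoid π) (show π.SameCycle d (π d) from
        Perm.sameCycle_apply_right.2 (Perm.SameCycle.refl _ _)))⟩⟩
  have hF : Function.Bijective F := by
    constructor
    · intro b b' hb
      apply Subtype.ext
      funext q
      induction q using Quotient.inductionOn with | _ d
      exact congrFun (congrArg Subtype.val hb) d
    · intro a
      have ha : ∀ d d', π.SameCycle d d' → a.1 d = a.1 d' := by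
        intro d d' hd
        obtain ⟨m, rfl⟩ := hd.exists_nat_pow_eq
        clear hd
        induction m with
        | zero => rfl
        | succ m ih => rw [pow_succ', Perm.mul_apply, ← (a.2 _).2, ih]
      refine ⟨⟨Quotient.lift a.1 ha, fun q => ?_⟩, rfl⟩
      induction q using Quotient.inductionOn with | _ d
      exact (a.2 d).1
  rw [← Nat.card_congr (Equiv.ofBijective F hF),
    Nat.card_congr (Equiv.subtypePiEquivPi (p := fun (q : Q) (x : Σ i, Fin (n i)) => x.1 = colQ q)),
    Nat.card_pi]
  have h1 : ∀ q : Q, Nat.card {x : Σ i, Fin (n i) // x.1 = colQ q} = n (colQ q) := by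
    intro q
    rw [Nat.card_congr (Equiv.sigmaSubtype (β := fun i => Fin (n i)) (colQ q)), Nat.card_fin]
  simp only [h1]
  rw [← prod_fiberwise_of_maps_to (s := univ) (t := univ) (g := colQ) (fun _ _ => mem_univ _)]
  refine prod_congr rfl fun i _ => ?_
  rw [prod_congr rfl (g := fun _ => n i) (fun q hq => by rw [(mem_filter.1 hq).2]), prod_const]
  congr 1
  rw [numCycles, ← Set.ncard_coe_finset]
  congr 1
  ext q
  induction q using Quotient.inductionOn with | _ d
  simp only [coe_filter, mem_univ, true_and, Set.mem_ofPred_eq, Set.mem_image]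
  constructor
  · intro hd; exact ⟨d, hd, rfl⟩
  · rintro ⟨d', hd', he⟩
    rw [← he]
    exact hd'

end Rotation

namespace TwoMatrixData

open Finset

variable {D : TwoMatrixData} {A : D.Color → Matrix Spin Spin ℂ}

variable (D) in
/-- The indices of the block matrices. -/
abbrev Idx : Type := (i : D.Color) × Fin (D.n i)

variable (D) in
/-- The matrix of variables as a block of a matrix of size `N`. -/
def blockMat (i : D.Color) (s : Spin) : Matrix D.Idx D.Idx (MvPolynomial D.Entry ℂ) :=
  Matrix.blockDiagonal' fun j => if j = i then D.genMat j s else 0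

theorem trace_blockMat_pow (i : D.Color) (s : Spin) {k : ℕ} (hk : 0 < k) :
    Matrix.trace (D.blockMat i s ^ k) = D.vertexTrace (s, k, i) := by
  rw [blockMat, ← Matrix.blockDiagonal'_pow, Matrix.trace_blockDiagonal', sum_eq_single i]
  · simp [vertexTrace]
  · intro j _ hj
    simp [hj, zero_pow hk.ne']
  · simp

theorem blockMat_same (i : D.Color) (s : Spin) (a b : Fin (D.n i)) :
    D.blockMat i s ⟨i, a⟩ ⟨i, b⟩ = MvPolynomial.X ⟨i, s, a, b⟩ := by
  rw [blockMat, Matrix.blockDiagonal'_apply_eq, if_pos rfl]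
  rfl

theorem blockMat_eq_zero (i : D.Color) (s : Spin) (x y : D.Idx) (h : ¬(x.1 = i ∧ y.1 = i)) :
    D.blockMat i s x y = 0 := by
  obtain ⟨j, a⟩ := x
  obtain ⟨j', b⟩ := y
  by_cases hj : j = j'
  · subst hj
    rw [blockMat, Matrix.blockDiagonal'_apply_eq, if_neg fun h' => h ⟨h', h'⟩]
    rfl
  · rw [blockMat, Matrix.blockDiagonal'_apply_ne _ _ _ hj]

theorem cov_eq (i i' : D.Color) (s s' : Spin) (a b : Fin (D.n i)) (a' b' : Fin (D.n i')) :
    D.cov ⟨i, s, a, b⟩ ⟨i', s', a', b'⟩ =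
      if i = i' ∧ (⟨i, a⟩ : D.Idx) = ⟨i', b'⟩ ∧ (⟨i', a'⟩ : D.Idx) = ⟨i, b⟩ then
        D.propagator i s s' / D.N else 0 := by
  by_cases h : i = i'
  · subst h
    rw [cov_mk_same]
    refine if_congr ?_ rfl rfl
    simp only [Sigma.mk.injEq, heq_eq_eq, true_and]
    constructor <;> rintro ⟨rfl, rfl⟩ <;> exact ⟨rfl, rfl⟩
  · rw [cov_of_ne h, if_neg fun h' => h h'.1]

variable {α : Type*} [Fintype α] [DecidableEq α]

/-- The weight of an edge between two legs of given spins and colours. -/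
def edgeWeight (c : α → Spin × D.Color) : Sym2 α → ℂ :=
  Sym2.lift ⟨fun d d' => if (c d).2 = (c d').2 then
    D.propagator (c d).2 (c d).1 (c d').1 / D.N else 0, fun d d' => by
      dsimp only
      by_cases h : (c d).2 = (c d').2
      · rw [if_pos h, if_pos h.symm, h, D.propagator_symm]
      · rw [if_neg h, if_neg fun h' => h h'.symm]⟩

theorem edgeWeight_mk (c : α → Spin × D.Color) (d d' : α) : edgeWeight c s(d, d') =
    if (c d).2 = (c d').2 then D.propagator (c d).2 (c d).1 (c d').1 / D.N else 0 := rfl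

/-- The condition that the indices at the ends of an edge match. -/
def edgeMatch (c : α → Spin × D.Color) (x y : α → D.Idx) : Sym2 α → Prop :=
  Sym2.lift ⟨fun d d' => (x d).1 = (c d).2 ∧ (x d').1 = (c d').2 ∧ x d = y d' ∧ x d' = y d,
    fun d d' => by
      dsimp only
      exact propext ⟨fun h => ⟨h.2.1, h.1, h.2.2.2, h.2.2.1⟩,
        fun h => ⟨h.2.1, h.1, h.2.2.2, h.2.2.1⟩⟩⟩

theorem edgeMatch_mk (c : α → Spin × D.Color) (x y : α → D.Idx) (d d' : α) :
    edgeMatch c x y s(d, d') ↔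
      (x d).1 = (c d).2 ∧ (x d').1 = (c d').2 ∧ x d = y d' ∧ x d' = y d := Iff.rfl

open Classical in
theorem mean_prod_blockMat (hA : ∀ i, D.IsContour i (A i))
    (hnondeg : ∀ i, D.t true 2 i * D.t false 2 i ≠ 1) (hN : 0 < D.N)
    (c : α → Spin × D.Color) (x y : α → D.Idx) :
    mean hA hN one_pos (∏ d, D.blockMat (c d).2 (c d).1 (x d) (y d)) =
      ∑ σ ∈ Involution.pairings α, ∏ e ∈ Involution.pairs σ,
        if edgeMatch c x y e then edgeWeight c e else 0 := by
  by_cases h : ∀ d, (x d).1 = (c d).2 ∧ (y d).1 = (c d).2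
  · obtain ⟨a, ha⟩ : ∃ a : ∀ d, Fin (D.n (c d).2), ∀ d, x d = ⟨(c d).2, a d⟩ :=
      ⟨fun d => (h d).1 ▸ (x d).2, fun d => Sigma.ext (h d).1 (by simp)⟩
    obtain ⟨b, hb⟩ : ∃ b : ∀ d, Fin (D.n (c d).2), ∀ d, y d = ⟨(c d).2, b d⟩ :=
      ⟨fun d => (h d).2 ▸ (y d).2, fun d => Sigma.ext (h d).2 (by simp)⟩
    simp only [ha, hb, blockMat_same]
    rw [mean_prod_X hA hnondeg hN one_pos, Complex.ofReal_one, one_pow, one_mul]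
    refine sum_congr rfl fun σ hσ => prod_congr rfl fun e he => ?_
    induction e with | _ d d'
    rw [Sym2.map_mk, covSym, Sym2.lift_mk]
    simp only
    rw [cov_eq, edgeWeight_mk]
    simp only [edgeMatch_mk, ha, hb, true_and]
    split_ifs <;> tauto
  · push Not at h
    obtain ⟨d, hd⟩ := h
    rw [prod_eq_zero (mem_univ d) (blockMat_eq_zero _ _ _ _ fun h => hd h.1 h.2), map_zero,
      sum_eq_zero]
    intro σ hσ
    rw [Involution.mem_pairings] at hσ
    refine prod_eq_zero (i := s(d, σ d))
      ((Involution.mem_pairs hσ.1).2 ⟨rfl, (hσ.2 d).symm⟩) ?_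
    rw [edgeWeight_mk, edgeMatch_mk]
    split_ifs with h1 h2
    · refine absurd ?_ (hd h1.1)
      rw [← h1.2.2.2, h1.2.1, h2]
    · rfl
    · rfl

/-- The mean value of a product of traces is the sum over the gluings of the legs of the products of
the weights of the edges and of the sizes of the matrices, for each loop. -/
theorem mean_prod_vertexTrace (hA : ∀ i, D.IsContour i (A i))
    (hnondeg : ∀ i, D.t true 2 i * D.t false 2 i ≠ 1) (hN : 0 < D.N)
    {β : Type*} [Fintype β] [DecidableEq β] {vertOf : α → β} {next : Equiv.Perm α}
    (h : IsRotation vertOf next) (c : β → Spin × D.Color) :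
    mean hA hN one_pos
        (∏ v, D.vertexTrace ((c v).1, Rotation.valence vertOf v, (c v).2)) =
      ∑ σ ∈ Involution.pairings α, (∏ e ∈ Involution.pairs σ, edgeWeight (c ∘ vertOf) e) *
        ∏ i, (D.n i : ℂ) ^ Rotation.numCycles (next * σ) (fun d => (c (vertOf d)).2) i := by
  classical
  have h1 : ∏ v, D.vertexTrace ((c v).1, Rotation.valence vertOf v, (c v).2) =
      ∑ a : α → D.Idx, ∏ d, D.blockMat (c (vertOf d)).2 (c (vertOf d)).1 (a d) (a (next d)) := by
    rw [← Matrix.prod_trace_pow_eq_sum h fun v => D.blockMat (c v).2 (c v).1]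
    exact prod_congr rfl fun v _ => (trace_blockMat_pow _ _ (h.valence_pos v)).symm
  rw [h1, map_sum]
  have h2 := fun a : α → D.Idx =>
    mean_prod_blockMat hA hnondeg hN (c ∘ vertOf) a (fun d => a (next d))
  simp only [Function.comp_apply] at h2
  simp only [h2]
  rw [sum_comm]
  refine sum_congr rfl fun σ hσ => ?_
  have hσ' := Involution.mem_pairings.1 hσ
  by_cases hcol : ∀ d, (c (vertOf (σ d))).2 = (c (vertOf d)).2
  · have h3 : ∀ a : α → D.Idx, (∏ e ∈ Involution.pairs σ,
        if edgeMatch (fun d => c (vertOf d)) a (fun d => a (next d)) e then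
          edgeWeight (fun d => c (vertOf d)) e else 0) =
        if ∀ d, (a d).1 = (c (vertOf d)).2 ∧ a d = a ((next * σ) d) then
          ∏ e ∈ Involution.pairs σ, edgeWeight (fun d => c (vertOf d)) e else 0 := by
      intro a
      split_ifs with ha
      · refine prod_congr rfl fun e he => ?_
        induction e with | _ d d'
        obtain ⟨rfl, -⟩ := (Involution.mem_pairs hσ'.1).1 he
        rw [if_pos]
        rw [edgeMatch_mk]
        refine ⟨(ha d).1, (ha _).1, (ha d).2, ?_⟩
        rw [(ha (σ d)).2, Equiv.Perm.mul_apply, hσ'.1]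
      · push Not at ha
        obtain ⟨d, hd⟩ := ha
        refine prod_eq_zero (i := s(d, σ d))
          ((Involution.mem_pairs hσ'.1).2 ⟨rfl, (hσ'.2 d).symm⟩) ?_
        rw [if_neg]
        rw [edgeMatch_mk]
        exact fun h' => hd h'.1 h'.2.2.1
    have h4 := Rotation.card_cycle_functions D.n (next * σ) (fun d => (c (vertOf d)).2) (fun d => by
      rw [Equiv.Perm.mul_apply, h.vertOf_next, hcol])
    have h5 : (fun d => c (vertOf d)) = c ∘ vertOf := rfl
    rw [h5] at h3
    rw [sum_congr rfl fun a _ => h3 a, ← sum_filter, sum_const, nsmul_eq_mul, mul_comm]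
    congr 1
    rw [Nat.card_eq_fintype_card, Fintype.card_subtype] at h4
    rw [h4]
    push_cast
    rfl
  · push Not at hcol
    obtain ⟨d, hd⟩ := hcol
    have h6 : edgeWeight (c ∘ vertOf) s(d, σ d) = 0 := by
      rw [edgeWeight_mk, if_neg]
      exact fun h' => hd h'.symm
    have h7 : s(d, σ d) ∈ Involution.pairs σ :=
      (Involution.mem_pairs hσ'.1).2 ⟨rfl, (hσ'.2 d).symm⟩
    rw [prod_eq_zero h7 h6, zero_mul, sum_eq_zero]
    intro a _
    refine prod_eq_zero h7 ?_
    split_ifs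
    · exact h6
    · rfl

end TwoMatrixData

namespace Involution

open Equiv Finset

variable {α M : Type*} [Fintype α] [DecidableEq α] [CommMonoid M]

/-- A product over all elements as a product over the fixed points and the pairs of an
involution. -/
@[to_additive]
theorem prod_fixed_mul_prod_pairs {σ : Perm α} (hσ : ∀ v, σ (σ v) = v) (f : α → M) (y : Sym2 α → M)
    (hy : ∀ a b, y s(a, b) = f a * f b) :
    (∏ v ∈ univ.filter (fun v => σ v = v), f v) * ∏ e ∈ pairs σ, y e = ∏ v, f v := by
  rw [← prod_filter_mul_prod_filter_not univ (fun v => σ v = v)]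
  congr 1
  rw [← prod_fiberwise_of_maps_to (s := univ.filter fun v => ¬σ v = v) (t := pairs σ)
    (g := fun v => s(v, σ v))]
  · refine prod_congr rfl fun e he => ?_
    induction e with | _ a b
    obtain ⟨rfl, hne⟩ := (mem_pairs hσ).1 he
    have h : ((univ.filter fun v => ¬σ v = v).filter fun v => s(v, σ v) = s(a, σ a)) =
        {a, σ a} := by
      ext v
      simp only [mem_filter, mem_univ, true_and, Sym2.eq_iff, mem_insert, mem_singleton]
      constructor
      · rintro ⟨-, h | h⟩
        · exact Or.inl h.1
        · exact Or.inr h.1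
      · rintro (rfl | rfl)
        · exact ⟨fun h => hne h.symm, Or.inl ⟨rfl, rfl⟩⟩
        · rw [hσ]
          exact ⟨hne, Or.inr ⟨rfl, rfl⟩⟩
    rw [h, prod_pair hne, hy]
  · intro v hv
    rw [mem_filter] at hv
    rw [mem_pairs hσ]
    exact ⟨rfl, fun h => hv.2 h.symm⟩

end Involution

namespace TwoMatrixData

open Finset

variable {D : TwoMatrixData} {A : D.Color → Matrix Spin Spin ℂ}

variable (D) in
/-- `pairSeries` as a function of an unordered pair. -/
def pairSym : Sym2 (Spin × ℕ × D.Color) → PowerSeries ℂ := Sym2.lift ⟨D.pairSeries, D.pairSeries_symm⟩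

variable {β : Type*} [Fintype β] [DecidableEq β]

/-- The product of the weights of the free vertices and of the linked pairs. -/
def scalarSeries (τ : β → Spin × ℕ × D.Color) (σ : Equiv.Perm β) : PowerSeries ℂ :=
  (∏ v ∈ univ.filter (fun v => σ v = v), D.vertexSeries (τ v).1 (τ v).2.1 (τ v).2.2) *
    ∏ e ∈ Involution.pairs σ, D.pairSym (e.map τ)

theorem prod_freeTerm_mul_prod_linkTerm {K : ℕ} (p : β → D.VertexType K) {σ : Equiv.Perm β}
    (hσ : ∀ v, σ (σ v) = v) :
    (∏ v ∈ univ.filter (fun v => σ v = v), D.freeTerm (p v)) *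
        ∏ e ∈ Involution.pairs σ, D.linkTerm (e.map p) =
      D.constSeries (scalarSeries (fun v => (p v).data) σ) *
        PowerSeries.C (∏ v, D.vertexTrace (p v).data) := by
  let y : Sym2 β → MvPolynomial D.Entry ℂ := Sym2.lift
    ⟨fun v w => D.vertexTrace (p v).data * D.vertexTrace (p w).data, fun v w => mul_comm _ _⟩
  rw [← Involution.prod_fixed_mul_prod_pairs hσ (fun v => D.vertexTrace (p v).data) y
    fun _ _ => rfl, scalarSeries, map_mul, map_mul, map_prod, map_prod, map_prod, map_prod,
    mul_mul_mul_comm, ← prod_mul_distrib, ← prod_mul_distrib]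
  congr 1
  refine prod_congr rfl fun e _ => ?_
  induction e with | _ v w
  rfl

theorem mean_coeff_loopHafnian (hA : ∀ i, D.IsContour i (A i)) (hN : 0 < D.N) (n : ℕ) {K : ℕ}
    (p : β → D.VertexType K) :
    mean hA hN one_pos (PowerSeries.coeff n
      (Involution.loopHafnian (D.freeTerm ∘ p) (D.linkTerm ∘ Sym2.map p) univ)) =
    (∑ σ ∈ Involution.involutionsOn univ,
      PowerSeries.coeff n (scalarSeries (fun v => (p v).data) σ)) *
        mean hA hN one_pos (∏ v, D.vertexTrace (p v).data) := by
  rw [Involution.loopHafnian, map_sum, map_sum, sum_mul]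
  refine sum_congr rfl fun σ hσ => ?_
  have h := prod_freeTerm_mul_prod_linkTerm p (Involution.mem_involutionsOn.1 hσ).1
  simp only [Function.comp_apply]
  rw [h, mul_comm, PowerSeries.coeff_C_mul, PowerSeries.coeff_map, mul_comm,
    ← MvPolynomial.smul_eq_C_mul, map_smul, smul_eq_mul]

/-- The contribution of the edges and loops of a graph. -/
def edgeLoopWeight {α : Type*} [Fintype α] [DecidableEq α] (c : β → Spin × D.Color)
    (vertOf : α → β) (next glue : Equiv.Perm α) : ℂ :=
  (∏ e ∈ Involution.pairs glue, edgeWeight (c ∘ vertOf) e) *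
    ∏ i, (D.n i : ℂ) ^ Rotation.numCycles (next * glue) (fun d => (c (vertOf d)).2) i

open Classical in
theorem mean_prod_vertexTrace_eq_sum (hA : ∀ i, D.IsContour i (A i))
    (hnondeg : ∀ i, D.t true 2 i * D.t false 2 i ≠ 1) (hN : 0 < D.N) (c : β → Spin × D.Color)
    (κ : β → ℕ) {B : ℕ} (hB : ∑ v, (κ v + 1) < B) :
    mean hA hN one_pos (∏ v, D.vertexTrace ((c v).1, κ v + 1, (c v).2)) =
      ∑ E ∈ range B, (E.factorial : ℂ)⁻¹ *
        ∑ q ∈ (univ : Finset ((Fin E → β) × Equiv.Perm (Fin E))).filter (fun q =>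
          IsRotation q.1 q.2 ∧ ∀ v, Rotation.valence q.1 v = κ v + 1),
        (∏ v, (Rotation.valence q.1 v : ℂ)) *
          ∑ g ∈ Involution.pairings (Fin E), edgeLoopWeight c q.1 q.2 g := by
  rw [sum_eq_single_of_mem (∑ v, (κ v + 1)) (mem_range.2 hB)]
  · have h1 := Rotation.card_rotations_mul (α := Fin (∑ v, (κ v + 1))) κ (by simp)
    rw [Fintype.card_fin] at h1
    rw [sum_congr rfl (g := fun _ => (∏ v, ((κ v + 1 : ℕ) : ℂ)) *
      mean hA hN one_pos (∏ v, D.vertexTrace ((c v).1, κ v + 1, (c v).2)))]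
    · rw [sum_const, nsmul_eq_mul, ← mul_assoc, ← mul_assoc, mul_assoc _⁻¹, ← Nat.cast_prod,
        ← Nat.cast_mul, h1, inv_mul_cancel₀ (by exact_mod_cast Nat.factorial_ne_zero _), one_mul]
    · intro q hq
      obtain ⟨hq1, hq2⟩ := (mem_filter.1 hq).2
      have h2 := mean_prod_vertexTrace hA hnondeg hN hq1 c
      simp only [hq2] at h2 ⊢
      rw [h2]
      rfl
  · intro E _ hE
    rw [filter_false_of_mem, sum_empty, mul_zero]
    rintro q - ⟨-, hq⟩
    apply hE
    have := Rotation.sum_valence q.1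
    rw [Fintype.card_fin] at this
    rw [← this]
    exact sum_congr rfl fun v _ => hq v

/-- The contribution of a fat graph to the coefficient of `z ^ n`, where `z ^ 2 = T`. -/
def graphTerm {α : Type*} [Fintype α] [DecidableEq α] (n : ℕ) (c : β → Spin × D.Color)
    (vertOf : α → β) (next glue : Equiv.Perm α) (link : Equiv.Perm β) : ℂ :=
  PowerSeries.coeff n
      (scalarSeries (fun v => ((c v).1, Rotation.valence vertOf v, (c v).2)) link) *
    (∏ v, (Rotation.valence vertOf v : ℂ)) * edgeLoopWeight c vertOf next glue

open Classical in
/-- The mean value of a sum over graphs with vertices of bounded valence. -/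
theorem sum_mean_coeff_loopHafnian (hA : ∀ i, D.IsContour i (A i))
    (hnondeg : ∀ i, D.t true 2 i * D.t false 2 i ≠ 1) (hN : 0 < D.N) (n K : ℕ) {B : ℕ}
    (hB : Fintype.card β * K < B) :
    ∑ p : β → D.VertexType K, mean hA hN one_pos (PowerSeries.coeff n
      (Involution.loopHafnian (D.freeTerm ∘ p) (D.linkTerm ∘ Sym2.map p) univ)) =
    ∑ E ∈ range B, (E.factorial : ℂ)⁻¹ *
        ∑ q ∈ (univ : Finset ((Fin E → β) × Equiv.Perm (Fin E))).filter (fun q =>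
          IsRotation q.1 q.2 ∧ ∀ v, Rotation.valence q.1 v ≤ K),
          ∑ g ∈ Involution.pairings (Fin E), ∑ c : β → Spin × D.Color,
            ∑ σ ∈ Involution.involutionsOn univ, graphTerm n c q.1 q.2 g σ := by
  have h1 : ∀ p : β → D.VertexType K, mean hA hN one_pos (PowerSeries.coeff n
      (Involution.loopHafnian (D.freeTerm ∘ p) (D.linkTerm ∘ Sym2.map p) univ)) =
      ∑ E ∈ range B, (E.factorial : ℂ)⁻¹ *
        ∑ q ∈ (univ : Finset ((Fin E → β) × Equiv.Perm (Fin E))).filter (fun q =>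
          IsRotation q.1 q.2), if ∀ v, Rotation.valence q.1 v = (p v).2.1 + 1 then
        ∑ g ∈ Involution.pairings (Fin E), ∑ σ ∈ Involution.involutionsOn univ,
          graphTerm n (fun v => ((p v).1, (p v).2.2)) q.1 q.2 g σ else 0 := by
    intro p
    have h2 : ∑ v, (((p v).2.1 : ℕ) + 1) < B := by
      refine lt_of_le_of_lt ?_ hB
      rw [← smul_eq_mul, ← card_univ]
      exact sum_le_card_nsmul _ _ _ fun v _ => (p v).2.1.2
    rw [mean_coeff_loopHafnian, show (∏ v, D.vertexTrace (p v).data) = ∏ v, D.vertexTrace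
      (((fun v => ((p v).1, (p v).2.2)) v : Spin × D.Color).1, (fun v => ((p v).2.1 : ℕ)) v + 1,
        ((fun v => ((p v).1, (p v).2.2)) v : Spin × D.Color).2) from rfl,
      mean_prod_vertexTrace_eq_sum hA hnondeg hN _ _ h2, mul_sum]
    refine sum_congr rfl fun E _ => ?_
    rw [mul_left_comm, ← filter_filter, sum_filter, mul_sum]
    congr 1
    refine sum_congr rfl fun q hq => ?_
    by_cases hv : ∀ v, Rotation.valence q.1 v = (p v).2.1 + 1
    · rw [if_pos hv, if_pos hv, mul_sum, mul_sum]
      refine sum_congr rfl fun g _ => ?_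
      rw [sum_mul]
      refine sum_congr rfl fun σ _ => ?_
      rw [graphTerm, mul_assoc]
      simp only [hv]
    · rw [if_neg hv, if_neg hv, mul_zero]
  simp only [h1]
  rw [sum_comm]
  refine sum_congr rfl fun E _ => ?_
  rw [← mul_sum, sum_comm]
  congr 1
  rw [← filter_filter, sum_filter (p := fun q : (Fin E → β) × Equiv.Perm (Fin E) =>
    ∀ v, Rotation.valence q.1 v ≤ K)]
  refine sum_congr rfl fun q hq => ?_
  have hq := (mem_filter.1 hq).2
  split_ifs with hK
  · rw [sum_comm (t := (univ : Finset (β → Spin × D.Color))), ← sum_filter]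
    refine sum_bij' (fun p _ v => ((p v).1, (p v).2.2))
      (fun c _ v => ((c v).1, ⟨Rotation.valence q.1 v - 1, ?_⟩, (c v).2)) ?_ ?_ ?_ ?_ ?_
    · have h3 := hK v
      have h4 := hq.valence_pos v
      omega
    · intro p _; exact mem_univ _
    · intro c _
      rw [mem_filter]
      refine ⟨mem_univ _, fun v => ?_⟩
      have h4 := hq.valence_pos v
      simp only
      omega
    · intro p hp
      funext v
      have := (mem_filter.1 hp).2 v
      ext
      · rfl
      · simp only; omega
      · rfl
    · intro c _; rfl
    · intro p hp; rfl
  · refine sum_eq_zero fun p _ => ?_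
    rw [if_neg]
    intro h5
    apply hK
    intro v
    rw [h5 v]
    exact (p v).2.1.2

end TwoMatrixData

/-! ### Sums over isomorphism classes of fat graphs -/

namespace FatGraph

open Equiv Finset

variable {ι : Type}

@[ext]
theorem Iso.ext {G H : FatGraph ι} {f g : Iso G H} (h₁ : f.vert = g.vert) (h₂ : f.dart = g.dart) :
    f = g := by
  cases f
  cases g
  cases h₁
  cases h₂
  rfl

instance (G H : FatGraph ι) : Finite (Iso G H) :=
  Finite.of_injective (fun f : Iso G H => (f.vert, f.dart)) fun _ _ h =>
    Iso.ext (congrArg Prod.fst h) (congrArg Prod.snd h)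

theorem numAut_pos (G : FatGraph ι) : 0 < G.numAut :=
  Nat.card_pos_iff.2 ⟨⟨Iso.refl G⟩, inferInstance⟩

theorem Iso.card_eq_numAut {G H : FatGraph ι} (f : Iso G H) : Nat.card (Iso G H) = G.numAut := by
  refine Nat.card_congr ⟨fun g => g.trans f.symm, fun g => g.trans f, fun g => ?_, fun g => ?_⟩
  · ext <;> simp [Iso.trans, Iso.symm]
  · ext <;> simp [Iso.trans, Iso.symm]

/-- The data of a fat graph with given sets of vertices and darts: the vertices of the darts and
the cyclic order, the gluing, the spins and colours, and the links. -/
abbrev Raw (ι : Type) (V E : ℕ) : Type :=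
  ((Fin E → Fin V) × Perm (Fin E)) × Perm (Fin E) × (Fin V → Spin × ι) × Perm (Fin V)

variable {V E : ℕ}

/-- The conditions on the data of a fat graph. -/
structure Raw.IsFat (t : Raw ι V E) : Prop where
  rotation : IsRotation t.1.1 t.1.2
  glue_glue : ∀ a, t.2.1 (t.2.1 a) = a
  glue_ne : ∀ a, t.2.1 a ≠ a
  color_glue : ∀ a, (t.2.2.1 (t.1.1 (t.2.1 a))).2 = (t.2.2.1 (t.1.1 a)).2
  link_link : ∀ v, t.2.2.2 (t.2.2.2 v) = v
  spin_link : ∀ v, (t.2.2.1 (t.2.2.2 v)).1 = (t.2.2.1 v).1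
  color_link : ∀ v, t.2.2.2 v ≠ v → (t.2.2.1 (t.2.2.2 v)).2 ≠ (t.2.2.1 v).2

variable (ι V E) in
/-- The fat graphs with given sets of vertices and darts. -/
abbrev On : Type := {t : Raw ι V E // t.IsFat}

/-- The fat graph with given data. -/
def On.toGraph (t : On ι V E) : FatGraph ι where
  numVert := V
  numDart := E
  vertOf := t.1.1.1
  next := t.1.1.2
  glue := t.1.2.1
  color v := (t.1.2.2.1 v).2
  spin v := (t.1.2.2.1 v).1
  link := t.1.2.2.2
  vertOf_surjective := t.2.rotation.1
  sameCycle_next_iff := t.2.rotation.2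
  glue_glue := t.2.glue_glue
  glue_ne := t.2.glue_ne
  color_glue := t.2.color_glue
  link_link := t.2.link_link
  spin_link := t.2.spin_link
  color_link := t.2.color_link

/-- Transport of a fat graph along bijections. -/
def transport (G : FatGraph ι) (e : Fin G.numVert ≃ Fin V) (f : Fin G.numDart ≃ Fin E) :
    On ι V E :=
  ⟨((fun a => e (G.vertOf (f.symm a)), (f.symm.trans G.next).trans f),
    (f.symm.trans G.glue).trans f, fun v => (G.spin (e.symm v), G.color (e.symm v)),
    (e.symm.trans G.link).trans e), by
    refine ⟨⟨?_, ?_⟩, ?_, ?_, ?_, ?_, ?_, ?_⟩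
    · exact (e.surjective.comp G.vertOf_surjective).comp f.symm.surjective
    · intro a b
      have h : ((f.symm.trans G.next).trans f) = f.permCongr G.next := rfl
      rw [h, e.apply_eq_iff_eq, ← G.sameCycle_next_iff, Perm.SameCycle, Perm.SameCycle]
      refine exists_congr fun n => ?_
      rw [show (f.permCongr G.next) ^ n = f.permCongr (G.next ^ n) from
        (map_zpow f.permCongrHom G.next n).symm, permCongr_apply, ← eq_symm_apply]
    · intro a; simp [G.glue_glue]
    · intro a h
      apply G.glue_ne (f.symm a)
      simpa [← eq_symm_apply] using h
    · intro a; simp [G.color_glue]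
    · intro v; simp [G.link_link]
    · intro v; simp [G.spin_link]
    · intro v h
      simp only [coe_trans, Function.comp_apply, symm_apply_apply]
      refine G.color_link _ fun h' => h ?_
      simp [h']⟩

/-- The isomorphism to the transported graph. -/
def transportIso (G : FatGraph ι) (e : Fin G.numVert ≃ Fin V) (f : Fin G.numDart ≃ Fin E) :
    Iso G (G.transport e f).toGraph where
  vert := e
  dart := f
  vertOf_dart a := congrArg (fun x => e (G.vertOf x)) (f.symm_apply_apply a)
  next_dart a := congrArg (fun x => f (G.next x)) (f.symm_apply_apply a)
  glue_dart a := congrArg (fun x => f (G.glue x)) (f.symm_apply_apply a)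
  color_vert v := congrArg G.color (e.symm_apply_apply v)
  spin_vert v := congrArg G.spin (e.symm_apply_apply v)
  link_vert v := congrArg (fun x => e (G.link x)) (e.symm_apply_apply v)

theorem bijective_iso_on (G : FatGraph ι) :
    Function.Bijective (fun x : (t : On ι V E) × Iso G t.toGraph =>
      ((x.2.vert, x.2.dart) : (Fin G.numVert ≃ Fin V) × (Fin G.numDart ≃ Fin E))) := by
  constructor
  · have key : ∀ x : (t : On ι V E) × Iso G t.toGraph,
        x = ⟨G.transport x.2.vert x.2.dart, G.transportIso x.2.vert x.2.dart⟩ := by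
      rintro ⟨t, φ⟩
      obtain ⟨e, f, h1, h2, h3, h4, h5, h6⟩ := φ
      change Fin G.numVert ≃ Fin V at e
      change Fin G.numDart ≃ Fin E at f
      have ht : t = G.transport e f := by
        apply Subtype.ext
        refine Prod.ext (Prod.ext ?_ ?_) (Prod.ext ?_ (Prod.ext ?_ ?_))
        · funext a
          exact (congrArg t.1.1.1 (f.apply_symm_apply a)).symm.trans (h1 (f.symm a))
        · ext a : 1
          exact (congrArg t.1.1.2 (f.apply_symm_apply a)).symm.trans (h2 (f.symm a))
        · ext a : 1
          exact (congrArg t.1.2.1 (f.apply_symm_apply a)).symm.trans (h3 (f.symm a))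
        · funext v
          refine (congrArg t.1.2.2.1 (e.apply_symm_apply v)).symm.trans ?_
          exact Prod.ext (h5 (e.symm v)) (h4 (e.symm v))
        · ext v : 1
          exact (congrArg t.1.2.2.2 (e.apply_symm_apply v)).symm.trans (h6 (e.symm v))
      subst ht
      rfl
    intro x y hxy
    exact (key x).trans ((congrArg (fun p : (Fin G.numVert ≃ Fin V) × (Fin G.numDart ≃ Fin E) =>
      (⟨G.transport p.1 p.2, G.transportIso p.1 p.2⟩ : (t : On ι V E) × Iso G t.toGraph))
      hxy).trans (key y).symm)
  · rintro ⟨e, f⟩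
    exact ⟨⟨G.transport e f, G.transportIso e f⟩, rfl⟩

variable [Finite ι]

instance : Finite (On ι V E) := Subtype.finite

/-- The class of a fat graph with given sets of vertices and darts. -/
def On.toClass (t : On ι V E) : IsoClass ι := Quotient.mk (isoSetoid ι) t.toGraph

theorem IsoClass.mk_repr (q : IsoClass ι) : Quotient.mk (isoSetoid ι) q.repr = q :=
  Quotient.out_eq q

theorem On.toClass_eq_iff (t : On ι V E) (q : IsoClass ι) :
    t.toClass = q ↔ Nonempty (Iso q.repr t.toGraph) := by
  rw [eq_comm]
  nth_rewrite 1 [← q.mk_repr]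
  exact Quotient.eq (r := isoSetoid ι)

variable (ι V E) in
/-- The isomorphism classes of the fat graphs with given numbers of vertices and darts. -/
def classesOn : Finset (IsoClass ι) := (Set.finite_range (On.toClass (ι := ι) (V := V) (E := E))).toFinset

theorem mem_classesOn {q : IsoClass ι} :
    q ∈ classesOn ι V E ↔ q.repr.numVert = V ∧ q.repr.numDart = E := by
  rw [classesOn, Set.Finite.mem_toFinset, Set.mem_range]
  constructor
  · rintro ⟨t, ht⟩
    obtain ⟨φ⟩ := (t.toClass_eq_iff q).1 ht
    exact ⟨Fin.equiv_iff_eq.1 ⟨φ.vert⟩, Fin.equiv_iff_eq.1 ⟨φ.dart⟩⟩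
  · rintro ⟨rfl, rfl⟩
    exact ⟨_, (On.toClass_eq_iff _ q).2 ⟨q.repr.transportIso (Equiv.refl _) (Equiv.refl _)⟩⟩

theorem card_fiber_mul_numAut {q : IsoClass ι} (hq : q ∈ classesOn ι V E) :
    Nat.card {t : On ι V E // t.toClass = q} * q.repr.numAut = V.factorial * E.factorial := by
  classical
  cases nonempty_fintype (On ι V E)
  obtain ⟨hV, hE⟩ := mem_classesOn.1 hq
  have h := Nat.card_congr (Equiv.ofBijective _ (bijective_iso_on (V := V) (E := E) q.repr))
  rw [Nat.card_sigma, Nat.card_prod, Nat.card_eq_fintype_card, Nat.card_eq_fintype_card,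
    Fintype.card_equiv (finCongr hV), Fintype.card_equiv (finCongr hE), Fintype.card_fin,
    Fintype.card_fin, hV, hE] at h
  rw [← h, Nat.card_eq_fintype_card, Fintype.card_subtype, ← smul_eq_mul, ← sum_const, sum_filter]
  refine sum_congr rfl fun t _ => ?_
  split_ifs with ht
  · obtain ⟨φ⟩ := (t.toClass_eq_iff q).1 ht
    exact φ.card_eq_numAut.symm
  · rw [On.toClass_eq_iff, not_nonempty_iff] at ht
    simp

/-- A sum over isomorphism classes, weighted by the numbers of automorphisms, as a sum over
labelled graphs. -/
theorem sum_classesOn (F : FatGraph ι → ℂ) (hF : ∀ G H, Iso G H → F G = F H) [Fintype (On ι V E)] :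
    ∑ q ∈ classesOn ι V E, F q.repr / q.repr.numAut =
      (V.factorial : ℂ)⁻¹ * ((E.factorial : ℂ)⁻¹ * ∑ t : On ι V E, F t.toGraph) := by
  classical
  rw [← sum_fiberwise_of_maps_to (s := univ) (t := classesOn ι V E) (g := On.toClass)
    (fun t _ => by simp [classesOn]), mul_sum, mul_sum]
  refine sum_congr rfl fun q hq => ?_
  have h1 := card_fiber_mul_numAut hq
  rw [sum_congr rfl (g := fun _ => F q.repr), sum_const, nsmul_eq_mul]
  · have h2 : (q.repr.numAut : ℂ) ≠ 0 := by exact_mod_cast q.repr.numAut_pos.ne'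
    have h3 : (V.factorial : ℂ) ≠ 0 := by exact_mod_cast V.factorial_ne_zero
    have h4 : (E.factorial : ℂ) ≠ 0 := by exact_mod_cast E.factorial_ne_zero
    rw [Nat.card_eq_fintype_card, Fintype.card_subtype] at h1
    have h5 : ((univ.filter fun t : On ι V E => t.toClass = q).card : ℂ) * q.repr.numAut =
      V.factorial * E.factorial := by exact_mod_cast h1
    rw [div_eq_iff h2]
    calc F q.repr = ((V.factorial : ℂ)⁻¹ * V.factorial) * ((E.factorial : ℂ)⁻¹ * E.factorial) *
        F q.repr := by rw [inv_mul_cancel₀ h3, inv_mul_cancel₀ h4]; ring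
      _ = (V.factorial : ℂ)⁻¹ * (E.factorial : ℂ)⁻¹ * (V.factorial * E.factorial) * F q.repr := by
        ring
      _ = _ := by rw [← h5]; ring
  · intro t ht
    obtain ⟨φ⟩ := (t.toClass_eq_iff q).1 (mem_filter.1 ht).2
    exact (hF _ _ φ).symm

variable (ι) in
open Classical in
/-- The isomorphism classes of the fat graphs with bounded numbers of vertices and darts. -/
def classesBelow (a b : ℕ) : Finset (IsoClass ι) :=
  (range a ×ˢ range b).biUnion fun p => classesOn ι p.1 p.2

theorem mem_classesBelow {a b : ℕ} {q : IsoClass ι} :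
    q ∈ classesBelow ι a b ↔ q.repr.numVert < a ∧ q.repr.numDart < b := by
  simp [classesBelow, mem_classesOn]

theorem sum_classesBelow {M : Type*} [AddCommMonoid M] (a b : ℕ) (f : IsoClass ι → M) :
    ∑ q ∈ classesBelow ι a b, f q =
      ∑ V ∈ range a, ∑ E ∈ range b, ∑ q ∈ classesOn ι V E, f q := by
  classical
  rw [classesBelow, sum_biUnion, sum_product]
  intro p _ p' _ hp
  rw [Function.onFun, disjoint_left]
  intro q hq hq'
  rw [mem_classesOn] at hq hq'
  exact hp (Prod.ext (hq.1.symm.trans hq'.1) (hq.2.symm.trans hq'.2))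

end FatGraph

/-! ### Weights of fat graphs -/

namespace FatGraph

open Equiv Finset

variable {ι : Type} [LinearOrder ι] (G : FatGraph ι)

@[to_additive]
theorem prod_pairs_link {M : Type*} [CommMonoid M] (y : Sym2 (Fin G.numVert) → M) :
    ∏ e ∈ Involution.pairs G.link, y e = ∏ v ∈ G.linkedPairs, y s(v, G.link v) := by
  have hne : ∀ v, G.color v < G.color (G.link v) → G.link v ≠ v := fun v hv h => by
    rw [h] at hv; exact lt_irrefl _ hv
  symm
  refine prod_bij (fun v _ => s(v, G.link v)) ?_ ?_ ?_ ?_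
  · intro v hv
    rw [Involution.mem_pairs G.link_link]
    exact ⟨rfl, (hne v (mem_filter.1 hv).2).symm⟩
  · intro v hv w hw h
    rcases Sym2.eq_iff.1 h with h | h
    · exact h.1
    · have h1 := (mem_filter.1 hv).2
      have h2 := (mem_filter.1 hw).2
      rw [← h.1] at h2
      rw [h.2] at h1
      exact absurd h1 (lt_asymm h2)
  · intro e he
    induction e with | _ v w
    obtain ⟨rfl, hvw⟩ := (Involution.mem_pairs G.link_link).1 he
    rcases lt_or_gt_of_ne (G.color_link v hvw.symm) with h | h
    · refine ⟨G.link v, mem_filter.2 ⟨mem_univ _, ?_⟩, ?_⟩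
      · rw [G.link_link]; exact h
      · rw [G.link_link]; exact Sym2.eq_swap
    · exact ⟨v, mem_filter.2 ⟨mem_univ _, h⟩, rfl⟩
  · intro v _; rfl

@[to_additive]
theorem prod_free_mul_prod_linked {M : Type*} [CommMonoid M] (f : Fin G.numVert → M) :
    (∏ v ∈ G.freeVerts, f v) * ∏ v ∈ G.linkedPairs, f v * f (G.link v) = ∏ v, f v := by
  let y : Sym2 (Fin G.numVert) → M := Sym2.lift ⟨fun v w => f v * f w, fun v w => mul_comm _ _⟩
  rw [← Involution.prod_fixed_mul_prod_pairs G.link_link f y fun _ _ => rfl, prod_pairs_link]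
  rfl

theorem isRotation : IsRotation G.vertOf G.next := ⟨G.vertOf_surjective, G.sameCycle_next_iff⟩

theorem glue_mem_pairings : G.glue ∈ Involution.pairings (Fin G.numDart) :=
  Involution.mem_pairings.2 ⟨G.glue_glue, G.glue_ne⟩

theorem sum_valence : ∑ v, G.valence v = G.numDart := by
  have := Rotation.sum_valence G.vertOf
  rwa [Fintype.card_fin] at this

theorem even_numDart : Even G.numDart := by
  have := Involution.two_mul_card_pairs G.glue_mem_pairings
  rw [Fintype.card_fin] at this
  exact ⟨_, by rw [← this, two_mul]⟩

theorem valence_pos (v : Fin G.numVert) : 0 < G.valence v := G.isRotation.valence_pos v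

/-- The spins and colours of the vertices. -/
def mark (v : Fin G.numVert) : Spin × ι := (G.spin v, G.color v)

theorem prod_pairs_glue [Fintype ι] {M : Type*} [CommMonoid M] (y : Sym2 (Fin G.numDart) → M) :
    ∏ e ∈ Involution.pairs G.glue, y e = ∏ i, ∏ e ∈
      (univ.filter fun a => G.color (G.vertOf a) = i).image (fun a => s(a, G.glue a)), y e := by
  rw [← prod_biUnion]
  · refine prod_congr ?_ fun _ _ => rfl
    ext e
    induction e with | _ a b
    simp only [Involution.mem_pairs G.glue_glue, mem_biUnion, mem_univ, true_and, mem_image,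
      mem_filter]
    constructor
    · rintro ⟨rfl, -⟩
      exact ⟨_, a, rfl, rfl⟩
    · rintro ⟨i, c, -, h⟩
      rcases Sym2.eq_iff.1 h with ⟨rfl, rfl⟩ | ⟨rfl, rfl⟩
      · exact ⟨rfl, (G.glue_ne _).symm⟩
      · exact ⟨G.glue_glue _, G.glue_ne _⟩
  · intro i _ j _ hij
    rw [Function.onFun, disjoint_left]
    intro e he he'
    obtain ⟨a, ha, rfl⟩ := mem_image.1 he
    obtain ⟨b, hb, hab⟩ := mem_image.1 he'
    apply hij
    rw [← (mem_filter.1 ha).2, ← (mem_filter.1 hb).2]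
    rcases Sym2.eq_iff.1 hab with ⟨rfl, -⟩ | ⟨rfl, -⟩
    · rfl
    · exact (G.color_glue a).symm

theorem mem_edgesSame {s : Spin} {i : ι} {a : Fin G.numDart} :
    s(a, G.glue a) ∈ (univ.filter fun a => G.color (G.vertOf a) = i ∧ G.spin (G.vertOf a) = s ∧
      G.spin (G.vertOf (G.glue a)) = s).image (fun a => s(a, G.glue a)) ↔
    G.color (G.vertOf a) = i ∧ G.spin (G.vertOf a) = s ∧ G.spin (G.vertOf (G.glue a)) = s := by
  simp only [mem_image, mem_filter, mem_univ, true_and]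
  constructor
  · rintro ⟨b, hb, h⟩
    rcases Sym2.eq_iff.1 h with ⟨rfl, -⟩ | ⟨rfl, -⟩
    · exact hb
    · rw [G.glue_glue, G.color_glue] at hb
      exact ⟨hb.1, hb.2.2, hb.2.1⟩
  · intro h
    exact ⟨a, h, rfl⟩

theorem edgesSame_subset (s : Spin) (i : ι) :
    (univ.filter fun a => G.color (G.vertOf a) = i ∧ G.spin (G.vertOf a) = s ∧
      G.spin (G.vertOf (G.glue a)) = s).image (fun a => s(a, G.glue a)) ⊆
    (univ.filter fun a => G.color (G.vertOf a) = i).image (fun a => s(a, G.glue a)) :=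
  image_subset_image fun _ ha => mem_filter.2 ⟨mem_univ _, (mem_filter.1 ha).2.1⟩

end FatGraph

namespace TwoMatrixData

open Finset

variable {D : TwoMatrixData}

theorem prod_edgeWeight (G : FatGraph D.Color) :
    ∏ e ∈ Involution.pairs G.glue, edgeWeight (G.mark ∘ G.vertOf) e =
      ∏ i, ((D.N : ℂ)⁻¹ ^ G.numEdges i * (D.t false 2 i ^ G.numEdgesSame true i *
        D.t true 2 i ^ G.numEdgesSame false i *
          ((D.t true 2 i * D.t false 2 i - 1) ^ G.numEdges i)⁻¹)) := by
  rw [G.prod_pairs_glue]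
  refine prod_congr rfl fun i _ => ?_
  have h : ∀ e ∈ (univ.filter fun a => G.color (G.vertOf a) = i).image (fun a => s(a, G.glue a)),
      edgeWeight (G.mark ∘ G.vertOf) e = (D.N : ℂ)⁻¹ * (D.t true 2 i * D.t false 2 i - 1)⁻¹ *
      (if e ∈ (univ.filter fun a => G.color (G.vertOf a) = i ∧ G.spin (G.vertOf a) = true ∧
        G.spin (G.vertOf (G.glue a)) = true).image (fun a => s(a, G.glue a)) then
          D.t false 2 i else 1) *
      (if e ∈ (univ.filter fun a => G.color (G.vertOf a) = i ∧ G.spin (G.vertOf a) = false ∧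
        G.spin (G.vertOf (G.glue a)) = false).image (fun a => s(a, G.glue a)) then
          D.t true 2 i else 1) := by
    intro e he
    obtain ⟨a, ha, rfl⟩ := mem_image.1 he
    obtain rfl := (mem_filter.1 ha).2
    simp only [G.mem_edgesSame, true_and]
    rw [edgeWeight_mk, if_pos (show ((G.mark ∘ G.vertOf) a).2 = ((G.mark ∘ G.vertOf) (G.glue a)).2
      from (G.color_glue a).symm)]
    simp only [Function.comp_apply, FatGraph.mark]
    generalize G.spin (G.vertOf a) = s
    generalize G.spin (G.vertOf (G.glue a)) = s'
    cases s <;> cases s' <;> simp [propagator] <;> ring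
  rw [prod_congr rfl h, prod_mul_distrib, prod_mul_distrib, prod_const, prod_ite_mem, prod_ite_mem,
    inter_eq_right.2 (G.edgesSame_subset _ _), inter_eq_right.2 (G.edgesSame_subset _ _),
    prod_const, prod_const, mul_pow, inv_pow (D.t true 2 i * D.t false 2 i - 1)]
  rw [FatGraph.numEdges, FatGraph.numEdgesSame, FatGraph.numEdgesSame]
  ring

theorem prod_n_pow_numLoops (hN : 0 < D.N) (G : FatGraph D.Color) :
    ∏ i, (D.n i : ℂ) ^ G.numLoops i = ∏ i, ((D.N : ℂ) ^ G.numLoops i * D.ε i ^ G.numLoops i) :=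
  prod_congr rfl fun i _ => by rw [← mul_pow, D.N_mul_ε hN]

theorem N_zpow_eulerChar (hN : 0 < D.N) (G : FatGraph D.Color) :
    (D.N : ℂ) ^ G.eulerChar =
      (∏ i, ((D.N : ℂ) ^ G.numLoops i * (D.N : ℂ)⁻¹ ^ G.numEdges i)) *
        (D.N : ℂ) ^ G.freeVerts.card := by
  have h : (D.N : ℂ) ≠ 0 := by exact_mod_cast hN.ne'
  have hs : ∀ s : Finset D.Color, (D.N : ℂ) ^ (∑ i ∈ s, ((G.numLoops i : ℤ) - G.numEdges i)) =
      ∏ i ∈ s, ((D.N : ℂ) ^ G.numLoops i * (D.N : ℂ)⁻¹ ^ G.numEdges i) := by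
    intro s
    induction s using Finset.induction_on with
    | empty => simp
    | insert i s hi ih =>
      rw [sum_insert hi, prod_insert hi, zpow_add₀ h, ih, zpow_sub₀ h, zpow_natCast, zpow_natCast,
        div_eq_mul_inv, inv_pow]
  rw [FatGraph.eulerChar, zpow_add₀ h, hs, zpow_natCast]

/-- The exponent of `z`, where `z ^ 2 = T`, of a vertex. -/
def vertexExponent (G : FatGraph D.Color) (v : Fin G.numVert) : ℕ :=
  G.valence v - if G.link v = v ∧ D.inPotential (G.spin v) (G.valence v) then 2 else 0

theorem sum_vertexExponent (G : FatGraph D.Color) :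
    ∑ v, vertexExponent G v = 2 * D.nT G := by
  have h1 : ∑ v, vertexExponent G v +
      2 * (G.freeVerts.filter fun v => D.inPotential (G.spin v) (G.valence v)).card =
      G.numDart := by
    have h2 : (G.freeVerts.filter fun v => D.inPotential (G.spin v) (G.valence v)) =
        univ.filter fun v => G.link v = v ∧ D.inPotential (G.spin v) (G.valence v) := by
      rw [FatGraph.freeVerts, filter_filter]
    rw [← G.sum_valence, h2, mul_comm, ← smul_eq_mul, ← sum_const, sum_filter, ← sum_add_distrib]
    refine sum_congr rfl fun v _ => ?_
    rw [vertexExponent]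
    split_ifs with h
    · have := h.2.1; omega
    · simp
  have h3 := G.sum_free_add_sum_linked G.valence
  rw [G.sum_valence] at h3
  obtain ⟨k, hk⟩ := G.even_numDart
  rw [nT, h3]
  omega

theorem vertexExponent_pos (G : FatGraph D.Color) (v : Fin G.numVert) :
    1 ≤ vertexExponent G v ∧ G.valence v ≤ 3 * vertexExponent G v := by
  have := G.valence_pos v
  rw [vertexExponent]
  split_ifs with h
  · have := h.2.1
    omega
  · omega

theorem numVert_le (G : FatGraph D.Color) : G.numVert ≤ 2 * D.nT G := by
  rw [← sum_vertexExponent]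
  calc G.numVert = ∑ _v : Fin G.numVert, 1 := by simp
    _ ≤ _ := sum_le_sum fun v _ => (vertexExponent_pos G v).1

theorem numDart_le (G : FatGraph D.Color) : G.numDart ≤ 6 * D.nT G := by
  have h : G.numDart ≤ 3 * (2 * D.nT G) := by
    rw [← sum_vertexExponent, ← G.sum_valence, mul_sum]
    exact sum_le_sum fun v _ => (vertexExponent_pos G v).2
  omega

theorem nT_le_of_coeff_weight_ne_zero {G : FatGraph D.Color} {m : ℕ}
    (h : PowerSeries.coeff m (D.weight G) ≠ 0) : D.nT G ≤ m := by
  by_contra hlt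
  push Not at hlt
  apply h
  rw [weight, mul_comm (PowerSeries.C _) (PowerSeries.X ^ _), mul_assoc, mul_assoc, mul_assoc,
    PowerSeries.coeff_X_pow_mul', if_neg (by omega)]

/-- The contribution of a fat graph with the spins and colours of its vertices. -/
def fatTerm (n : ℕ) (G : FatGraph D.Color) : ℂ :=
  graphTerm n G.mark G.vertOf G.next G.glue G.link

theorem pairSym_eq (G : FatGraph D.Color) {v : Fin G.numVert} (hv : v ∈ G.linkedPairs) :
    D.pairSym (Sym2.map (fun v => (G.spin v, G.valence v, G.color v)) s(v, G.link v)) =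
      PowerSeries.C (-(D.hh (G.spin v) (G.valence v) (G.color v) (G.valence (G.link v))
        (G.color (G.link v))) / (G.valence v * G.valence (G.link v))) *
        PowerSeries.X ^ (vertexExponent G v + vertexExponent G (G.link v)) := by
  have h := (mem_filter.1 hv).2
  have hne : G.link v ≠ v := fun h' => by rw [h'] at h; exact lt_irrefl _ h
  rw [Sym2.map_mk, pairSym, Sym2.lift_mk]
  simp only [pairSeries]
  rw [if_pos ⟨(G.spin_link v).symm, h.ne⟩, vertexExponent, vertexExponent,
    if_neg fun h' => hne h'.1, if_neg fun h' => hne (by simpa [G.link_link] using h'.1.symm),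
    Nat.sub_zero, Nat.sub_zero]

theorem scalarSeries_eq (G : FatGraph D.Color) :
    scalarSeries (fun v => (G.spin v, G.valence v, G.color v)) G.link =
      PowerSeries.C ((∏ v ∈ G.freeVerts, (-(D.N : ℂ) / G.valence v)) *
        ∏ v ∈ G.linkedPairs, (-(D.hh (G.spin v) (G.valence v) (G.color v) (G.valence (G.link v))
        (G.color (G.link v))) / (G.valence v * G.valence (G.link v)))) *
      PowerSeries.expand 2 two_ne_zero (PowerSeries.X ^ D.nT G *
        ∏ v ∈ G.freeVerts, D.vertexWeight (G.spin v) (G.valence v) (G.color v)) := by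
  have h1 : ∏ e ∈ Involution.pairs G.link,
      D.pairSym (e.map fun v => (G.spin v, G.valence v, G.color v)) =
      (∏ v ∈ G.linkedPairs, PowerSeries.C (-(D.hh (G.spin v) (G.valence v) (G.color v)
        (G.valence (G.link v)) (G.color (G.link v))) / (G.valence v * G.valence (G.link v)))) *
      PowerSeries.X ^ ∑ v ∈ G.linkedPairs, (vertexExponent G v + vertexExponent G (G.link v)) := by
    rw [G.prod_pairs_link fun e => D.pairSym (e.map fun v => (G.spin v, G.valence v, G.color v)),
      prod_congr rfl fun v hv => pairSym_eq G hv, prod_mul_distrib, prod_pow_eq_pow_sum]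
  have h2 : ∏ v ∈ G.freeVerts, D.vertexSeries (G.spin v) (G.valence v) (G.color v) =
      (∏ v ∈ G.freeVerts, PowerSeries.C (-(D.N : ℂ) / G.valence v)) *
      ((PowerSeries.X : PowerSeries ℂ) ^ (∑ v ∈ G.freeVerts, vertexExponent G v) *
        PowerSeries.expand 2 two_ne_zero (∏ v ∈ G.freeVerts,
          D.vertexWeight (G.spin v) (G.valence v) (G.color v))) := by
    rw [← prod_pow_eq_pow_sum, map_prod, ← prod_mul_distrib, ← prod_mul_distrib]
    refine prod_congr rfl fun v hv => ?_
    have hv' : G.link v = v := (mem_filter.1 hv).2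
    rw [vertexSeries, PowerSeries.smul_eq_C_mul, vertexExponent]
    simp only [hv', true_and]
  have h3 := G.sum_free_add_sum_linked (vertexExponent G)
  rw [sum_vertexExponent] at h3
  change (∏ v ∈ G.freeVerts, D.vertexSeries (G.spin v) (G.valence v) (G.color v)) * _ = _
  rw [h1, h2, map_mul (PowerSeries.expand 2 two_ne_zero), map_pow, PowerSeries.expand_X, ← pow_mul,
    ← h3, pow_add, map_mul PowerSeries.C, map_prod PowerSeries.C, map_prod PowerSeries.C]
  ring

/-- The contribution of a fat graph is the coefficient of its weight, up to the number of its
automorphisms. -/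
theorem fatTerm_div_numAut (hN : 0 < D.N) (m : ℕ) (G : FatGraph D.Color) :
    fatTerm (2 * m) G / G.numAut = PowerSeries.coeff m (D.weight G) := by
  have hk : ∀ v, (G.valence v : ℂ) ≠ 0 := fun v => by exact_mod_cast (G.valence_pos v).ne'
  have h1 : fatTerm (2 * m) G = PowerSeries.coeff (2 * m)
      (scalarSeries (fun v => (G.spin v, G.valence v, G.color v)) G.link) *
      (∏ v, (G.valence v : ℂ)) * ((∏ e ∈ Involution.pairs G.glue,
        edgeWeight (G.mark ∘ G.vertOf) e) * ∏ i, (D.n i : ℂ) ^ G.numLoops i) := rfl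
  have h2 : ∏ v, (G.valence v : ℂ) = (∏ v ∈ G.freeVerts, (G.valence v : ℂ)) *
      ∏ v ∈ G.linkedPairs, ((G.valence v : ℂ) * G.valence (G.link v)) :=
    (G.prod_free_mul_prod_linked fun v => (G.valence v : ℂ)).symm
  have h3 : (∏ v ∈ G.freeVerts, (-(D.N : ℂ) / G.valence v)) * (∏ v ∈ G.freeVerts,
      (G.valence v : ℂ)) = (-1) ^ G.freeVerts.card * (D.N : ℂ) ^ G.freeVerts.card := by
    rw [← prod_mul_distrib, prod_congr rfl fun v _ => div_mul_cancel₀ _ (hk v), prod_const,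
      neg_pow]
  have h4 : (∏ v ∈ G.linkedPairs, (-(D.hh (G.spin v) (G.valence v) (G.color v)
      (G.valence (G.link v)) (G.color (G.link v))) / (G.valence v * G.valence (G.link v)))) *
      (∏ v ∈ G.linkedPairs, ((G.valence v : ℂ) * G.valence (G.link v))) =
      (-1) ^ G.linkedPairs.card * ∏ v ∈ G.linkedPairs, D.hh (G.spin v) (G.valence v) (G.color v)
        (G.valence (G.link v)) (G.color (G.link v)) := by
    rw [← prod_mul_distrib, prod_congr rfl fun v _ =>
      div_mul_cancel₀ _ (mul_ne_zero (hk v) (hk (G.link v))), prod_neg]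
  rw [h1, scalarSeries_eq, PowerSeries.coeff_C_mul, PowerSeries.coeff_expand_mul, prod_edgeWeight,
    prod_n_pow_numLoops hN, h2]
  have h5 : D.weight G = PowerSeries.C (((-1) ^ G.numCentres * (D.N : ℂ) ^ G.eulerChar / G.numAut) *
      (∏ v ∈ G.linkedPairs,
      D.hh (G.spin v) (G.valence v) (G.color v) (G.valence (G.link v)) (G.color (G.link v))) *
      (∏ i, (D.ε i ^ G.numLoops i *
      D.t false 2 i ^ G.numEdgesSame true i * D.t true 2 i ^ G.numEdgesSame false i *
      ((D.t true 2 i * D.t false 2 i - 1) ^ G.numEdges i)⁻¹))) * (PowerSeries.X ^ D.nT G *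
        ∏ v ∈ G.freeVerts, D.vertexWeight (G.spin v) (G.valence v) (G.color v)) := by
    rw [weight, map_mul, map_mul]
    ring
  have h6 : (∏ i, ((D.N : ℂ)⁻¹ ^ G.numEdges i * (D.t false 2 i ^ G.numEdgesSame true i *
        D.t true 2 i ^ G.numEdgesSame false i *
          ((D.t true 2 i * D.t false 2 i - 1) ^ G.numEdges i)⁻¹))) *
      (∏ i, ((D.N : ℂ) ^ G.numLoops i * D.ε i ^ G.numLoops i)) =
      (∏ i, ((D.N : ℂ) ^ G.numLoops i * (D.N : ℂ)⁻¹ ^ G.numEdges i)) *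
      ∏ i, (D.ε i ^ G.numLoops i *
      D.t false 2 i ^ G.numEdgesSame true i * D.t true 2 i ^ G.numEdgesSame false i *
      ((D.t true 2 i * D.t false 2 i - 1) ^ G.numEdges i)⁻¹) := by
    rw [← prod_mul_distrib, ← prod_mul_distrib]
    exact prod_congr rfl fun i _ => by ring
  rw [h6, h5, PowerSeries.coeff_C_mul, N_zpow_eulerChar hN, FatGraph.numCentres, pow_add]
  generalize PowerSeries.coeff m (PowerSeries.X ^ D.nT G *
    ∏ v ∈ G.freeVerts, D.vertexWeight (G.spin v) (G.valence v) (G.color v)) = w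
  generalize (∏ i, (D.ε i ^ G.numLoops i *
    D.t false 2 i ^ G.numEdgesSame true i * D.t true 2 i ^ G.numEdgesSame false i *
      ((D.t true 2 i * D.t false 2 i - 1) ^ G.numEdges i)⁻¹)) = u
  generalize (∏ i, ((D.N : ℂ) ^ G.numLoops i * (D.N : ℂ)⁻¹ ^ G.numEdges i)) = u'
  revert h3 h4
  generalize (∏ v ∈ G.linkedPairs, (-(D.hh (G.spin v) (G.valence v) (G.color v)
    (G.valence (G.link v)) (G.color (G.link v))) / (G.valence v * G.valence (G.link v)))) = b
  generalize (∏ v ∈ G.linkedPairs, ((G.valence v : ℂ) * G.valence (G.link v))) = b'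
  generalize (∏ v ∈ G.freeVerts, (-(D.N : ℂ) / G.valence v)) = a
  generalize (∏ v ∈ G.freeVerts, (G.valence v : ℂ)) = a'
  intro h3 h4
  linear_combination (w * u * u' / G.numAut) * (b * b' * h3 +
    (-1) ^ G.freeVerts.card * (D.N : ℂ) ^ G.freeVerts.card * h4)

end TwoMatrixData

/-! ### The sum over all graphs -/

namespace TwoMatrixData

open Finset

variable {D : TwoMatrixData} {A : D.Color → Matrix Spin Spin ℂ}

section Invariance

variable {α α' β β' : Type*} [Fintype α] [DecidableEq α] [Fintype β] [DecidableEq β]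
  [Fintype α'] [DecidableEq α'] [Fintype β'] [DecidableEq β']

theorem _root_.Involution.prod_pairs_congr {M : Type*} [CommMonoid M] {σ : Equiv.Perm α}
    {σ' : Equiv.Perm α'} (f : α ≃ α') (h : ∀ a, σ' (f a) = f (σ a)) (y : Sym2 α' → M) :
    ∏ e ∈ Involution.pairs σ', y e = ∏ e ∈ Involution.pairs σ, y (e.map f) := by
  rw [← prod_image fun _ _ _ _ h' => Sym2.map.injective f.injective h']
  refine prod_congr ?_ fun _ _ => rfl
  rw [Involution.pairs, Involution.pairs, image_image]
  ext e
  simp only [mem_image, mem_filter, mem_univ, true_and, Function.comp_apply, Sym2.map_mk]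
  constructor
  · rintro ⟨a, ha, rfl⟩
    refine ⟨f.symm a, fun h' => ha ?_, ?_⟩
    · rw [← f.apply_symm_apply a, h, h']
    · rw [← h, f.apply_symm_apply]
  · rintro ⟨a, ha, rfl⟩
    refine ⟨f a, fun h' => ha ?_, ?_⟩
    · rw [h] at h'
      exact f.injective h'
    · rw [h]

theorem _root_.Rotation.valence_congr {vertOf : α → β} {vertOf' : α' → β'} (f : α ≃ α')
    (e : β ≃ β') (h : ∀ a, vertOf' (f a) = e (vertOf a)) (v : β) :
    Rotation.valence vertOf' (e v) = Rotation.valence vertOf v := by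
  rw [Rotation.valence, Rotation.valence, ← card_map f.toEmbedding]
  congr 1
  ext a
  obtain ⟨b, rfl⟩ := f.surjective a
  simp [h]

theorem _root_.Rotation.numCycles_congr {ι : Type*} [Fintype ι] [DecidableEq ι]
    {π : Equiv.Perm α} {π' : Equiv.Perm α'} {col : α → ι} {col' : α' → ι} (f : α ≃ α')
    (hπ : ∀ a, π' (f a) = f (π a)) (hcol : ∀ a, col' (f a) = col a) (i : ι) :
    Rotation.numCycles π' col' i = Rotation.numCycles π col i := by
  have h1 : ∀ n : ℕ, ∀ a, (π' ^ n) (f a) = f ((π ^ n) a) := by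
    intro n a
    induction n with
    | zero => rfl
    | succ n ih => rw [pow_succ', Equiv.Perm.mul_apply, ih, hπ, pow_succ', Equiv.Perm.mul_apply]
  have h2 : ∀ a b, π.SameCycle a b ↔ π'.SameCycle (f a) (f b) := by
    intro a b
    constructor
    · intro h
      obtain ⟨n, rfl⟩ := h.exists_nat_pow_eq
      exact ⟨n, by rw [zpow_natCast, h1]⟩
    · intro h
      obtain ⟨n, hn⟩ := h.exists_nat_pow_eq
      rw [h1] at hn
      exact ⟨n, by rw [zpow_natCast]; exact f.injective hn⟩
  let F : Quotient (Equiv.Perm.SameCycle.setoid π) ≃ Quotient (Equiv.Perm.SameCycle.setoid π') :=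
    Quotient.congr f h2
  rw [Rotation.numCycles, Rotation.numCycles, ← Set.ncard_image_of_injective _ F.injective]
  congr 1
  ext q
  simp only [Set.mem_image, Set.mem_ofPred_eq, exists_exists_and_eq_and]
  constructor
  · rintro ⟨a, ha, rfl⟩
    refine ⟨f.symm a, ?_, ?_⟩
    · rw [← hcol, f.apply_symm_apply, ha]
    · exact congrArg (Quotient.mk _) (f.apply_symm_apply a)
  · rintro ⟨a, ha, rfl⟩
    exact ⟨f a, by rw [hcol, ha], rfl⟩

theorem graphTerm_congr (n : ℕ) {c : β → Spin × D.Color} {c' : β' → Spin × D.Color}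
    {vertOf : α → β} {vertOf' : α' → β'} {next glue : Equiv.Perm α} {next' glue' : Equiv.Perm α'}
    {link : Equiv.Perm β} {link' : Equiv.Perm β'} (f : α ≃ α') (e : β ≃ β')
    (hvert : ∀ a, vertOf' (f a) = e (vertOf a)) (hnext : ∀ a, next' (f a) = f (next a))
    (hglue : ∀ a, glue' (f a) = f (glue a)) (hc : ∀ v, c' (e v) = c v)
    (hlink : ∀ v, link' (e v) = e (link v)) :
    graphTerm n c' vertOf' next' glue' link' = graphTerm n c vertOf next glue link := by
  have hval := Rotation.valence_congr f e hvert
  have h1 : scalarSeries (fun v => ((c' v).1, Rotation.valence vertOf' v, (c' v).2)) link' =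
      scalarSeries (fun v => ((c v).1, Rotation.valence vertOf v, (c v).2)) link := by
    rw [scalarSeries, scalarSeries]
    congr 1
    · rw [prod_filter, prod_filter, ← e.prod_comp]
      refine prod_congr rfl fun v _ => ?_
      simp only [hlink, e.apply_eq_iff_eq, hc, hval]
    · rw [Involution.prod_pairs_congr e hlink]
      refine prod_congr rfl fun p _ => ?_
      rw [Sym2.map_map]
      congr 2
      funext v
      simp only [Function.comp_apply, hc, hval]
  have h2 : edgeLoopWeight c' vertOf' next' glue' = edgeLoopWeight c vertOf next glue := by
    rw [edgeLoopWeight, edgeLoopWeight, Involution.prod_pairs_congr f hglue]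
    congr 1
    · refine prod_congr rfl fun p _ => ?_
      induction p with | _ a b
      rw [Sym2.map_mk, edgeWeight_mk, edgeWeight_mk]
      simp only [Function.comp_apply, hvert, hc]
    · refine prod_congr rfl fun i _ => ?_
      rw [Rotation.numCycles_congr f (fun a => by
        rw [Equiv.Perm.mul_apply, hglue, hnext, Equiv.Perm.mul_apply]) fun a => by
          rw [hvert, hc]]
  rw [graphTerm, graphTerm, h1, h2, ← e.prod_comp]
  simp only [hval]

end Invariance

theorem fatTerm_congr (n : ℕ) (G H : FatGraph D.Color) (φ : G.Iso H) :
    fatTerm n G = fatTerm n H :=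
  (graphTerm_congr n φ.dart φ.vert φ.vertOf_dart φ.next_dart φ.glue_dart
    (fun v => Prod.ext (φ.spin_vert v) (φ.color_vert v)) φ.link_vert).symm

open Classical in
theorem sum_graphTerm_eq_sum_fatTerm (n : ℕ) {V E : ℕ} (P : (Fin E → Fin V) → Prop) :
    ∑ q ∈ (univ : Finset ((Fin E → Fin V) × Equiv.Perm (Fin E))).filter (fun q =>
        IsRotation q.1 q.2 ∧ P q.1),
      ∑ g ∈ Involution.pairings (Fin E), ∑ c : Fin V → Spin × D.Color,
        ∑ σ ∈ Involution.involutionsOn univ, graphTerm n c q.1 q.2 g σ =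
    ∑ t : FatGraph.On D.Color V E, if P t.1.1.1 then fatTerm n t.toGraph else 0 := by
  have h1 : ∑ t : FatGraph.On D.Color V E, (if P t.1.1.1 then fatTerm n t.toGraph else 0) =
      ∑ t ∈ (univ : Finset (FatGraph.Raw D.Color V E)).filter fun t => t.IsFat ∧ P t.1.1,
        graphTerm n t.2.2.1 t.1.1 t.1.2 t.2.1 t.2.2.2 := by
    rw [← filter_filter, sum_filter (p := fun t : FatGraph.Raw D.Color V E => P t.1.1),
      sum_subtype (p := FatGraph.Raw.IsFat) _ (by simp)]
    rfl
  rw [h1]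
  simp only [← sum_product']
  symm
  refine sum_subset ?_ ?_
  · intro t ht
    obtain ⟨ht, hP⟩ := (mem_filter.1 ht).2
    simp only [mem_product, mem_filter, mem_univ, true_and, Involution.mem_pairings,
      Involution.mem_involutionsOn, not_true_eq_false, false_imp_iff, implies_true, and_true]
    exact ⟨⟨ht.rotation, hP⟩, ⟨ht.glue_glue, ht.glue_ne⟩, ht.link_link⟩
  · rintro ⟨⟨vo, nx⟩, g, c, σ⟩ ht hn
    simp only [mem_product, mem_filter, mem_univ, true_and, Involution.mem_pairings,
      Involution.mem_involutionsOn, not_true_eq_false, false_imp_iff, implies_true,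
      and_true] at ht hn
    obtain ⟨⟨h2, hP⟩, ⟨h3, h4⟩, h5⟩ := ht
    simp only [graphTerm]
    by_cases h6 : ∀ a, (c (vo (g a))).2 = (c (vo a)).2
    · have h7 : ¬∀ v, σ v ≠ v → (c (σ v)).1 = (c v).1 ∧ (c (σ v)).2 ≠ (c v).2 := by
        intro h7
        refine hn ⟨⟨h2, h3, h4, h6, h5, fun v => ?_, fun v hv => (h7 v hv).2⟩, hP⟩
        by_cases hv : σ v = v
        · exact congrArg (fun w => (c w).1) hv
        · exact (h7 v hv).1
      push Not at h7
      obtain ⟨v, hv, h7⟩ := h7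
      rw [scalarSeries, prod_eq_zero (s := Involution.pairs σ) (i := s(v, σ v))
        ((Involution.mem_pairs h5).2 ⟨rfl, hv.symm⟩), mul_zero, map_zero, zero_mul, zero_mul]
      rw [Sym2.map_mk, pairSym, Sym2.lift_mk]
      simp only [pairSeries]
      rw [if_neg]
      rintro ⟨h8, h9⟩
      exact h9 (h7 h8.symm).symm
    · push Not at h6
      obtain ⟨a, ha⟩ := h6
      rw [edgeLoopWeight, prod_eq_zero (s := Involution.pairs g) (i := s(a, g a))
        ((Involution.mem_pairs h3).2 ⟨rfl, (h4 a).symm⟩), zero_mul, mul_zero]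
      rw [edgeWeight_mk, if_neg]
      exact fun h => ha h.symm

theorem coeff_graphSeries (m : ℕ) {a b : ℕ} (ha : 2 * m < a) (hb : 6 * m < b) :
    PowerSeries.coeff m D.graphSeries =
      ∑ q ∈ FatGraph.classesBelow D.Color a b, PowerSeries.coeff m (D.weight q.repr) := by
  rw [graphSeries, PowerSeries.coeff_mk]
  refine finsum_eq_sum_of_support_subset _ fun q hq => ?_
  have h := nT_le_of_coeff_weight_ne_zero hq
  have h1 := D.numVert_le q.repr
  have h2 := D.numDart_le q.repr
  rw [mem_coe, FatGraph.mem_classesBelow]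
  omega

theorem finite_setOf_nT_le (m : ℕ) :
    {q : FatGraph.IsoClass D.Color | D.nT q.repr ≤ m}.Finite := by
  refine (FatGraph.classesBelow D.Color (2 * m + 1) (6 * m + 1)).finite_toSet.subset fun q hq => ?_
  have h : D.nT q.repr ≤ m := hq
  have h1 := D.numVert_le q.repr
  have h2 := D.numDart_le q.repr
  rw [mem_coe, FatGraph.mem_classesBelow]
  omega

/-- The mean value of the exponential of the interaction is the sum over the graphs. -/
theorem mean_coeff_fexp_exponent (hA : ∀ i, D.IsContour i (A i))
    (hnondeg : ∀ i, D.t true 2 i * D.t false 2 i ≠ 1) (hN : 0 < D.N) (m : ℕ) :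
    mean hA hN one_pos (PowerSeries.coeff (2 * m) (PowerSeries.fexp
      ((-(D.N : ℂ)) • D.potentialSeries +
        ∑ s : Spin, ∑ i, ∑ j ∈ Finset.univ.filter (· < i), D.pairLog s i j))) =
    PowerSeries.coeff m D.graphSeries := by
  classical
  obtain ⟨K, hK1, hK2⟩ : ∃ K, (∀ s, D.d s + 1 ≤ K) ∧ 6 * m + 1 ≤ K :=
    ⟨6 * m + 1 + D.d₁ + D.d₂, fun s => by cases s <;> simp only [d] <;> omega, by omega⟩
  obtain ⟨B, hB⟩ : ∃ B, B = 4 * m * K + 6 * m + 1 := ⟨_, rfl⟩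
  obtain ⟨i₀⟩ : Nonempty D.Color := by
    by_contra h
    rw [not_nonempty_iff] at h
    simp [N] at hN
  rw [← PowerSeries.coeff_fexp_congr fun p hp => D.coeff_exponent hN hK1 (p := p) (by omega),
    Involution.coeff_fexp_eq_sum_loopHafnian ((true, ⟨0, by omega⟩, i₀) : D.VertexType K)
      D.freeTerm D.linkTerm D.constantCoeff_freeTerm D.constantCoeff_linkTerm, map_sum,
    coeff_graphSeries m (a := 2 * (2 * m) + 1) (b := B) (by omega)
      (by rw [hB]; exact Nat.lt_succ_of_le (Nat.le_add_left _ _)),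
    FatGraph.sum_classesBelow]
  refine sum_congr rfl fun V hV => ?_
  rw [map_smul, map_sum, sum_mean_coeff_loopHafnian hA hnondeg hN (2 * m) K (B := B), smul_eq_mul,
    mul_sum]
  · refine sum_congr rfl fun E _ => ?_
    refine (congrArg (fun x => (V.factorial : ℂ)⁻¹ * ((E.factorial : ℂ)⁻¹ * x))
      (Eq.trans (sum_congr (Finset.ext fun q => by simp only [mem_filter]) fun _ _ => rfl)
        (sum_graphTerm_eq_sum_fatTerm (2 * m) fun vo => ∀ v, Rotation.valence vo v ≤ K))).trans ?_
    symm
    rw [sum_congr rfl fun q _ => (fatTerm_div_numAut hN m (FatGraph.IsoClass.repr q)).symm,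
      FatGraph.sum_classesOn (fatTerm (2 * m)) (fatTerm_congr (2 * m))]
    congr 2
    refine sum_congr rfl fun t _ => ?_
    by_cases ht : ∀ v, Rotation.valence t.1.1.1 v ≤ K
    · rw [if_pos ht]
    · rw [if_neg ht]
      by_contra hne
      apply ht
      have h1 : PowerSeries.coeff m (D.weight t.toGraph) ≠ 0 := by
        rw [← fatTerm_div_numAut hN]
        exact div_ne_zero hne (by exact_mod_cast t.toGraph.numAut_pos.ne')
      have h2 := D.numDart_le t.toGraph
      have h3 := nT_le_of_coeff_weight_ne_zero h1
      intro v
      have h4 : t.toGraph.valence v ≤ t.toGraph.numDart := by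
        rw [← t.toGraph.sum_valence]
        exact single_le_sum (f := t.toGraph.valence) (fun _ _ => Nat.zero_le _) (mem_univ v)
      have h5 : Rotation.valence t.1.1.1 v ≤ t.toGraph.numDart := h4
      omega
  · rw [Fintype.card_fin, hB]
    have : V * K ≤ 4 * m * K := Nat.mul_le_mul_right _ (by rw [mem_range] at hV; omega)
    omega

end TwoMatrixData

end

namespace TwoMatrixData

open Finset

variable {D : TwoMatrixData}

theorem pt_injective (hξ : ∀ i, (derivative D.V₁).eval (D.ξ i) = D.η i)
    (hη : ∀ i, (derivative D.V₂).eval (D.η i) = D.ξ i)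
    (hdist : Function.Injective fun i => (D.ξ i, D.η i)) (s : Spin) :
    Function.Injective (D.pt s) := by
  intro i j h
  apply hdist
  cases s
  · change D.η i = D.η j at h
    exact Prod.ext (show D.ξ i = D.ξ j by rw [← hη, ← hη, h]) h
  · change D.ξ i = D.ξ j at h
    exact Prod.ext h (show D.η i = D.η j by rw [← hξ, ← hξ, h])

theorem prod_sub_pow_eq :
    (∏ s : Spin, ∏ i, ∏ j ∈ univ.filter (· < i), (D.pt s i - D.pt s j) ^ (D.n i * D.n j)) =
      ∏ i, ∏ j ∈ univ.filter (i < ·),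
        ((D.ξ i - D.ξ j) * (D.η i - D.η j)) ^ (D.n i * D.n j) := by
  rw [Fintype.prod_bool, ← prod_mul_distrib]
  simp only [← prod_mul_distrib, prod_filter]
  rw [prod_comm]
  refine prod_congr rfl fun i _ => prod_congr rfl fun j _ => ?_
  split_ifs
  · rw [← mul_pow, mul_comm (D.n j)]
    congr 1
    simp only [pt]
    ring
  · exact one_mul 1

theorem prod_expOver {ι : Type*} (s : Finset ι) (f : ι → ℂ) :
    ∏ i ∈ s, expOver (f i) = expOver (∑ i ∈ s, f i) := by
  classical
  induction s using Finset.induction_on with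
  | empty => rfl
  | insert i s hi ih =>
    rw [prod_insert hi, sum_insert hi, ih, expOver, expOver, expOver,
      AddMonoidAlgebra.single_mul_single, one_mul]

theorem ofSeries_mul (f g : PowerSeries ℂ) : ofSeries (f * g) = ofSeries f * ofSeries g := by
  rw [ofSeries, ofSeries, ofSeries, AddMonoidAlgebra.single_mul_single, add_zero]

end TwoMatrixData

theorem mainTheorem12 (D : TwoMatrixData)
    (hV₁ : D.V₁.natDegree = D.d₁ + 1) (hV₂ : D.V₂.natDegree = D.d₂ + 1)
    (hξ : ∀ i, (derivative D.V₁).eval (D.ξ i) = D.η i)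
    (hη : ∀ i, (derivative D.V₂).eval (D.η i) = D.ξ i)
    (hdist : Function.Injective fun i => (D.ξ i, D.η i))
    (hnondeg : ∀ i, D.t true 2 i * D.t false 2 i ≠ 1)
    (hN : 0 < D.N) :
    (∀ i, ∃ A, D.IsContour i A) ∧
    ∀ A : D.Color → Matrix Spin Spin ℂ, (∀ i, D.IsContour i (A i)) →
      -- the Gaussian integrals make sense
      (∀ T : ℝ, 0 < T →
        MeasureTheory.Integrable (D.gaussWeight A T) ∧ (∫ u, D.gaussWeight A T u) ≠ 0 ∧
        ∀ l : ℕ, MeasureTheory.Integrable fun u =>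
          (D.interaction A u ^ l * D.dets A u) * D.gaussWeight A T u) ∧
      -- the terms of the expansion are polynomials in `T`, without terms of degree less than `l/2`
      (∀ (l : ℕ) (T : ℝ), 0 < T → D.gaussTerm A l T = (D.termPoly A l).eval (T : ℂ)) ∧
      (∀ k l : ℕ, 2 * k < l → D.coeffA A k l = 0) ∧
      -- finitely many graphs contribute to each power of `T`
      (∀ m : ℕ, {q : FatGraph.IsoClass D.Color | D.nT q.repr ≤ m}.Finite ∧
        {q : FatGraph.IsoClass D.Color | PowerSeries.coeff m (D.weight q.repr) ≠ 0}.Finite) ∧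
      -- the partition function is the generating function of the graphs
      D.Zform A =
        (∏ i, TwoMatrixData.expOver (-((D.N : ℂ) ^ 2 * D.ε i * D.action i))) *
        TwoMatrixData.ofSeries (PowerSeries.C (∏ i, ∏ j ∈ Finset.univ.filter (i < ·),
          ((D.ξ i - D.ξ j) * (D.η i - D.η j)) ^ (D.n i * D.n j))) *
        TwoMatrixData.ofSeries D.graphSeries := by
  have hV := D.natDegree_V hV₁ hV₂
  refine ⟨fun i => D.exists_isContour (hnondeg i), fun A hA =>
    ⟨fun T hT => ⟨?_, TwoMatrixData.integral_gaussWeight_ne_zero hA hN hT,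
      fun l => TwoMatrixData.integrable_interaction_mul_dets hA hN hT l⟩,
    fun l T hT => TwoMatrixData.gaussTerm_eq_eval_termPoly hA hnondeg hN hV l hT,
    fun k l h => TwoMatrixData.coeffA_eq_zero hA hnondeg hN hV h,
    fun m => ⟨TwoMatrixData.finite_setOf_nT_le m, (TwoMatrixData.finite_setOf_nT_le m).subset
      fun q hq => TwoMatrixData.nT_le_of_coeff_weight_ne_zero hq⟩, ?_⟩⟩
  · simpa using TwoMatrixData.integrable_eval_mul_gaussWeight hA hN hT 1
  · have h1 : -(D.N : ℂ) * ∑ i, (D.n i : ℂ) * D.action i =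
        ∑ i, -((D.N : ℂ) ^ 2 * D.ε i * D.action i) := by
      rw [Finset.mul_sum]
      refine Finset.sum_congr rfl fun i _ => ?_
      rw [← D.N_mul_ε hN]
      ring
    rw [TwoMatrixData.Zform, TwoMatrixData.prod_expOver, h1, mul_assoc,
      ← TwoMatrixData.ofSeries_mul]
    congr 2
    ext m
    have h2 : PowerSeries.constantCoeff ((-(D.N : ℂ)) • D.potentialSeries) = 0 := by
      rw [← PowerSeries.coeff_zero_eq_constantCoeff_apply, PowerSeries.coeff_complex_smul,
        PowerSeries.coeff_zero_eq_constantCoeff_apply, D.constantCoeff_potentialSeries, smul_zero]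
    have h3 : PowerSeries.constantCoeff (∑ s : Spin, ∑ i, ∑ j ∈ Finset.univ.filter (· < i),
        D.pairLog s i j) = 0 := by
      simp only [map_sum, D.constantCoeff_pairLog, Finset.sum_const_zero]
    rw [PowerSeries.coeff_mk, TwoMatrixData.sum_coeffA_eq hA hnondeg hN hV,
      D.scale_detsOf_genMat (TwoMatrixData.pt_injective hξ hη hdist), mul_smul_comm,
      ← PowerSeries.fexp_add h2 h3, PowerSeries.coeff_complex_smul, map_smul,
      TwoMatrixData.mean_coeff_fexp_exponent hA hnondeg hN, PowerSeries.coeff_C_mul, smul_eq_mul,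
      TwoMatrixData.prod_sub_pow_eq]
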